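/- **Theorem 3.8 (Characterization of Quasi-Convex Fans).** *Setting.* Let $V$ be a real vector space of finite dimension $n$. A cone in $V$ is a strictly convex polyhedral cone, that is, a finite intersection of half-spaces $\{\alpha\ge 0\}$ ($\alpha \in V^*$) such that the forms $\alpha$ have only the zero $0\in V$ in common. A face of $\sigma$ is a set $\sigma\cap\ker\beta$ with $\beta\in V^*$, $\beta|_\sigma\ge 0$. We write $\tau\preceq\sigma$ for faces, $V_\sigma$ for the linear span of $\sigma$, $\dim\sigma=\dim V_\sigma$, and $\partial\sigma$ for the set of proper faces of $\sigma$; a facet is a face of codimension one. A fan is a non-empty finite set of cones that contains all faces of its members and in which any two members intersect in a common face. A fan $\Delta$ in $V$ is *purely $n$-dimensional* if its maximal cones are exactly its $n$-dimensional cones; then its boundary fan $\partial\Delta$ (possibly empty) consists of the faces of those $(n-1)$-dimensional cones of $\Delta$ that are facets of precisely one $n$-dimensional cone of $\Delta$. For $\sigma\in\Delta$, the transversal fan $\Delta_\sigma$ is the fan in $V/V_\sigma$ consisting of the images of the cones $\gamma\in\Delta$ with $\sigma\preceq\gamma$; if $\Delta$ is purely $n$-dimensional, then $\Delta_\sigma$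 is purely $(n-\dim\sigma)$-dimensional. The fan $\Delta$ is a topological space whose open sets are its subfans (including $\emptyset$). A sheaf $\mathcal F$ on $\Delta$ is the same as a family of values $\mathcal F(\sigma)$, $\sigma\in\Delta$, with compatible restriction maps $\mathcal F(\sigma)\to\mathcal F(\tau)$ for $\tau\preceq\sigma$; for a subfan $\Lambda$, $\mathcal F(\Lambda)$ is the set of families in $\prod_{\sigma\in\Lambda}\mathcal F(\sigma)$ that are compatible with restriction. Choose an orientation of $V_\sigma$ for each $\sigma\in\Delta$, constant on the $n$-dimensional cones; for a facet $\tau$ of $\sigma$ let $\mathrm{or}^\sigma_\tau=1$ if the orientation of $V_\tau$ followed by the inward normal is the orientation of $V_\sigma$, and $\mathrm{or}^\sigma_\tau=-1$ otherwise. For a sheaf $\mathcal F$ of real vector spaces on a purely $n$-dimensional fan $\Delta$, the augmented relative cellular cochain complex $\tilde C^\bullet(\Delta,\partial\Delta;\mathcal F)$ is $$0\to\mathcal F(\Delta)\xrightarrow{\delta^{-1}}C^0\xrightarrow{\delta^0}C^1\to\dots\to C^n\to 0,\qquad C^k=\bigoplus_{\sigma\in\Delta\setminus\partial\Delta,\ \dim\sigma=n-k}\mathcal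 F(\sigma),$$ where $\delta^{-1}$ is restriction to the $n$-dimensional cones and $\delta^k(f)_\tau=\sum_\sigma \mathrm{or}^\sigma_\tau\, f_\sigma|_\tau$, the sum being over the $\sigma$ of which $\tau$ is a facet. Its cohomology is denoted by $\tilde H^\bullet(\Delta,\partial\Delta;\mathcal F)$; up to isomorphism it does not depend on the orientations. Let $A=S(V^*)$ and $A_\sigma=S(V_\sigma^*)$, graded so that linear forms have degree $2$, let $\mathfrak m=A^{>0}$, and put $\overline F=F/\mathfrak mF$ for an $A$-module $F$. A *minimal extension sheaf* on $\Delta$ is a sheaf $\mathcal E$ of graded modules over the sheaf of graded algebras $\sigma\mapsto A_\sigma$ such that $\mathcal E(o)\cong A_o=\mathbb R$ as graded modules for the zero cone $o$; $\mathcal E(\sigma)$ is a free $A_\sigma$-module for each $\sigma\in\Delta$; and for each $\sigma\in\Delta\setminus\{o\}$ the restriction $\mathcal E(\sigma)\to\mathcal E(\partial\sigma)$ induces an isomorphism $\overline{\mathcal E(\sigma)}\to\overline{\mathcal E(\partial\sigma)}$. *Theorem.* Let $\Delta$ be a purely $n$-dimensional fan in $V$, and let $\mathcal E$ be a minimal extension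 sheaf on $\Delta$. Then the following statements are equivalent: (i) for each cone $\sigma\in\Delta$, $\tilde H^\bullet(\Delta_\sigma,\partial\Delta_\sigma;\mathbb R)=0$, where $\mathbb R$ is the constant sheaf; (ii) $\tilde H^\bullet(\Delta,\partial\Delta;\mathcal E)=0$; (iii) $\Delta$ is quasi-convex, i.e. the $A$-module $\mathcal E(\Delta)$ of global sections is free. -/

import Mathlib

universe u w

noncomputable section

namespace QCFan

/-! ### Cones and fans -/

section Fans

variable {V : Type u} [AddCommGroup V] [Module ℝ V]

/-- A (strictly convex polyhedral) cone: a finite intersection of half-spaces `α ≥ 0` such that the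
linear forms `α` have no common zero except the origin. -/
def IsPolyCone (σ : PointedCone ℝ V) : Prop :=
  ∃ S : Finset (Module.Dual ℝ V),
    (∀ v, v ∈ σ ↔ ∀ α ∈ S, 0 ≤ α v) ∧ ∀ v, (∀ α ∈ S, α v = 0) → v = 0

/-- `τ` is a face of `σ`: `τ = σ ∩ ker β` for a linear form `β` that is nonnegative on `σ`. -/
def IsFace (τ σ : PointedCone ℝ V) : Prop :=
  ∃ β : Module.Dual ℝ V, (∀ v ∈ σ, 0 ≤ β v) ∧ ∀ v, v ∈ τ ↔ v ∈ σ ∧ β v = 0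

/-- A fan: a non-empty finite set of cones that contains all faces of its members, and in which any
two members intersect in a common face. -/
structure IsFan (Δ : Finset (PointedCone ℝ V)) : Prop where
  nonempty : Δ.Nonempty
  isPolyCone : ∀ σ ∈ Δ, IsPolyCone σ
  face_mem : ∀ σ ∈ Δ, ∀ τ, IsFace τ σ → τ ∈ Δ
  inter_left : ∀ σ ∈ Δ, ∀ σ' ∈ Δ, IsFace (σ ⊓ σ') σ
  inter_right : ∀ σ ∈ Δ, ∀ σ' ∈ Δ, IsFace (σ ⊓ σ') σ'

/-- For two cones of a fan, being a face is the same as being contained. Therefore the face relation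
between cones of a fan is written `≤` everywhere below. -/
theorem IsFan.isFace_iff_le {Δ : Finset (PointedCone ℝ V)} (h : IsFan Δ) {τ σ : PointedCone ℝ V}
    (hτ : τ ∈ Δ) (hσ : σ ∈ Δ) : IsFace τ σ ↔ τ ≤ σ := by
  constructor
  · rintro ⟨β, -, hβ⟩ v hv
    exact ((hβ v).1 hv).1
  · intro hle
    have := h.inter_right τ hτ σ hσ
    rwa [inf_eq_left.2 hle] at this

/-- The linear span `V_σ` of a cone. -/
def lspan (σ : PointedCone ℝ V) : Submodule ℝ V := Submodule.span ℝ (σ : Set V)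

theorem lspan_mono {τ σ : PointedCone ℝ V} (h : τ ≤ σ) : lspan τ ≤ lspan σ :=
  Submodule.span_mono h

/-- The dimension of a cone. -/
def cdim (σ : PointedCone ℝ V) : ℕ := Module.finrank ℝ (lspan σ)

/-- `Δ` is purely `n`-dimensional, where `n = dim V`: the maximal cones of `Δ` are exactly its
`n`-dimensional cones. -/
def IsPure (Δ : Finset (PointedCone ℝ V)) : Prop :=
  ∀ σ ∈ Δ, Maximal (fun γ => γ ∈ Δ) σ ↔ cdim σ = Module.finrank ℝ V

/-- The boundary fan `∂Δ`: it is generated by those `(n-1)`-dimensional cones of `Δ` that are facets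
of precisely one `n`-dimensional cone of `Δ`. It may be empty. -/
def boundary (Δ : Finset (PointedCone ℝ V)) : Set (PointedCone ℝ V) :=
  {τ | τ ∈ Δ ∧ ∃ ρ ∈ Δ, cdim ρ + 1 = Module.finrank ℝ V ∧
    (∃! σ, σ ∈ Δ ∧ cdim σ = Module.finrank ℝ V ∧ ρ ≤ σ) ∧ τ ≤ ρ}

open Classical in
/-- The transversal fan `Δ_σ` in `V / V_σ`: the images of the cones of `Δ` that have `σ` as a
face. -/
def transversal (Δ : Finset (PointedCone ℝ V)) (σ : PointedCone ℝ V) :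
    Finset (PointedCone ℝ (V ⧸ lspan σ)) :=
  (Δ.filter fun γ => σ ≤ γ).image (PointedCone.map (lspan σ).mkQ)

end Fans

/-! ### Orientations -/

section Orientations

variable {V : Type u} [AddCommGroup V] [Module ℝ V]

/-- A choice of an orientation of `V_σ` for each cone `σ` of `Δ`, constant on the `n`-dimensional
cones. An orientation is a nonzero top-degree alternating form up to positive factors, and
`someVector` is a form that represents it. Constancy says that the forms of two `n`-dimensional cones
never have opposite signs on the same family of `n` vectors. -/
structure Orient (Δ : Finset (PointedCone ℝ V)) where
  or : ∀ σ : Δ, Orientation ℝ (lspan σ.1) (Fin (cdim σ.1))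
  const : ∀ σ σ' : Δ, cdim σ.1 = Module.finrank ℝ V → cdim σ'.1 = Module.finrank ℝ V →
    ∀ (c : Fin (cdim σ.1) → lspan σ.1) (c' : Fin (cdim σ'.1) → lspan σ'.1),
      (∀ (i : Fin (cdim σ.1)) (j : Fin (cdim σ'.1)), (i : ℕ) = j → (c i : V) = c' j) →
        0 ≤ (or σ).someVector c * (or σ').someVector c'

open Classical in
/-- The orientation coefficient of a facet `τ` of `σ`: it is `1` if the orientation of `V_τ`
followed by the inward normal is the orientation of `V_σ`, and `-1` otherwise. Here `b` is a basis of
`V_τ`, and `c` is the basis of `V_σ` that consists of `b` followed by a vector of `σ` outside `V_τ`;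
such a vector lies on the same side of `V_τ` in `V_σ` as the inward normal. The condition says that
`b` is positively oriented if and only if `c` is. -/
def Orient.coeff {Δ : Finset (PointedCone ℝ V)} (o : Orient Δ) (σ τ : Δ) : ℤ :=
  if ∃ (b : Fin (cdim τ.1) → lspan τ.1) (c : Fin (cdim σ.1) → lspan σ.1),
      (∀ (i : Fin (cdim τ.1)) (j : Fin (cdim σ.1)), (i : ℕ) = j → (b i : V) = c j) ∧
      (∀ j : Fin (cdim σ.1), (j : ℕ) = cdim τ.1 → (c j : V) ∈ σ.1) ∧
      0 < (o.or τ).someVector b * (o.or σ).someVector c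
  then 1 else -1

end Orientations

/-! ### Sheaves of modules on a fan space and the cellular cochain complex -/

section Sheaves

variable {V : Type u} [AddCommGroup V] [Module ℝ V]

/-- A sheaf of `R`-modules on the fan space `Δ` (whose open sets are the subfans). The affine subfans
`⟨σ⟩` form a basis of the topology, and they cannot be covered by smaller open sets; so a sheaf is the
same thing as the collection of the modules `F(σ) = F(⟨σ⟩)` together with compatible restriction maps
`F(σ) → F(τ)` for faces `τ` of `σ`. -/
structure FanSheaf (R : Type*) [CommRing R] (Δ : Finset (PointedCone ℝ V)) where
  obj : Δ → Type w
  [addCommGroup : ∀ σ, AddCommGroup (obj σ)]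
  [module : ∀ σ, Module R (obj σ)]
  res : ∀ {σ τ : Δ}, τ.1 ≤ σ.1 → (obj σ →ₗ[R] obj τ)
  res_self : ∀ (σ : Δ) (h : σ.1 ≤ σ.1) (x : obj σ), res h x = x
  res_res : ∀ {σ τ ρ : Δ} (h : τ.1 ≤ σ.1) (h' : ρ.1 ≤ τ.1) (x : obj σ),
    res h' (res h x) = res (h'.trans h) x

attribute [instance] FanSheaf.addCommGroup FanSheaf.module

/-- The constant sheaf. -/
def constSheaf (R : Type w) [CommRing R] (Δ : Finset (PointedCone ℝ V)) : FanSheaf.{u, w} R Δ where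
  obj _ := R
  res _ := LinearMap.id
  res_self _ _ _ := rfl
  res_res _ _ _ := rfl

variable {R : Type*} [CommRing R] {Δ : Finset (PointedCone ℝ V)}

namespace FanSheaf

/-- The module `F(Λ)` of sections over a subfan `Λ`: families of elements of the `F(σ)`, `σ ∈ Λ`,
that are compatible with restriction to faces. -/
def sections (F : FanSheaf.{u, w} R Δ) (Λ : Set Δ) :
    Submodule R (∀ σ : Λ, F.obj σ.1) where
  carrier := {f | ∀ (σ τ : Λ) (h : τ.1.1 ≤ σ.1.1), F.res h (f σ) = f τ}
  add_mem' := by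
    intro f g hf hg σ τ h
    simp only [Pi.add_apply, map_add, hf σ τ h, hg σ τ h]
  zero_mem' := by
    intro σ τ h
    simp
  smul_mem' := by
    intro a f hf σ τ h
    simp only [Pi.smul_apply, map_smul, hf σ τ h]

/-- The module `F(Δ)` of global sections. -/
abbrev global (F : FanSheaf.{u, w} R Δ) : Submodule R (∀ σ : (Set.univ : Set Δ), F.obj σ.1) :=
  F.sections Set.univ

/-- The boundary fan `∂σ` of a cone `σ ∈ Δ`: all its proper faces. -/
def properFaces (σ : Δ) : Set Δ := {τ | τ.1 ≤ σ.1 ∧ τ ≠ σ}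

/-- The restriction map `F(σ) → F(∂σ)`. -/
def resBoundary (F : FanSheaf.{u, w} R Δ) (σ : Δ) : F.obj σ →ₗ[R] F.sections (properFaces σ) :=
  LinearMap.codRestrict _ (LinearMap.pi fun τ => F.res τ.2.1) fun x τ _ h =>
    F.res_res τ.2.1 h x

end FanSheaf

/-- The cones of codimension `k` in `Δ` that do not belong to `Λ`. -/
abbrev Cell (Δ : Finset (PointedCone ℝ V)) (Λ : Set (PointedCone ℝ V)) (k : ℕ) : Type u :=
  {σ : Δ // σ.1 ∉ Λ ∧ cdim σ.1 + k = Module.finrank ℝ V}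

instance (Δ : Finset (PointedCone ℝ V)) (Λ : Set (PointedCone ℝ V)) (k : ℕ) :
    Fintype (Cell Δ Λ k) := Fintype.ofFinite _

namespace FanSheaf

/-- The relative cellular cochains `C^k(Δ, Λ; F) = C^k(Δ; F) / C^k(Λ; F)`, where `C^k(Δ; F)` is the
direct sum of the `F(σ)` over all cones `σ ∈ Δ` of dimension `n - k`: the summands that remain in the
quotient are those with `σ ∉ Λ`. -/
abbrev Cochain (F : FanSheaf.{u, w} R Δ) (Λ : Set (PointedCone ℝ V)) (k : ℕ) :=
  ∀ σ : Cell Δ Λ k, F.obj σ.1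

open Classical in
/-- The coboundary operator `δ^k : C^k(Δ, Λ; F) → C^{k+1}(Δ, Λ; F)`,
`δ(f)_τ = ∑ or^σ_τ f_σ|_τ`, the sum being over the cones `σ` that have `τ` as a facet. -/
def coboundary (F : FanSheaf.{u, w} R Δ) (o : Orient Δ) (Λ : Set (PointedCone ℝ V)) (k : ℕ) :
    F.Cochain Λ k →ₗ[R] F.Cochain Λ (k + 1) :=
  LinearMap.pi fun τ => ∑ σ : Cell Δ Λ k,
    if h : τ.1.1 ≤ σ.1.1 then o.coeff σ.1 τ.1 • (F.res h ∘ₗ LinearMap.proj σ) else 0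

/-- The augmentation `δ^{-1} : F(Δ) → C^0(Δ, ∂Δ; F)`, which restricts a global section to the
`n`-dimensional cones. -/
def augmentation (F : FanSheaf.{u, w} R Δ) : F.global →ₗ[R] F.Cochain (boundary Δ) 0 :=
  (LinearMap.pi fun σ : Cell Δ (boundary Δ) 0 =>
    LinearMap.proj (⟨σ.1, trivial⟩ : (Set.univ : Set Δ))) ∘ₗ F.global.subtype

/-- The augmented relative cellular complex
`0 → F(Δ) → C^0(Δ, ∂Δ; F) → C^1(Δ, ∂Δ; F) → ⋯ → C^n(Δ, ∂Δ; F) → 0` is acyclic. (The cochain modules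
in degrees above `n` are zero.) -/
def IsAugAcyclic (F : FanSheaf.{u, w} R Δ) (o : Orient Δ) : Prop :=
  Function.Injective F.augmentation ∧
  Function.Exact F.augmentation (F.coboundary o (boundary Δ) 0) ∧
  ∀ k : ℕ, Function.Exact (F.coboundary o (boundary Δ) k) (F.coboundary o (boundary Δ) (k + 1))

end FanSheaf

end Sheaves

/-! ### Symmetric algebras, the structure sheaf and minimal extension sheaves -/

section Minimal

/-- The algebra `S(M*)` of polynomial functions on `M`. -/
abbrev Pol (M : Type*) [AddCommGroup M] [Module ℝ M] : Type _ :=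
  SymmetricAlgebra ℝ (Module.Dual ℝ M)

/-- The homogeneous part of degree `j` of `S(M*)`, where `S^q(M*)` has degree `2q` and all other
degrees are zero. -/
def Pol.deg (M : Type*) [AddCommGroup M] [Module ℝ M] (j : ℤ) : Submodule ℝ (Pol M) :=
  ⨆ (q : ℕ) (_ : j = 2 * (q : ℤ)),
    (LinearMap.range (SymmetricAlgebra.ι ℝ (Module.Dual ℝ M))) ^ q

/-- The maximal ideal of `S(M*)` generated by the elements of positive degree, that is, by the linear
forms. -/
def Pol.maxIdeal (M : Type*) [AddCommGroup M] [Module ℝ M] : Ideal (Pol M) :=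
  Ideal.span (Set.range (SymmetricAlgebra.ι ℝ (Module.Dual ℝ M)))

/-- The algebra homomorphism `S(N*) → S(M*)` induced by a linear map `M → N`. -/
def Pol.comap {M N : Type*} [AddCommGroup M] [Module ℝ M] [AddCommGroup N] [Module ℝ N]
    (f : M →ₗ[ℝ] N) : Pol N →ₐ[ℝ] Pol M :=
  SymmetricAlgebra.lift (SymmetricAlgebra.ι ℝ (Module.Dual ℝ M) ∘ₗ f.dualMap)

theorem Pol.comap_comap {M N P : Type*} [AddCommGroup M] [Module ℝ M] [AddCommGroup N]
    [Module ℝ N] [AddCommGroup P] [Module ℝ P] (f : M →ₗ[ℝ] N) (g : N →ₗ[ℝ] P) (a : Pol P) :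
    Pol.comap f (Pol.comap g a) = Pol.comap (g ∘ₗ f) a := by
  have : (Pol.comap f).comp (Pol.comap g) = Pol.comap (g ∘ₗ f) := by
    apply SymmetricAlgebra.algHom_ext
    ext x
    simp [Pol.comap]
    rfl
  exact DFunLike.congr_fun this a

variable {V : Type u} [AddCommGroup V] [Module ℝ V]

/-- The restriction `A_σ → A_τ` of the structure sheaf, for a face `τ` of `σ`. -/
def polRes {τ σ : PointedCone ℝ V} (h : τ ≤ σ) : Pol (lspan σ) →ₐ[ℝ] Pol (lspan τ) :=
  Pol.comap (Submodule.inclusion (lspan_mono h))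

/-- The restriction `A = S(V*) → A_σ`. -/
def polToCone (V : Type u) [AddCommGroup V] [Module ℝ V] (σ : PointedCone ℝ V) :
    Pol V →ₐ[ℝ] Pol (lspan σ) :=
  Pol.comap (lspan σ).subtype

theorem polRes_polToCone {τ σ : PointedCone ℝ V} (h : τ ≤ σ) (a : Pol V) :
    polRes h (polToCone V σ a) = polToCone V τ a := by
  unfold polRes polToCone
  rw [Pol.comap_comap, Submodule.subtype_comp_inclusion]

/-- A sheaf of graded modules over the sheaf of graded algebras `σ ↦ A_σ = S(V_σ*)` on the fan space
`Δ`, described through its values on cones: each `E(σ)` is a (ℤ-)graded `A_σ`-module, and the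
restriction maps are compatible with the module structures and the gradings. -/
structure GradedSheaf (Δ : Finset (PointedCone ℝ V)) where
  obj : Δ → Type w
  [addCommGroup : ∀ σ, AddCommGroup (obj σ)]
  [module : ∀ σ, Module (Pol (lspan σ.1)) (obj σ)]
  gr : ∀ σ, ℤ → AddSubgroup (obj σ)
  isInternal : ∀ σ, DirectSum.IsInternal (gr σ)
  smul_mem : ∀ (σ : Δ) (i j : ℤ) (a : Pol (lspan σ.1)) (x : obj σ),
    a ∈ Pol.deg (lspan σ.1) i → x ∈ gr σ j → a • x ∈ gr σ (i + j)
  res : ∀ {σ τ : Δ}, τ.1 ≤ σ.1 → (obj σ →+ obj τ)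
  res_smul : ∀ {σ τ : Δ} (h : τ.1 ≤ σ.1) (a : Pol (lspan σ.1)) (x : obj σ),
    res h (a • x) = polRes h a • res h x
  res_mem : ∀ {σ τ : Δ} (h : τ.1 ≤ σ.1) (j : ℤ) (x : obj σ), x ∈ gr σ j → res h x ∈ gr τ j
  res_self : ∀ (σ : Δ) (h : σ.1 ≤ σ.1) (x : obj σ), res h x = x
  res_res : ∀ {σ τ ρ : Δ} (h : τ.1 ≤ σ.1) (h' : ρ.1 ≤ τ.1) (x : obj σ),
    res h' (res h x) = res (h'.trans h) x

attribute [instance] GradedSheaf.addCommGroup GradedSheaf.module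

namespace GradedSheaf

variable {Δ : Finset (PointedCone ℝ V)}

/-- The underlying sheaf of `A`-modules, where `A = S(V*)` acts on `E(σ)` through `A → A_σ`. -/
def toFanSheaf (E : GradedSheaf.{u, w} Δ) : FanSheaf.{u, w} (Pol V) Δ where
  obj := E.obj
  addCommGroup := E.addCommGroup
  module σ := Module.compHom (E.obj σ) (polToCone V σ.1).toRingHom
  res {σ τ} h :=
    letI : Module (Pol V) (E.obj σ) := Module.compHom (E.obj σ) (polToCone V σ.1).toRingHom
    letI : Module (Pol V) (E.obj τ) := Module.compHom (E.obj τ) (polToCone V τ.1).toRingHom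
    { E.res h with
      map_smul' := fun a x => by
        change E.res h (polToCone V σ.1 a • x) = polToCone V τ.1 a • E.res h x
        rw [E.res_smul, polRes_polToCone] }
  res_self := E.res_self
  res_res := E.res_res

/-- The residue class module `F / 𝔪F` of an `A`-module, where `𝔪` is the homogeneous maximal
ideal of `A = S(V*)`. -/
abbrev Residue (V : Type u) [AddCommGroup V] [Module ℝ V] (F : Type*) [AddCommGroup F]
    [Module (Pol V) F] :=
  F ⧸ (Pol.maxIdeal V • (⊤ : Submodule (Pol V) F))

/-- The map of residue class modules induced by an `A`-linear map. -/
def residueMap {F G : Type*} [AddCommGroup F] [Module (Pol V) F] [AddCommGroup G]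
    [Module (Pol V) G] (φ : F →ₗ[Pol V] G) : Residue V F →ₗ[Pol V] Residue V G :=
  Submodule.mapQ _ _ φ (Submodule.smul_top_le_comap_smul_top _ φ)

/-- Minimal extension sheaves. -/
structure IsMinimalExtension (E : GradedSheaf.{u, w} Δ) : Prop where
  /-- Normalization: on the zero cone `o`, the graded module `E(o)` is isomorphic to `A_o = ℝ`. -/
  normalization : ∀ σ : Δ, σ.1 = ⊥ →
    ∃ e : E.obj σ ≃ₗ[Pol (lspan σ.1)] Pol (lspan σ.1),
      ∀ (j : ℤ) (x : E.obj σ), x ∈ E.gr σ j ↔ e x ∈ Pol.deg (lspan σ.1) j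
  /-- Pointwise freeness. -/
  free : ∀ σ : Δ, Module.Free (Pol (lspan σ.1)) (E.obj σ)
  /-- Local minimal extension modulo `𝔪`: for each nonzero cone `σ`, the restriction
  `E(σ) → E(∂σ)` induces an isomorphism of the residue class modules. -/
  lme : ∀ σ : Δ, σ.1 ≠ ⊥ → Function.Bijective (residueMap (E.toFanSheaf.resBoundary σ))

end GradedSheaf

/-- A fan with minimal extension sheaf `E` is called quasi-convex if the `A`-module `E(Δ)` of global
sections is free. -/
def IsQuasiConvex {Δ : Finset (PointedCone ℝ V)} (E : GradedSheaf.{u, w} Δ) : Prop :=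
  Module.Free (Pol V) E.toFanSheaf.global

end Minimal

end QCFan

end

noncomputable section

set_option linter.unusedSectionVars false

namespace QCFan

/-! ### Polyhedral geometry of fans -/

section Geometry

open Module

variable {V : Type u} [AddCommGroup V] [Module ℝ V]

/-! All three statements are compared with one condition: for every cone `s`, the complex of the
star sheaf of `s` (value ℝ on the cones containing `s`, zero elsewhere) is exact at every `C^k`.
Injectivity of the augmentation is automatic on a pure fan.

Condition (i) is this condition read in the quotient. The cones of the transversal fan are the
images of the cones containing `s`, boundary cones correspond to boundary cones, and the orientation
coefficients agree up to a sign attached to each cone; rescaling cochains by these signs identifies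
the complexes (`IsFan.transversal_isAugAcyclic_iff`).

The condition implies (ii) because graded Nakayama makes `E` flabby. As a sheaf of real vector
spaces, a flabby sheaf is the product over `γ` of star sheaves with coefficients in the kernel of
`E(γ) → E(∂γ)` (`FanSheaf.exactAt_of_starSheaf`).

For (ii) ⇒ (iii), `E(σ)` is a finite free `A_σ`-module, so its projective dimension over `A` is at
most the codimension of `σ`, and that of `C^k` is at most `k`. Descending along the exact complex
bounds the dimension of the kernel of `δ^k` by `k`. For `k = 0` this kernel is `E(Δ)`, which is
therefore projective, and a finitely generated graded projective module is free.

The return from (iii) is by induction on `k` and, for fixed `k`, downwards on `s`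
(`starSheaf_exactAt`). Exactness below degree `k` and freeness of `E(Δ)` bound the projective
dimension of `C^k` modulo coboundaries by `k + 1`. A nonzero element of the kernel of `E(s) → E(∂s)`
realizes the star sheaf of `s` as a retract of `E`. The class of a star cocycle is killed by every
linear form vanishing on `V_s`, since only components at cones larger than `s` survive the
multiplication and these are exact by induction. Such forms contain a regular sequence of length
`codim s`; when this exceeds `k + 1`, a depth argument makes the class zero.

The cases `codim s ≤ k + 1` need no algebra beyond degree zero. Either there are no cells, or `s` is
the only one, or `s` has codimension `k + 1`. In the last case with `k > 0`, a functional vanishing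
on coboundaries is turned into a function on the atoms over `s`, which is constant by connectedness
of the atoms in each cone and exactness at `C^0` (`starSheaf_exactAt_penultimate`). -/

theorem cone_smul_mem {σ : PointedCone ℝ V} {c : ℝ} (hc : 0 ≤ c) {v : V} (hv : v ∈ σ) :
    c • v ∈ σ :=
  Submodule.smul_mem σ (⟨c, hc⟩ : NNReal) hv

theorem mem_lspan {σ : PointedCone ℝ V} {v : V} (hv : v ∈ σ) : v ∈ lspan σ :=
  Submodule.subset_span hv

theorem lspan_le {σ : PointedCone ℝ V} {U : Submodule ℝ V} : lspan σ ≤ U ↔ ∀ v ∈ σ, v ∈ U :=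
  Submodule.span_le

theorem dual_eq_zero_of_mem_lspan {σ : PointedCone ℝ V} {β : Dual ℝ V} (h : ∀ v ∈ σ, β v = 0)
    {v : V} (hv : v ∈ lspan σ) : β v = 0 :=
  (lspan_le (U := LinearMap.ker β)).2 h hv

/-- `p` lies in the relative interior of `σ`. -/
def IsRelInt (σ : PointedCone ℝ V) (p : V) : Prop :=
  p ∈ σ ∧ ∀ β : Dual ℝ V, (∀ v ∈ σ, 0 ≤ β v) → β p = 0 → ∀ v ∈ lspan σ, β v = 0

/-- Sum a finite subset of `σ` that spans `V_σ`: a form nonnegative on `σ` that kills the sum kills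
every summand. -/
theorem exists_isRelInt [FiniteDimensional ℝ V] (σ : PointedCone ℝ V) : ∃ p, IsRelInt σ p := by
  obtain ⟨s, hs, hspan⟩ := (Submodule.fg_span_iff_fg_span_finset_subset (R := ℝ) (σ : Set V)).1
    (IsNoetherian.noetherian _)
  refine ⟨∑ x ∈ s, x, σ.sum_mem fun x hx => hs hx, fun β hβ h0 v hv => ?_⟩
  rw [map_sum, Finset.sum_eq_zero_iff_of_nonneg fun x hx => hβ x (hs hx)] at h0
  have : Submodule.span ℝ (s : Set V) ≤ LinearMap.ker β := Submodule.span_le.2 h0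
  exact this (hspan ▸ hv)

theorem IsRelInt.add {σ : PointedCone ℝ V} {p v : V} (hp : IsRelInt σ p) (hv : v ∈ σ) :
    IsRelInt σ (p + v) := by
  refine ⟨add_mem hp.1 hv, fun β hβ h0 => hp.2 β hβ ?_⟩
  rw [map_add] at h0
  linarith [hβ p hp.1, hβ v hv]

/-- The finite set `S` of linear forms defines the cone `σ`. -/
def DefinedBy (σ : PointedCone ℝ V) (S : Finset (Dual ℝ V)) : Prop :=
  ∀ v, v ∈ σ ↔ ∀ α ∈ S, 0 ≤ α v

theorem DefinedBy.nonneg {σ : PointedCone ℝ V} {S : Finset (Dual ℝ V)} (hS : DefinedBy σ S)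
    {α : Dual ℝ V} (hα : α ∈ S) : ∀ v ∈ σ, 0 ≤ α v :=
  fun v hv => (hS v).1 hv α hα

/-- Only forms active at `p` restrict the direction. The finitely many others are positive at `p`
and remain so for small `ε`. -/
theorem DefinedBy.exists_add_smul_mem {σ : PointedCone ℝ V} {S : Finset (Dual ℝ V)}
    (hS : DefinedBy σ S) {p v : V} (hp : p ∈ σ) (h : ∀ α ∈ S, α p = 0 → 0 ≤ α v) :
    ∃ ε : ℝ, 0 < ε ∧ p + ε • v ∈ σ := by
  have key : ∀ᶠ ε in nhdsWithin (0 : ℝ) (Set.Ioi 0), ∀ α ∈ S, 0 ≤ α (p + ε • v) := by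
    rw [Filter.eventually_all_finset]
    intro α hα
    rcases (hS.nonneg hα p hp).eq_or_lt with h0 | h0
    · filter_upwards [self_mem_nhdsWithin] with ε hε
      rw [map_add, map_smul, ← h0, zero_add]
      exact mul_nonneg (le_of_lt hε) (h α hα h0.symm)
    · have ht : Filter.Tendsto (fun ε : ℝ => α p + ε * α v) (nhdsWithin 0 (Set.Ioi 0))
          (nhds (α p + 0 * α v)) := by
        refine Filter.Tendsto.mono_left (Continuous.tendsto ?_ _) nhdsWithin_le_nhds
        fun_prop
      rw [zero_mul, add_zero] at ht
      filter_upwards [ht.eventually (lt_mem_nhds h0)] with ε hε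
      rw [map_add, map_smul]
      exact hε.le
  obtain ⟨ε, h1, h2⟩ := (key.and self_mem_nhdsWithin).exists
  exact ⟨ε, h2, (hS _).2 h1⟩

theorem mem_of_add_smul_mem {U : Submodule ℝ V} {p v : V} {ε : ℝ} (hε : 0 < ε) (hp : p ∈ U)
    (h : p + ε • v ∈ U) : v ∈ U :=
  (Submodule.smul_mem_iff U hε.ne').1 ((Submodule.add_mem_iff_right U hp).1 h)

variable {Δ : Finset (PointedCone ℝ V)}

theorem IsFan.exists_definedBy (h : IsFan Δ) {σ : PointedCone ℝ V} (hσ : σ ∈ Δ) :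
    ∃ S, DefinedBy σ S ∧ ∀ v, (∀ α ∈ S, α v = 0) → v = 0 :=
  h.isPolyCone σ hσ

theorem IsFan.exists_dual (h : IsFan Δ) {τ σ : PointedCone ℝ V} (hτ : τ ∈ Δ) (hσ : σ ∈ Δ)
    (hle : τ ≤ σ) : ∃ β : Dual ℝ V, (∀ v ∈ σ, 0 ≤ β v) ∧ (∀ v, v ∈ τ ↔ v ∈ σ ∧ β v = 0) ∧
      ∀ v ∈ lspan τ, β v = 0 := by
  obtain ⟨β, h1, h2⟩ := (h.isFace_iff_le hτ hσ).2 hle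
  exact ⟨β, h1, h2, fun v hv => dual_eq_zero_of_mem_lspan (fun w hw => ((h2 w).1 hw).2) hv⟩

theorem IsFan.mem_of_mem_lspan (h : IsFan Δ) {τ σ : PointedCone ℝ V} (hτ : τ ∈ Δ) (hσ : σ ∈ Δ)
    (hle : τ ≤ σ) {v : V} (hv : v ∈ σ) (hv' : v ∈ lspan τ) : v ∈ τ := by
  obtain ⟨β, -, h2, h3⟩ := h.exists_dual hτ hσ hle
  exact (h2 v).2 ⟨hv, h3 v hv'⟩

theorem IsFan.exists_face (h : IsFan Δ) {σ : PointedCone ℝ V} (hσ : σ ∈ Δ) {β : Dual ℝ V}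
    (hβ : ∀ v ∈ σ, 0 ≤ β v) : ∃ τ ∈ Δ, ∀ v, v ∈ τ ↔ v ∈ σ ∧ β v = 0 := by
  let τ : PointedCone ℝ V := σ ⊓ (LinearMap.ker β).restrictScalars _
  have hτ : ∀ v, v ∈ τ ↔ v ∈ σ ∧ β v = 0 := fun v => Iff.rfl
  exact ⟨τ, h.face_mem σ hσ τ ⟨β, hβ, hτ⟩, hτ⟩

/-- The form cutting out `τ` vanishes at a relative interior point of `σ`, hence on all of `σ`. -/
theorem IsFan.eq_of_isRelInt (h : IsFan Δ) {τ σ : PointedCone ℝ V} (hτ : τ ∈ Δ) (hσ : σ ∈ Δ)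
    (hle : τ ≤ σ) {p : V} (hp : IsRelInt σ p) (hp' : p ∈ lspan τ) : τ = σ := by
  obtain ⟨β, h1, h2, h3⟩ := h.exists_dual hτ hσ hle
  exact le_antisymm hle fun v hv => (h2 v).2 ⟨hv, hp.2 β h1 (h3 p hp') v (mem_lspan hv)⟩

theorem IsFan.le_of_lspan_le (h : IsFan Δ) {τ τ' σ : PointedCone ℝ V} (hτ : τ ∈ Δ)
    (hσ : σ ∈ Δ) (hle : τ ≤ σ) (hle' : τ' ≤ σ) (hs : lspan τ' ≤ lspan τ) : τ' ≤ τ :=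
  fun _ hv => h.mem_of_mem_lspan hτ hσ hle (hle' hv) (hs (mem_lspan hv))

variable [FiniteDimensional ℝ V]

theorem cdim_mono {τ σ : PointedCone ℝ V} (h : τ ≤ σ) : cdim τ ≤ cdim σ :=
  Submodule.finrank_mono (lspan_mono h)

theorem IsFan.eq_of_cdim_le (h : IsFan Δ) {τ σ : PointedCone ℝ V} (hτ : τ ∈ Δ) (hσ : σ ∈ Δ)
    (hle : τ ≤ σ) (hd : cdim σ ≤ cdim τ) : τ = σ :=
  le_antisymm hle (h.le_of_lspan_le hτ hσ hle le_rfl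
    (Submodule.eq_of_le_of_finrank_le (lspan_mono hle) hd).ge)

theorem IsFan.cdim_lt (h : IsFan Δ) {τ σ : PointedCone ℝ V} (hτ : τ ∈ Δ) (hσ : σ ∈ Δ)
    (hle : τ ≤ σ) (hne : τ ≠ σ) : cdim τ < cdim σ := by
  by_contra hd
  exact hne (h.eq_of_cdim_le hτ hσ hle (not_lt.1 hd))

/-- By strict convexity, the sum of the defining forms is nonnegative on `σ` and vanishes only at
the origin. -/
theorem IsFan.bot_mem (h : IsFan Δ) : (⊥ : PointedCone ℝ V) ∈ Δ := by
  obtain ⟨σ, hσ⟩ := h.nonempty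
  obtain ⟨S, hS, hS'⟩ := h.exists_definedBy hσ
  refine h.face_mem σ hσ _ ⟨∑ α ∈ S, α, fun v hv => ?_, fun v => ⟨?_, ?_⟩⟩
  · rw [LinearMap.sum_apply]
    exact Finset.sum_nonneg fun α hα => hS.nonneg hα v hv
  · intro hv
    rw [Submodule.mem_bot] at hv
    subst hv
    exact ⟨zero_mem _, map_zero _⟩
  · rintro ⟨hv, h0⟩
    rw [LinearMap.sum_apply, Finset.sum_eq_zero_iff_of_nonneg fun α hα => hS.nonneg hα v hv] at h0
    exact hS' v h0

/-- If all forms defining `γ` that vanish at the relative interior point `p` of the face `τ` also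
vanish at `u ∈ V_γ`, then `u ∈ V_τ`. -/
theorem IsFan.mem_lspan_of_forall (h : IsFan Δ) {τ γ : PointedCone ℝ V} (hτ : τ ∈ Δ) (hγ : γ ∈ Δ)
    (hle : τ ≤ γ) {S : Finset (Dual ℝ V)} (hS : DefinedBy γ S) {p : V} (hp : IsRelInt τ p)
    {u : V} (hu : ∀ α ∈ S, α p = 0 → α u = 0) : u ∈ lspan τ := by
  obtain ⟨β, h1, h2, h3⟩ := h.exists_dual hτ hγ hle
  -- Small steps from `p` in both directions `u` and `-u` stay in `γ`, so the form cutting out `τ`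
  -- must vanish on `u`.
  obtain ⟨ε, hε, hm⟩ := hS.exists_add_smul_mem (hle hp.1) fun α hα h0 => (hu α hα h0).ge
  obtain ⟨ε', hε', hm'⟩ := hS.exists_add_smul_mem (v := -u) (hle hp.1) fun α hα h0 => by
    rw [map_neg, hu α hα h0, neg_zero]
  have hβp : β p = 0 := ((h2 p).1 hp.1).2
  have b1 := h1 _ hm
  have b2 := h1 _ hm'
  simp only [map_add, map_smul, map_neg, hβp, zero_add, smul_eq_mul, mul_neg] at b1 b2
  have c1 : 0 ≤ β u := nonneg_of_mul_nonneg_right b1 hε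
  have c2 : β u ≤ 0 := by nlinarith
  have : p + ε • u ∈ τ := (h2 _).2 ⟨hm, by simp [hβp, le_antisymm c2 c1]⟩
  exact mem_of_add_smul_mem hε (mem_lspan hp.1) (mem_lspan this)

open Classical in
/-- The sum of the forms in `S` that vanish at `p`. -/
noncomputable def activeSum (S : Finset (Dual ℝ V)) (p : V) : Dual ℝ V := ∑ α ∈ S with α p = 0, α

/-- When `p` is relatively interior to a face `τ`, the active sum serves as a height function modulo
`V_τ`; its level sets slice the cone transversally to `τ`. -/
theorem activeSum_apply_pos {S : Finset (Dual ℝ V)} {p v : V}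
    (h : ∀ α ∈ S, α p = 0 → 0 ≤ α v) {α : Dual ℝ V} (hα : α ∈ S) (hp : α p = 0) (hv : 0 < α v) :
    0 < activeSum S p v := by
  classical
  rw [activeSum, LinearMap.sum_apply]
  refine Finset.sum_pos' (fun α hα => ?_) ⟨α, Finset.mem_filter.2 ⟨hα, hp⟩, hv⟩
  exact h α (Finset.mem_filter.1 hα).1 (Finset.mem_filter.1 hα).2

theorem eq_zero_of_activeSum_eq_zero {S : Finset (Dual ℝ V)} {p v : V}
    (h : ∀ α ∈ S, α p = 0 → 0 ≤ α v) (h0 : activeSum S p v = 0) {α : Dual ℝ V} (hα : α ∈ S)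
    (hp : α p = 0) : α v = 0 := by
  by_contra hne
  exact (activeSum_apply_pos h hα hp (lt_of_le_of_ne (h α hα hp) (Ne.symm hne))).ne' h0

/-- Starting at a relative interior point `v₀` of `γ`, move in the direction `u` until the first of
the forms active at `p` vanishes. -/
theorem exists_exit {γ : PointedCone ℝ V} {S : Finset (Dual ℝ V)} (hS : DefinedBy γ S)
    {p v₀ u : V} (hv₀ : IsRelInt γ v₀) (hu : u ∈ lspan γ) (hex : ∃ α ∈ S, α p = 0 ∧ α u < 0) :
    ∃ t : ℝ, 0 < t ∧ (∀ α ∈ S, α p = 0 → 0 ≤ α (v₀ + t • u)) ∧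
      ∃ α ∈ S, α p = 0 ∧ 0 < α v₀ ∧ α u < 0 ∧ α (v₀ + t • u) = 0 := by
  classical
  have hpos : ∀ α ∈ S, α u < 0 → 0 < α v₀ := fun α hα hneg => by
    refine lt_of_le_of_ne (hS.nonneg hα _ hv₀.1) fun h0 => ?_
    exact hneg.ne (hv₀.2 α (hS.nonneg hα) h0.symm u hu)
  let T := S.filter fun α => α p = 0 ∧ α u < 0
  have hT : T.Nonempty := by
    obtain ⟨α, h1, h2⟩ := hex
    exact ⟨α, Finset.mem_filter.2 ⟨h1, h2⟩⟩
  -- The quotient `α v₀ / (-α u)` is the time at which `α` reaches zero along the ray; the smallest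
  -- one is the exit time.
  obtain ⟨α, hα, hmin⟩ := T.exists_min_image (fun α => α v₀ / (-α u)) hT
  obtain ⟨hαS, hαp, hαu⟩ := Finset.mem_filter.1 hα
  have hα0 := hpos α hαS hαu
  refine ⟨α v₀ / (-α u), div_pos hα0 (by linarith), fun α' h1 h2 => ?_, α, hαS, hαp, hα0, hαu, ?_⟩
  · rw [map_add, map_smul, smul_eq_mul]
    by_cases hneg : α' u < 0
    · have := hmin α' (Finset.mem_filter.2 ⟨h1, h2, hneg⟩)
      rw [le_div_iff₀ (by linarith)] at this
      linarith
    · exact add_nonneg (hS.nonneg h1 _ hv₀.1)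
        (mul_nonneg (div_pos hα0 (by linarith)).le (not_lt.1 hneg))
  · rw [map_add, map_smul, smul_eq_mul, div_mul_eq_mul_div, div_neg, mul_div_assoc,
      div_self hαu.ne, mul_one, add_neg_cancel]

/-- The kernel of `ψ` on `W` has codimension at most one, so it is still too large to fit into `U`.
-/
theorem exists_mem_ker_notMem {U W : Submodule ℝ V} (ψ : Dual ℝ V)
    (hd : finrank ℝ U + 2 ≤ finrank ℝ W) : ∃ u ∈ W, u ∉ U ∧ ψ u = 0 := by
  by_contra! hcon
  have hle : Submodule.map W.subtype (LinearMap.ker (ψ.domRestrict W)) ≤ U := by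
    rintro _ ⟨x, hx, rfl⟩
    by_contra hU
    exact hcon x x.2 hU hx
  have h1 := Submodule.finrank_mono hle
  rw [Submodule.finrank_map_subtype_eq] at h1
  have h2 := LinearMap.finrank_range_add_finrank_ker (ψ.domRestrict W)
  have h3 := Submodule.finrank_le (LinearMap.range (ψ.domRestrict W))
  rw [finrank_self] at h3
  omega

/-- Otherwise all active forms are nonnegative at `u` with sum zero, so all vanish there, which
forces `u` into `V_τ`. -/
theorem IsFan.exists_active_neg (h : IsFan Δ) {τ γ : PointedCone ℝ V} (hτ : τ ∈ Δ) (hγ : γ ∈ Δ)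
    (hle : τ ≤ γ) {S : Finset (Dual ℝ V)} (hS : DefinedBy γ S) {p : V} (hp : IsRelInt τ p)
    {u : V} (hu : u ∉ lspan τ) (h0 : activeSum S p u = 0) : ∃ α ∈ S, α p = 0 ∧ α u < 0 := by
  by_contra! hcon
  exact hu (h.mem_lspan_of_forall hτ hγ hle hS hp fun α hα hαp =>
    eq_zero_of_activeSum_eq_zero hcon h0 hα hαp)

/-- A face of `γ` that contains `τ` is cut out at the exit point. -/
theorem IsFan.exists_face_of_exit (h : IsFan Δ) {τ γ : PointedCone ℝ V} (hγ : γ ∈ Δ)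
    (hle : τ ≤ γ) {S : Finset (Dual ℝ V)} (hS : DefinedBy γ S) {p : V}
    (hp : IsRelInt τ p) {y : V} (hy : ∀ α ∈ S, α p = 0 → 0 ≤ α y) {α : Dual ℝ V} (hα : α ∈ S)
    (hαp : α p = 0) (hαy : α y = 0) :
    ∃ ρ ∈ Δ, τ ≤ ρ ∧ ρ ≤ γ ∧ (∀ v, v ∈ ρ ↔ v ∈ γ ∧ α v = 0) ∧ y ∈ lspan ρ := by
  obtain ⟨ρ, hρ, hmem⟩ := h.exists_face hγ (hS.nonneg hα)
  have hτρ : τ ≤ ρ := fun v hv => (hmem v).2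
    ⟨hle hv, hp.2 α (fun w hw => hS.nonneg hα w (hle hw)) hαp v (mem_lspan hv)⟩
  obtain ⟨ε, hε, hm⟩ := hS.exists_add_smul_mem (hle hp.1) hy
  refine ⟨ρ, hρ, hτρ, fun v hv => ((hmem v).1 hv).1, hmem, ?_⟩
  refine mem_of_add_smul_mem hε (mem_lspan (hτρ hp.1)) (mem_lspan ((hmem _).2 ⟨hm, ?_⟩))
  simp [hαp, hαy]

/-- A ray from the relative interior of `γ`, taken along a level set of the active sum, must leave
the region where the active forms are nonnegative. The face cut out at the exit point lies strictly
between `τ` and `γ`. -/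
theorem IsFan.exists_between (h : IsFan Δ) {τ γ : PointedCone ℝ V} (hτ : τ ∈ Δ) (hγ : γ ∈ Δ)
    (hle : τ ≤ γ) (hd : cdim τ + 2 ≤ cdim γ) : ∃ ρ ∈ Δ, τ ≤ ρ ∧ ρ ≤ γ ∧ ρ ≠ τ ∧ ρ ≠ γ := by
  obtain ⟨S, hS, -⟩ := h.exists_definedBy hγ
  obtain ⟨p, hp⟩ := exists_isRelInt τ
  obtain ⟨v₀, hv₀⟩ := exists_isRelInt γ
  obtain ⟨u, hu, huτ, h0⟩ := exists_mem_ker_notMem (activeSum S p) hd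
  obtain ⟨t, -, hy, α, hα, hαp, hα0, -, hαy⟩ :=
    exists_exit hS hv₀ hu (h.exists_active_neg hτ hγ hle hS hp huτ h0)
  obtain ⟨ρ, hρ, hτρ, hργ, hmem, hyρ⟩ := h.exists_face_of_exit hγ hle hS hp hy hα hαp hαy
  refine ⟨ρ, hρ, hτρ, hργ, ?_, ?_⟩
  · rintro rfl
    -- If the exit face were `τ`, the active sum would vanish at the exit point; but it is constant
    -- along the ray and positive at `v₀`.
    have h1 : activeSum S p (v₀ + t • u) = 0 := by
      rw [activeSum, LinearMap.sum_apply]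
      refine Finset.sum_eq_zero fun β hβ => ?_
      rw [Finset.mem_filter] at hβ
      exact hp.2 β (fun v hv => hS.nonneg hβ.1 v (hle hv)) hβ.2 _ hyρ
    rw [map_add, map_smul, h0, smul_zero, add_zero] at h1
    exact (activeSum_apply_pos (fun β hβ _ => hS.nonneg hβ _ hv₀.1) hα hαp hα0).ne' h1
  · rintro rfl
    exact hα0.ne' ((hmem v₀).1 hv₀.1).2

/-- Among the faces of `γ` strictly above `τ`, one of least dimension works: a gap of two or more
could be refined by `exists_between`. -/
theorem IsFan.exists_atom (h : IsFan Δ) {τ γ : PointedCone ℝ V} (hτ : τ ∈ Δ) (hγ : γ ∈ Δ)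
    (hle : τ ≤ γ) (hne : τ ≠ γ) : ∃ ρ ∈ Δ, τ ≤ ρ ∧ ρ ≤ γ ∧ cdim ρ = cdim τ + 1 := by
  classical
  obtain ⟨ρ, hρ, hmin⟩ := (Δ.filter fun ρ => τ ≤ ρ ∧ ρ ≤ γ ∧ τ ≠ ρ).exists_min_image cdim
    ⟨γ, by simp [hγ, hle, hne]⟩
  simp only [Finset.mem_filter] at hρ hmin
  obtain ⟨hρ, h1, h2, h3⟩ := hρ
  refine ⟨ρ, hρ, h1, h2, ?_⟩
  by_contra hc
  have := h.cdim_lt hτ hρ h1 h3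
  obtain ⟨ρ', hρ', k1, k2, k3, k4⟩ := h.exists_between hτ hρ h1 (by omega)
  have h5 := hmin ρ' ⟨hρ', k1, k2.trans h2, k3.symm⟩
  have h6 := h.cdim_lt hρ' hρ k2 k4
  omega

theorem IsFan.exists_facet (h : IsFan Δ) {τ γ : PointedCone ℝ V} (hτ : τ ∈ Δ) (hγ : γ ∈ Δ)
    (hle : τ ≤ γ) (hne : τ ≠ γ) : ∃ ρ ∈ Δ, τ ≤ ρ ∧ ρ ≤ γ ∧ cdim ρ + 1 = cdim γ := by
  classical
  obtain ⟨ρ, hρ, hmax⟩ := (Δ.filter fun ρ => τ ≤ ρ ∧ ρ ≤ γ ∧ ρ ≠ γ).exists_max_image cdim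
    ⟨τ, by simp [hτ, hle, hne]⟩
  simp only [Finset.mem_filter] at hρ hmax
  obtain ⟨hρ, h1, h2, h3⟩ := hρ
  refine ⟨ρ, hρ, h1, h2, ?_⟩
  by_contra hc
  have := h.cdim_lt hρ hγ h2 h3
  obtain ⟨ρ', hρ', k1, k2, k3, k4⟩ := h.exists_between hρ hγ h2 (by omega)
  have h5 := hmax ρ' ⟨hρ', h1.trans k1, k2, k4⟩
  have h6 := h.cdim_lt hρ hρ' k1 k3.symm
  omega

end Geometry

/-! ### Diamonds and walls. -/

section Geometry

open Module

variable {V : Type u} [AddCommGroup V] [Module ℝ V] [FiniteDimensional ℝ V]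
variable {Δ : Finset (PointedCone ℝ V)}

theorem IsRelInt.smul {σ : PointedCone ℝ V} {p : V} (hp : IsRelInt σ p) {c : ℝ} (hc : 0 < c) :
    IsRelInt σ (c • p) := by
  refine ⟨cone_smul_mem hc.le hp.1, fun β hβ h0 => hp.2 β hβ ?_⟩
  rw [map_smul, smul_eq_mul] at h0
  exact (mul_eq_zero.1 h0).resolve_left hc.ne'

theorem exists_eq_add_smul_of_finrank {U W : Submodule ℝ V} (hUW : U ≤ W)
    (hd : finrank ℝ W ≤ finrank ℝ U + 1) {x : V} (hx : x ∈ W) (hxU : x ∉ U) {y : V}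
    (hy : y ∈ W) : ∃ b : ℝ, y - b • x ∈ U := by
  have hlt : U < U ⊔ Submodule.span ℝ {x} := lt_of_le_of_ne le_sup_left fun h => hxU
    (h ▸ Submodule.mem_sup_right (Submodule.mem_span_singleton_self x))
  have hle : U ⊔ Submodule.span ℝ {x} ≤ W :=
    sup_le hUW ((Submodule.span_singleton_le_iff_mem _ _).2 hx)
  have h1 := Submodule.finrank_lt_finrank_of_lt hlt
  have heq := Submodule.eq_of_le_of_finrank_le hle (by omega)
  rw [← heq] at hy
  obtain ⟨u, hu, z, hz, rfl⟩ := Submodule.mem_sup.1 hy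
  obtain ⟨b, rfl⟩ := Submodule.mem_span_singleton.1 hz
  exact ⟨b, by simpa using hu⟩

/-- By dimension, `V_ρ` is `V_τ` plus the line through `y`, and both lie in `V_ρ'`. -/
theorem lspan_le_of_cdim_le {τ ρ ρ' : PointedCone ℝ V} (hτρ : τ ≤ ρ) (hτρ' : τ ≤ ρ')
    (hd : cdim ρ ≤ cdim τ + 1) {y : V} (hy : y ∈ lspan ρ) (hy' : y ∈ lspan ρ')
    (hyτ : y ∉ lspan τ) : lspan ρ ≤ lspan ρ' := by
  intro z hz
  obtain ⟨b, hb⟩ := exists_eq_add_smul_of_finrank (lspan_mono hτρ) hd hy hyτ hz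
  have := Submodule.add_mem _ (lspan_mono hτρ' hb) (Submodule.smul_mem _ b hy')
  simpa using this

theorem IsFan.eq_of_mem_lspan (h : IsFan Δ) {τ ρ ρ' γ : PointedCone ℝ V} (hρ : ρ ∈ Δ)
    (hρ' : ρ' ∈ Δ) (hγ : γ ∈ Δ) (hτρ : τ ≤ ρ) (hτρ' : τ ≤ ρ') (hργ : ρ ≤ γ) (hργ' : ρ' ≤ γ)
    (hd : cdim ρ = cdim τ + 1) (hd' : cdim ρ' = cdim τ + 1) {y : V} (hy : y ∈ lspan ρ)
    (hy' : y ∈ lspan ρ') (hyτ : y ∉ lspan τ) : ρ = ρ' :=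
  le_antisymm (h.le_of_lspan_le hρ' hγ hργ' hργ (lspan_le_of_cdim_le hτρ hτρ' hd.le hy hy' hyτ))
    (h.le_of_lspan_le hρ hγ hργ hργ' (lspan_le_of_cdim_le hτρ' hτρ hd'.le hy' hy hyτ))

/-- An intermediate face that meets the ray `v₀ + ℝ_{>0} u` (modulo `V_τ`) contains the exit
point. -/
theorem IsFan.exit_mem_lspan (h : IsFan Δ) {τ ρ γ : PointedCone ℝ V}
    (hρ : ρ ∈ Δ) (hγ : γ ∈ Δ) (hτρ : τ ≤ ρ) (hργ : ρ ≤ γ) (hne : ρ ≠ γ)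
    {S : Finset (Dual ℝ V)} (hS : DefinedBy γ S) {p v₀ u x w : V} (hp : IsRelInt τ p)
    (hv₀ : IsRelInt γ v₀) {t : ℝ} (ht : ∀ α ∈ S, α p = 0 → 0 ≤ α (v₀ + t • u))
    {α : Dual ℝ V} (hα : α ∈ S) (hαp : α p = 0) (hαu : α u < 0) (hαy : α (v₀ + t • u) = 0)
    (hx : x ∈ ρ) (hw : w ∈ lspan τ) {a b : ℝ} (ha : 0 < a) (hb : 0 < b)
    (hxe : a • x = v₀ + b • u + w) : v₀ + t • u ∈ lspan ρ := by
  obtain ⟨β, h1, h2, h3⟩ := h.exists_dual hρ hγ hργ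
  have hβ0 : 0 < β v₀ := by
    refine lt_of_le_of_ne (h1 _ hv₀.1) fun h0 => hne ?_
    exact h.eq_of_isRelInt hρ hγ hργ hv₀ (mem_lspan ((h2 _).2 ⟨hv₀.1, h0.symm⟩))
  obtain ⟨ε, hε, hm⟩ := hS.exists_add_smul_mem (hργ (hτρ hp.1)) ht
  have e1 := h1 _ hm
  rw [map_add, h3 p (lspan_mono hτρ (mem_lspan hp.1)), zero_add, map_smul, smul_eq_mul] at e1
  have e2 : 0 ≤ β v₀ + t * β u := by
    simpa using nonneg_of_mul_nonneg_right e1 hε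
  have e3 := congrArg β hxe
  simp only [map_add, map_smul, h3 x (mem_lspan hx), h3 w (lspan_mono hτρ hw),
    add_zero, smul_eq_mul] at e3
  have e4 := congrArg α hxe
  have hατ : α w = 0 := hp.2 α (fun v hv => hS.nonneg hα v (hργ (hτρ hv))) hαp w hw
  simp only [map_add, map_smul, hατ, add_zero, smul_eq_mul] at e4
  have e5 : 0 ≤ α v₀ + b * α u := by
    rw [← e4]
    exact mul_nonneg ha.le (hS.nonneg hα x (hργ hx))
  rw [map_add, map_smul, smul_eq_mul] at hαy
  -- The form `α` vanishes at time `t` and is nonnegative at time `b`; the form `β` vanishes at time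
  -- `b` and is nonnegative at time `t`. Both are positive at `v₀`, hence decreasing along the ray,
  -- so the times coincide.
  have hbt : b = t := by
    apply le_antisymm
    · nlinarith
    · have : β u < 0 := by nlinarith
      nlinarith
  subst hbt
  have : v₀ + b • u = a • x - w := by rw [hxe]; abel
  rw [this]
  exact Submodule.sub_mem _ (Submodule.smul_mem _ _ (mem_lspan hx)) (lspan_mono hτρ hw)

/-- Between two cones whose dimensions differ by two there are exactly two cones. -/
theorem IsFan.diamond (h : IsFan Δ) {τ γ : PointedCone ℝ V} (hτ : τ ∈ Δ) (hγ : γ ∈ Δ)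
    (hle : τ ≤ γ) (hd : cdim γ = cdim τ + 2) : ∃ ρ₁ ∈ Δ, ∃ ρ₂ ∈ Δ, ρ₁ ≠ ρ₂ ∧
      (τ ≤ ρ₁ ∧ ρ₁ ≤ γ ∧ cdim ρ₁ = cdim τ + 1) ∧ (τ ≤ ρ₂ ∧ ρ₂ ≤ γ ∧ cdim ρ₂ = cdim τ + 1) ∧
      ∀ ρ ∈ Δ, τ ≤ ρ → ρ ≤ γ → cdim ρ = cdim τ + 1 → ρ = ρ₁ ∨ ρ = ρ₂ := by
  obtain ⟨S, hS, -⟩ := h.exists_definedBy hγ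
  obtain ⟨p, hp⟩ := exists_isRelInt τ
  obtain ⟨v₀, hv₀⟩ := exists_isRelInt γ
  -- Modulo `V_τ` the cone `γ` is planar, and its slice at the height of `v₀` is a segment through
  -- `v₀` in the direction `u`. The exits along `u` and `-u` are its two ends and give the two
  -- faces.
  obtain ⟨u, hu, huτ, h0⟩ := exists_mem_ker_notMem (activeSum S p) hd.ge
  set ψ := activeSum S p with hψ
  obtain ⟨t, ht, hy, α, hα, hαp, hα0, hαu, hαy⟩ :=
    exists_exit hS hv₀ hu (h.exists_active_neg hτ hγ hle hS hp huτ h0)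
  obtain ⟨ρ₁, hρ₁, hτρ₁, hργ₁, hmem₁, hyρ₁⟩ := h.exists_face_of_exit hγ hle hS hp hy hα hαp hαy
  obtain ⟨t', ht', hy', α', hα', hαp', hα0', hαu', hαy'⟩ :=
    exists_exit hS hv₀ (neg_mem hu) (h.exists_active_neg hτ hγ hle hS hp (u := -u)
      (by rwa [neg_mem_iff]) (by rw [map_neg, h0, neg_zero]))
  obtain ⟨ρ₂, hρ₂, hτρ₂, hργ₂, hmem₂, hyρ₂⟩ :=
    h.exists_face_of_exit hγ hle hS hp hy' hα' hαp' hαy'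
  have hψ0 : 0 < ψ v₀ := activeSum_apply_pos (fun β hβ _ => hS.nonneg hβ _ hv₀.1) hα hαp hα0
  have hψτ : ∀ w ∈ lspan τ, ψ w = 0 := fun w hw => by
    rw [hψ, activeSum, LinearMap.sum_apply]
    refine Finset.sum_eq_zero fun β hβ => ?_
    rw [Finset.mem_filter] at hβ
    exact hp.2 β (fun v hv => hS.nonneg hβ.1 v (hle hv)) hβ.2 _ hw
  have hnτ : ∀ s : ℝ, v₀ + s • u ∉ lspan τ := fun s hs => by
    have := hψτ _ hs
    rw [map_add, map_smul, h0, smul_zero, add_zero] at this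
    exact hψ0.ne' this
  have hnτ' : ∀ s : ℝ, v₀ + s • -u ∉ lspan τ := fun s => by simpa using hnτ (-s)
  have hdim : ∀ {ρ : PointedCone ℝ V}, ρ ∈ Δ → τ ≤ ρ → ρ ≤ γ → ∀ {y : V}, y ∈ lspan ρ →
      y ∉ lspan τ → v₀ ∉ ρ → cdim ρ = cdim τ + 1 := by
    intro ρ hρ h1 h2 y h3 h4 h5
    have k1 := h.cdim_lt hτ hρ h1 (by rintro rfl; exact h4 h3)
    have k2 := h.cdim_lt hρ hγ h2 (by rintro rfl; exact h5 hv₀.1)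
    omega
  have hv₁ : v₀ ∉ ρ₁ := fun hv => hα0.ne' ((hmem₁ v₀).1 hv).2
  have hv₂ : v₀ ∉ ρ₂ := fun hv => hα0'.ne' ((hmem₂ v₀).1 hv).2
  have hd₁ := hdim hρ₁ hτρ₁ hργ₁ hyρ₁ (hnτ t) hv₁
  have hd₂ := hdim hρ₂ hτρ₂ hργ₂ hyρ₂ (hnτ' t') hv₂
  refine ⟨ρ₁, hρ₁, ρ₂, hρ₂, ?_, ⟨hτρ₁, hργ₁, hd₁⟩, ⟨hτρ₂, hργ₂, hd₂⟩, ?_⟩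
  -- If one face contained both ends, its span would contain the point `v₀` between them, and the
  -- face would then contain `v₀`.
  · rintro rfl
    apply hv₁
    refine h.mem_of_mem_lspan hρ₁ hγ hργ₁ hv₀.1 ?_
    have : (t + t') • v₀ ∈ lspan ρ₁ := by
      have := Submodule.add_mem _ (Submodule.smul_mem _ t' hyρ₁) (Submodule.smul_mem _ t hyρ₂)
      convert this using 1
      module
    exact (Submodule.smul_mem_iff _ (by positivity)).1 this
  · intro ρ hρ hτρ hργ hdρ
    have hneγ : ρ ≠ γ := by rintro rfl; omega
    obtain ⟨x, hxρ, hxτ⟩ : ∃ x ∈ ρ, x ∉ lspan τ := by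
      by_contra! hcon
      have := Submodule.finrank_mono (lspan_le.2 hcon)
      change cdim ρ ≤ cdim τ at this
      omega
    have hact : ∀ β ∈ S, β p = 0 → 0 ≤ β x := fun β hβ _ => hS.nonneg hβ x (hργ hxρ)
    have hψx : 0 < ψ x := by
      have hex : ∃ β ∈ S, β p = 0 ∧ 0 < β x := by
        by_contra! hcon
        exact hxτ (h.mem_lspan_of_forall hτ hγ hle hS hp fun β hβ hβp =>
          le_antisymm (hcon β hβ hβp) (hact β hβ hβp))
      obtain ⟨β, hβ, hβp, hβx⟩ := hex
      exact activeSum_apply_pos hact hβ hβp hβx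
    -- Scaled to the height of `v₀`, the vector `x` of `ρ` equals `v₀ + b • u` modulo `V_τ`; the
    -- sign of `b` tells which of the two ends it meets.
    have ha : 0 < ψ v₀ / ψ x := div_pos hψ0 hψx
    have hK : finrank ℝ ↥(LinearMap.ker ψ ⊓ lspan γ) ≤ finrank ℝ (lspan τ) + 1 := by
      have : LinearMap.ker ψ ⊓ lspan γ < lspan γ := lt_of_le_of_ne inf_le_right fun heq => by
        have := heq.ge (mem_lspan hv₀.1)
        exact hψ0.ne' this.1
      have := Submodule.finrank_lt_finrank_of_lt this
      change _ < cdim γ at this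
      change _ ≤ cdim τ + 1
      omega
    obtain ⟨b, hb⟩ := exists_eq_add_smul_of_finrank (U := lspan τ)
      (le_inf (fun w hw => hψτ w hw) (lspan_mono hle)) hK (x := u) ⟨h0, hu⟩ huτ
      (y := (ψ v₀ / ψ x) • x - v₀)
      ⟨by simp [div_mul_cancel₀ _ hψx.ne'], Submodule.sub_mem _ (Submodule.smul_mem _ _
        (mem_lspan (hργ hxρ))) (mem_lspan hv₀.1)⟩
    rcases lt_trichotomy b 0 with hb0 | hb0 | hb0
    · right
      have := h.exit_mem_lspan hρ hγ hτρ hργ hneγ hS hp hv₀ hy' hα' hαp' hαu' hαy' hxρ hb ha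
        (neg_pos.2 hb0) (by module)
      exact h.eq_of_mem_lspan hρ hρ₂ hγ hτρ hτρ₂ hργ hργ₂ hdρ hd₂ this hyρ₂ (hnτ' t')
    · exfalso
      subst hb0
      apply hneγ
      refine h.eq_of_isRelInt hρ hγ hργ hv₀ ?_
      have e : v₀ = (ψ v₀ / ψ x) • x - ((ψ v₀ / ψ x) • x - v₀ - (0 : ℝ) • u) := by module
      rw [e]
      exact Submodule.sub_mem _ (Submodule.smul_mem _ _ (mem_lspan hxρ)) (lspan_mono hτρ hb)
    · left
      have := h.exit_mem_lspan hρ hγ hτρ hργ hneγ hS hp hv₀ hy hα hαp hαu hαy hxρ hb ha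
        hb0 (by module)
      exact h.eq_of_mem_lspan hρ hρ₁ hγ hτρ hτρ₁ hργ hργ₁ hdρ hd₁ this hyρ₁ (hnτ t)

/-- Two full-dimensional cones with a common facet lie on opposite sides of it. -/
theorem IsFan.wall_opposite (h : IsFan Δ) {ρ γ₁ γ₂ : PointedCone ℝ V} (hρ : ρ ∈ Δ) (hγ₁ : γ₁ ∈ Δ)
    (hγ₂ : γ₂ ∈ Δ) (h₁ : ρ ≤ γ₁) (h₂ : ρ ≤ γ₂) (hd : cdim ρ + 1 = finrank ℝ V)
    (hd₁ : cdim γ₁ = finrank ℝ V) (hd₂ : cdim γ₂ = finrank ℝ V) (hne : γ₁ ≠ γ₂) {v₁ v₂ : V}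
    (hv₁ : v₁ ∈ γ₁) (hv₂ : v₂ ∈ γ₂) (hn₁ : v₁ ∉ lspan ρ) (hn₂ : v₂ ∉ lspan ρ) :
    ∃ c : ℝ, 0 < c ∧ v₂ + c • v₁ ∈ lspan ρ := by
  have hdV : finrank ℝ (⊤ : Submodule ℝ V) ≤ finrank ℝ (lspan ρ) + 1 := by
    rw [finrank_top]
    exact hd.ge
  obtain ⟨a, ha⟩ := exists_eq_add_smul_of_finrank le_top hdV (x := v₁) trivial hn₁ (y := v₂) trivial
  rcases lt_trichotomy a 0 with ha0 | ha0 | ha0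
  · exact ⟨-a, neg_pos.2 ha0, by rwa [neg_smul, ← sub_eq_add_neg]⟩
  · simp [ha0, hn₂] at ha
  · exfalso
    apply hne
    obtain ⟨S, hS, -⟩ := h.exists_definedBy hγ₂
    obtain ⟨p, hp⟩ := exists_isRelInt ρ
    obtain ⟨v₀, hv₀⟩ := exists_isRelInt γ₁
    obtain ⟨β, b1, b2, b3⟩ := h.exists_dual hρ hγ₁ h₁
    obtain ⟨a', ha'⟩ :=
      exists_eq_add_smul_of_finrank le_top hdV (x := v₁) trivial hn₁ (y := v₀) trivial
    have hβ₁ : 0 < β v₁ := lt_of_le_of_ne (b1 _ hv₁) fun h0 =>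
      hn₁ (mem_lspan ((b2 _).2 ⟨hv₁, h0.symm⟩))
    have ha'0 : 0 ≤ a' := by
      have e := b3 _ ha'
      rw [map_sub, map_smul, smul_eq_mul] at e
      have := b1 _ hv₀.1
      by_contra hneg
      nlinarith
    -- Modulo `V_ρ`, both `v₂` and `v₀` are nonnegative multiples of `v₁`, with a positive factor
    -- for `v₂`. A form of `γ₂` active at `p` is thus nonnegative at `v₀`, so a relative interior
    -- point of `γ₁` near `p` also lies in `γ₂`.
    obtain ⟨ε, hε, hm⟩ := hS.exists_add_smul_mem (v := v₀) (h₂ hp.1) fun α hα hαp => by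
      have hα0 := hp.2 α (fun v hv => hS.nonneg hα v (h₂ hv)) hαp
      have e1 := hα0 _ ha
      have e2 := hα0 _ ha'
      rw [map_sub, map_smul, smul_eq_mul] at e1 e2
      have e3 := hS.nonneg hα _ hv₂
      have e4 : 0 ≤ α v₁ := by
        by_contra hneg
        nlinarith
      nlinarith
    have hri : IsRelInt γ₁ (p + ε • v₀) := by
      rw [add_comm]
      exact (hv₀.smul hε).add (h₁ hp.1)
    have hmem : p + ε • v₀ ∈ γ₁ ⊓ γ₂ := ⟨hri.1, hm⟩
    have hinf : γ₁ ⊓ γ₂ ∈ Δ := h.face_mem _ hγ₁ _ (h.inter_left _ hγ₁ _ hγ₂)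
    have := h.eq_of_isRelInt hinf hγ₁ inf_le_left hri (mem_lspan hmem)
    exact h.eq_of_cdim_le hγ₁ hγ₂ (inf_eq_left.1 this) (by rw [hd₁, hd₂])

theorem IsFan.exists_mem_notMem_lspan (h : IsFan Δ) {τ σ : PointedCone ℝ V} (hτ : τ ∈ Δ)
    (hσ : σ ∈ Δ) (hle : τ ≤ σ) (hne : τ ≠ σ) : ∃ v ∈ σ, v ∉ lspan τ := by
  by_contra! hcon
  exact hne (le_antisymm hle fun v hv => h.mem_of_mem_lspan hτ hσ hle hv (hcon v hv))

/-- A cone of codimension one is a facet of at most two full-dimensional cones. -/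
theorem IsFan.wall_unique (h : IsFan Δ) {ρ γ₁ γ₂ γ₃ : PointedCone ℝ V} (hρ : ρ ∈ Δ) (hγ₁ : γ₁ ∈ Δ)
    (hγ₂ : γ₂ ∈ Δ) (hγ₃ : γ₃ ∈ Δ) (h₁ : ρ ≤ γ₁) (h₂ : ρ ≤ γ₂) (h₃ : ρ ≤ γ₃)
    (hd : cdim ρ + 1 = finrank ℝ V) (hd₁ : cdim γ₁ = finrank ℝ V) (hd₂ : cdim γ₂ = finrank ℝ V)
    (hd₃ : cdim γ₃ = finrank ℝ V) (hne : γ₁ ≠ γ₂) : γ₃ = γ₁ ∨ γ₃ = γ₂ := by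
  by_contra! hcon
  have aux : ∀ γ : PointedCone ℝ V, cdim γ = finrank ℝ V → ρ ≠ γ := by
    rintro γ hγ rfl
    omega
  obtain ⟨v₁, hv₁, hn₁⟩ := h.exists_mem_notMem_lspan hρ hγ₁ h₁ (aux _ hd₁)
  obtain ⟨v₂, hv₂, hn₂⟩ := h.exists_mem_notMem_lspan hρ hγ₂ h₂ (aux _ hd₂)
  obtain ⟨v₃, hv₃, hn₃⟩ := h.exists_mem_notMem_lspan hρ hγ₃ h₃ (aux _ hd₃)
  obtain ⟨c, hc, e1⟩ := h.wall_opposite hρ hγ₁ hγ₂ h₁ h₂ hd hd₁ hd₂ hne hv₁ hv₂ hn₁ hn₂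
  obtain ⟨c', hc', e2⟩ :=
    h.wall_opposite hρ hγ₁ hγ₃ h₁ h₃ hd hd₁ hd₃ hcon.1.symm hv₁ hv₃ hn₁ hn₃
  obtain ⟨c'', hc'', e3⟩ :=
    h.wall_opposite hρ hγ₂ hγ₃ h₂ h₃ hd hd₂ hd₃ hcon.2.symm hv₂ hv₃ hn₂ hn₃
  apply hn₁
  -- Three vectors cannot lie pairwise on opposite sides of a hyperplane: eliminating `v₂` and `v₃`
  -- leaves a positive multiple of `v₁`.
  have : (c' + c'' * c) • v₁ ∈ lspan ρ := by
    have := Submodule.add_mem _ (Submodule.sub_mem _ e2 e3) (Submodule.smul_mem _ c'' e1)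
    convert this using 1
    module
  exact (Submodule.smul_mem_iff _ (by positivity)).1 this

end Geometry

/-! ### Connectedness of the atoms over a face. -/

section Geometry

open Module

variable {V : Type u} [AddCommGroup V] [Module ℝ V] [FiniteDimensional ℝ V]
variable {Δ : Finset (PointedCone ℝ V)}

theorem exists_isRelInt_notMem {γ : PointedCone ℝ V} {H : Submodule ℝ V}
    (hd : finrank ℝ H < cdim γ) : ∃ u, IsRelInt γ u ∧ u ∉ H := by
  obtain ⟨v₀, hv₀⟩ := exists_isRelInt γ
  by_cases hH : v₀ ∈ H
  · obtain ⟨x, hx, hxH⟩ : ∃ x ∈ γ, x ∉ H := by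
      by_contra! hcon
      exact hd.not_ge (Submodule.finrank_mono (lspan_le.2 hcon))
    exact ⟨v₀ + x, hv₀.add hx, fun hm => hxH ((Submodule.add_mem_iff_right H hH).1 hm)⟩
  · exact ⟨v₀, hv₀, hH⟩

/-- In a cone `γ` with a face `σ` of codimension at least two, a function that is constant on the
pairs of atoms over `σ` in each cone of relative dimension two is constant on the atoms. -/
theorem IsFan.atoms_connected (h : IsFan Δ) {X : Type*} (φ : PointedCone ℝ V → X)
    {σ : PointedCone ℝ V} (hσ : σ ∈ Δ)
    (hφ : ∀ e ∈ Δ, σ ≤ e → cdim e = cdim σ + 2 → ∀ a ∈ Δ, ∀ a' ∈ Δ, σ ≤ a → σ ≤ a' → a ≤ e →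
      a' ≤ e → cdim a = cdim σ + 1 → cdim a' = cdim σ + 1 → φ a = φ a')
    {γ : PointedCone ℝ V} (hγ : γ ∈ Δ) (hle : σ ≤ γ) (hd : cdim σ + 2 ≤ cdim γ)
    {a a' : PointedCone ℝ V} (ha : a ∈ Δ) (ha' : a' ∈ Δ) (hσa : σ ≤ a) (hσa' : σ ≤ a')
    (haγ : a ≤ γ) (haγ' : a' ≤ γ) (hda : cdim a = cdim σ + 1) (hda' : cdim a' = cdim σ + 1) :
    φ a = φ a' := by
  classical
  induction hN : cdim γ using Nat.strong_induction_on generalizing γ a a' with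
  | _ N ih =>
  subst hN
  rcases hd.eq_or_lt with hd2 | hd3
  · exact hφ γ hγ hle hd2.symm a ha a' ha' hσa hσa' haγ haγ' hda hda'
  -- Within a proper face of `γ` the claim is known: enlarge the face to a facet and use the
  -- induction hypothesis.
  have hF : ∀ F ∈ Δ, σ ≤ F → F ≤ γ → F ≠ γ → ∀ b ∈ Δ, ∀ b' ∈ Δ, σ ≤ b → σ ≤ b' → b ≤ F →
      b' ≤ F → cdim b = cdim σ + 1 → cdim b' = cdim σ + 1 → φ b = φ b' := by
    intro F hF hσF hFγ hne b hb b' hb' h1 h2 h3 h4 h5 h6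
    obtain ⟨ρ, hρ, hFρ, hργ, hdρ⟩ := h.exists_facet hF hγ hFγ hne
    exact ih (cdim ρ) (by omega) hρ (hσF.trans hFρ) (by omega) hb hb' h1 h2
      (h3.trans hFρ) (h4.trans hFρ) h5 h6 rfl
  obtain ⟨S, hS, -⟩ := h.exists_definedBy hγ
  obtain ⟨p, hp⟩ := exists_isRelInt σ
  obtain ⟨p₁, hp₁⟩ := exists_isRelInt a
  obtain ⟨p₂, hp₂⟩ := exists_isRelInt a'
  have hH : finrank ℝ ↥(lspan a ⊔ lspan a') < cdim γ := by
    have h1 := Submodule.finrank_sup_add_finrank_inf_eq (lspan a) (lspan a')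
    have h2 := Submodule.finrank_mono (le_inf (lspan_mono hσa) (lspan_mono hσa'))
    change cdim σ ≤ _ at h2
    change _ = cdim a + cdim a' at h1
    omega
  -- The span of the two atoms has dimension at most `cdim σ + 2`, which is now less than `cdim γ`,
  -- so the direction `u` can avoid it.
  obtain ⟨u, hu, huH⟩ := exists_isRelInt_notMem hH
  have hu0 : ∀ α ∈ S, 0 ≤ α u := fun α hα => hS.nonneg hα u hu.1
  have hvan : ∀ {b : PointedCone ℝ V}, b ≤ γ → ∀ {q}, IsRelInt b q → ∀ {α}, α ∈ S → α q = 0 →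
      ∀ v ∈ lspan b, α v = 0 := fun {b} hb {q} hq {α} hα h0 =>
    hq.2 α (fun v hv => hS.nonneg hα v (hb hv)) h0
  let T := S.filter fun α => α p = 0 ∧ 0 < α u
  -- the forms active at an atom
  have hend : ∀ {b : PointedCone ℝ V}, b ∈ Δ → σ ≤ b → b ≤ γ → lspan b ≤ lspan a ⊔ lspan a' →
      ∀ {q}, IsRelInt b q → ∃ α ∈ T, α q = 0 := by
    intro b hb hσb hbγ hbH q hq
    by_contra! hcon
    refine huH (hbH (h.mem_lspan_of_forall hb hγ hbγ hS hq fun α hα h0 => ?_))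
    by_contra hne
    refine hcon α (Finset.mem_filter.2 ⟨hα, ?_, lt_of_le_of_ne (hu0 α hα) (Ne.symm hne)⟩) h0
    exact hvan hbγ hq hα h0 p (mem_lspan (hσb hp.1))
  have hT : T.Nonempty := (hend ha hσa haγ le_sup_left hp₁).imp fun α hα => hα.1
  -- The segment from `p₁` to `p₂` is pushed along `-u` until one of the forms in `T` vanishes. The
  -- result `y` is a continuous path on the boundary of the cone given by the forms active at `p`.
  let P : ℝ → V := fun t => p₁ + t • (p₂ - p₁)
  let s : ℝ → ℝ := fun t => T.inf' hT fun α => α (P t) / α u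
  let y : ℝ → V := fun t => P t - s t • u
  have hs_cont : Continuous s := by
    refine Continuous.finset_inf'_apply hT fun α _ => ?_
    simp only [P, map_add, map_smul, smul_eq_mul]
    fun_prop
  have hPnn : ∀ t ∈ Set.Icc (0 : ℝ) 1, ∀ α : Dual ℝ V, 0 ≤ α p₁ → 0 ≤ α p₂ →
      α (P t) = (1 - t) * α p₁ + t * α p₂ := by
    intro t _ α _ _
    simp only [P, map_add, map_smul, smul_eq_mul, map_sub]
    ring
  have hP0 : ∀ t ∈ Set.Icc (0 : ℝ) 1, ∀ α ∈ S, 0 ≤ α (P t) := by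
    intro t ht α hα
    have h1 := hS.nonneg hα _ (haγ hp₁.1)
    have h2 := hS.nonneg hα _ (haγ' hp₂.1)
    rw [hPnn t ht α h1 h2]
    exact add_nonneg (mul_nonneg (by linarith [ht.2]) h1) (mul_nonneg ht.1 h2)
  have hs0 : ∀ t ∈ Set.Icc (0 : ℝ) 1, 0 ≤ s t := by
    intro t ht
    refine (Finset.le_inf'_iff hT _).2 fun α hα => ?_
    rw [Finset.mem_filter] at hα
    exact div_nonneg (hP0 t ht α hα.1) hα.2.2.le
  have hy : ∀ t ∈ Set.Icc (0 : ℝ) 1, ∀ α ∈ S, α p = 0 → 0 ≤ α (y t) := by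
    intro t ht α hα hαp
    simp only [y, map_sub, map_smul, smul_eq_mul]
    rcases (hu0 α hα).eq_or_lt with h0 | h0
    · rw [← h0, mul_zero, sub_zero]
      exact hP0 t ht α hα
    · have := Finset.inf'_le (fun α => α (P t) / α u) (Finset.mem_filter.2 ⟨hα, hαp, h0⟩ : α ∈ T)
      rw [le_div_iff₀ h0] at this
      exact sub_nonneg.2 this
  have hyT : ∀ t, ∃ α ∈ T, α (y t) = 0 := by
    intro t
    obtain ⟨α, hα, he⟩ := Finset.exists_mem_eq_inf' hT fun α => α (P t) / α u
    refine ⟨α, hα, ?_⟩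
    have h0 := (Finset.mem_filter.1 hα).2.2
    simp only [y, map_sub, map_smul, smul_eq_mul]
    change _ - (T.inf' hT fun α => α (P t) / α u) * _ = 0
    rw [he, div_mul_cancel₀ _ h0.ne', sub_self]
  have hPH : ∀ t, P t ∈ lspan a ⊔ lspan a' := by
    intro t
    have e : P t = (1 - t) • p₁ + t • p₂ := by simp only [P]; module
    rw [e]
    exact Submodule.add_mem_sup (Submodule.smul_mem _ _ (mem_lspan hp₁.1))
      (Submodule.smul_mem _ _ (mem_lspan hp₂.1))
  -- A point of the path in `V_σ` would force `s t = 0`, because `u` avoids the span of the atoms.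
  -- But the form cutting out `σ` is positive on the whole segment.
  have hyσ : ∀ t ∈ Set.Icc (0 : ℝ) 1, y t ∉ lspan σ := by
    intro t ht hm
    have h1 : s t • u ∈ lspan a ⊔ lspan a' := by
      have := Submodule.sub_mem _ (hPH t) (le_sup_of_le_left (a := lspan a) (lspan_mono hσa) hm)
      simpa [y] using this
    have h2 : s t = 0 := by
      by_contra hne
      exact huH ((Submodule.smul_mem_iff _ hne).1 h1)
    obtain ⟨β, b1, b2, b3⟩ := h.exists_dual hσ hγ hle
    have hpos : ∀ {b : PointedCone ℝ V}, b ∈ Δ → σ ≤ b → b ≤ γ → cdim b = cdim σ + 1 →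
        ∀ {q}, IsRelInt b q → 0 < β q := by
      intro b hb k1 k2 k3 q hq
      refine lt_of_le_of_ne (b1 _ (k2 hq.1)) fun h0 => ?_
      have := h.eq_of_isRelInt hσ hb k1 hq (mem_lspan ((b2 _).2 ⟨k2 hq.1, h0.symm⟩))
      subst this
      omega
    have q1 := hpos ha hσa haγ hda hp₁
    have q2 := hpos ha' hσa' haγ' hda' hp₂
    have h3 := b3 _ hm
    simp only [y, h2, zero_smul, sub_zero] at h3
    rw [hPnn t ht β q1.le q2.le] at h3
    have h4 : 0 ≤ (1 - t) * β p₁ := mul_nonneg (by linarith [ht.2]) q1.le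
    rcases ht.1.eq_or_lt with h5 | h5
    · rw [← h5] at h3
      linarith
    · linarith [mul_pos h5 q2]
  -- faces cut out by the forms in `T`
  have hface : ∀ α ∈ T, ∀ t ∈ Set.Icc (0 : ℝ) 1, α (y t) = 0 → ∃ F ∈ Δ, σ ≤ F ∧ F ≤ γ ∧ F ≠ γ ∧
      (∀ v, v ∈ F ↔ v ∈ γ ∧ α v = 0) ∧ y t ∈ lspan F := by
    intro α hα t ht h0
    obtain ⟨hα1, hα2, hα3⟩ := Finset.mem_filter.1 hα
    obtain ⟨F, f1, f2, f3, f4, f5⟩ :=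
      h.exists_face_of_exit hγ hle hS hp (hy t ht) hα1 hα2 h0
    refine ⟨F, f1, f2, f3, ?_, f4, f5⟩
    rintro rfl
    exact hα3.ne' ((f4 u).1 hu.1).2
  -- A form is good if its face contains an atom with the same value of `φ` as `a`. Forms vanishing
  -- at the start of the path are good, and goodness at the end gives the claim.
  let Good : Dual ℝ V → Prop := fun α => ∃ b ∈ Δ, σ ≤ b ∧ b ≤ γ ∧ cdim b = cdim σ + 1 ∧
    (∀ v ∈ b, α v = 0) ∧ φ b = φ a
  have hclosed : ∀ Q : Dual ℝ V → Prop, IsClosed {t : ℝ | ∃ α ∈ T, Q α ∧ α (y t) = 0} := by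
    intro Q
    have : {t : ℝ | ∃ α ∈ T, Q α ∧ α (y t) = 0} =
        ⋃ α ∈ (T.filter Q : Set (Dual ℝ V)), {t : ℝ | α (y t) = 0} := by
      ext t
      simp [and_assoc]
    rw [this]
    refine Set.Finite.isClosed_biUnion (Finset.finite_toSet _) fun α _ => ?_
    refine isClosed_eq ?_ continuous_const
    simp only [y, P, map_sub, map_add, map_smul, smul_eq_mul]
    fun_prop
  -- At a relative interior point of an atom the push has length zero, as some form of `T` already
  -- vanishes there. Hence every form of `T` vanishing on the path at that time vanishes on the
  -- atom.
  have hstart : ∀ t ∈ Set.Icc (0 : ℝ) 1, ∀ {b : PointedCone ℝ V}, b ∈ Δ → σ ≤ b → b ≤ γ →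
      lspan b ≤ lspan a ⊔ lspan a' → IsRelInt b (P t) → ∀ α ∈ T, α (y t) = 0 →
        ∀ v ∈ b, α v = 0 := by
    intro t ht b hb k1 k2 k3 hq α hα h0 v hv
    obtain ⟨α₁, hα₁, h1⟩ := hend hb k1 k2 k3 hq
    have h2 : s t = 0 := by
      refine le_antisymm ?_ (hs0 t ht)
      have := Finset.inf'_le (fun α => α (P t) / α u) hα₁
      simpa [h1] using this
    simp only [y, h2, zero_smul, sub_zero] at h0
    exact hvan k2 hq (Finset.mem_filter.1 hα).1 h0 v (mem_lspan hv)
  have hPz : P 0 = p₁ := by simp [P]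
  have hPo : P 1 = p₂ := by simp [P]
  have m0 : (0 : ℝ) ∈ Set.Icc (0 : ℝ) 1 := by simp
  have m1 : (1 : ℝ) ∈ Set.Icc (0 : ℝ) 1 := by simp
  have v1 := hstart 1 m1 ha' hσa' haγ' le_sup_right (by rwa [hPo])
  obtain ⟨α₀, hα₀, e0⟩ := hyT 0
  obtain ⟨α₁, hα₁, e1⟩ := hyT 1
  have g0 : Good α₀ := ⟨a, ha, hσa, haγ, hda,
    hstart 0 m0 ha hσa haγ le_sup_left (by rwa [hPz]) α₀ hα₀ e0, rfl⟩
  by_cases g1 : Good α₁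
  · obtain ⟨b, hb, k1, k2, k3, k4, k5⟩ := g1
    obtain ⟨F, f1, f2, f3, f4, f5, -⟩ := hface α₁ hα₁ 1 m1 e1
    rw [← k5]
    exact hF F f1 f2 f3 f4 b hb a' ha' k1 hσa' (fun v hv => (f5 v).2 ⟨k2 hv, k4 v hv⟩)
      (fun v hv => (f5 v).2 ⟨haγ' hv, v1 α₁ hα₁ e1 v hv⟩) k3 hda'
  · exfalso
    -- The closed sets belonging to good and to bad forms cover the interval, so they meet. At a
    -- common time the two faces share an atom over `σ`, since the path avoids `V_σ`, and this atom
    -- makes the bad form good.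
    obtain ⟨t, ht, ⟨α, hα, gα, eα⟩, ⟨α', hα', gα', eα'⟩⟩ :=
      isPreconnected_closed_iff.1 (isPreconnected_Icc (a := (0 : ℝ)) (b := 1)) _ _ (hclosed Good)
        (hclosed fun α => ¬ Good α) (fun t _ => by
          obtain ⟨α, hα, e⟩ := hyT t
          by_cases g : Good α
          · exact Or.inl ⟨α, hα, g, e⟩
          · exact Or.inr ⟨α, hα, g, e⟩) ⟨0, m0, α₀, hα₀, g0, e0⟩ ⟨1, m1, α₁, hα₁, g1, e1⟩
    obtain ⟨F, f1, f2, f3, f4, f5, f6⟩ := hface α hα t ht eα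
    obtain ⟨F', f1', f2', f3', f4', f5', f6'⟩ := hface α' hα' t ht eα'
    have hG : F ⊓ F' ∈ Δ := h.face_mem _ f1 _ (h.inter_left _ f1 _ f1')
    have hne : σ ≠ F ⊓ F' := by
      intro heq
      obtain ⟨ε, hε, hm⟩ := hS.exists_add_smul_mem (hle hp.1) (hy t ht)
      have hp0 := (Finset.mem_filter.1 hα).2.1
      have hp0' := (Finset.mem_filter.1 hα').2.1
      have : p + ε • y t ∈ F ⊓ F' :=
        ⟨(f5 _).2 ⟨hm, by simp [eα, hp0]⟩, (f5' _).2 ⟨hm, by simp [eα', hp0']⟩⟩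
      rw [← heq] at this
      exact hyσ t ht (mem_of_add_smul_mem hε (mem_lspan hp.1) (mem_lspan this))
    obtain ⟨b', hb', j1, j2, j3⟩ := h.exists_atom hσ hG (le_inf f2 f2') hne
    obtain ⟨b, hb, k1, k2, k3, k4, k5⟩ := gα
    refine gα' ⟨b', hb', j1, (j2.trans inf_le_left).trans f3, j3,
      fun v hv => ((f5' v).1 (j2 hv).2).2, ?_⟩
    rw [← k5]
    exact hF F f1 f2 f3 f4 b' hb' b hb j1 k1 (j2.trans inf_le_left)
      (fun v hv => (f5 v).2 ⟨k2 hv, k4 v hv⟩) j3 k3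

end Geometry

/-! ### Volume forms and orientation coefficients -/

section Forms

open Module

variable {V : Type u} [AddCommGroup V] [Module ℝ V]

/-- `b` is a basis of the subspace `U`. -/
structure IsFrame {m : ℕ} (U : Submodule ℝ V) (b : Fin m → V) : Prop where
  mem : ∀ i, b i ∈ U
  li : LinearIndependent ℝ b
  finrank_eq : finrank ℝ U = m

/-- The basis of `U` given by a frame. -/
noncomputable def IsFrame.basis {m : ℕ} {U : Submodule ℝ V} [FiniteDimensional ℝ U] {b : Fin m → V}
    (hb : IsFrame U b) : Basis (Fin m) ℝ U :=
  basisOfLinearIndependentOfCardEqFinrank' (fun i => (⟨b i, hb.mem i⟩ : U))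
    (LinearIndependent.of_comp U.subtype hb.li) (by simp [hb.finrank_eq])

theorem IsFrame.coe_basis {m : ℕ} {U : Submodule ℝ V} [FiniteDimensional ℝ U] {b : Fin m → V}
    (hb : IsFrame U b) (i : Fin m) : (hb.basis i : V) = b i := by
  simp [IsFrame.basis]

theorem exists_isFrame (U : Submodule ℝ V) [FiniteDimensional ℝ U] {m : ℕ} (h : finrank ℝ U = m) :
    ∃ b : Fin m → V, IsFrame U b := by
  subst h
  refine ⟨fun i => finBasis ℝ U i, fun i => Subtype.coe_prop _, ?_, rfl⟩
  exact (finBasis ℝ U).linearIndependent.map' U.subtype U.ker_subtype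

theorem IsFrame.span_eq {m : ℕ} {U : Submodule ℝ V} [FiniteDimensional ℝ U] {b : Fin m → V}
    (hb : IsFrame U b) : Submodule.span ℝ (Set.range b) = U := by
  have h := hb.basis.span_eq
  have := congrArg (Submodule.map U.subtype) h
  rw [Submodule.map_span, Submodule.map_top, Submodule.range_subtype, ← Set.range_comp] at this
  rw [← this]
  congr 2
  ext i
  exact (hb.coe_basis i).symm

theorem IsFrame.snoc {m : ℕ} {U W : Submodule ℝ V} [FiniteDimensional ℝ U] {b : Fin m → V}
    (hb : IsFrame U b) {v : V} (hUW : U ≤ W) (hv : v ∈ W) (hvU : v ∉ U)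
    (hW : finrank ℝ W = m + 1) : IsFrame W (Fin.snoc b v : Fin (m + 1) → V) := by
  refine ⟨fun i => ?_, ?_, hW⟩
  · refine Fin.lastCases ?_ (fun i => ?_) i
    · simpa using hv
    · simpa using hUW (hb.mem i)
  · rw [linearIndependent_finSnoc]
    exact ⟨hb.li, by rwa [hb.span_eq]⟩

/-- The restriction of `Ω` to `U`. -/
noncomputable def restrictForm {m : ℕ} (Ω : V [⋀^Fin m]→ₗ[ℝ] ℝ) (U : Submodule ℝ V) :
    U [⋀^Fin m]→ₗ[ℝ] ℝ := Ω.compLinearMap U.subtype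

theorem restrictForm_basis {m : ℕ} (Ω : V [⋀^Fin m]→ₗ[ℝ] ℝ) {U : Submodule ℝ V}
    [FiniteDimensional ℝ U] {b : Fin m → V} (hb : IsFrame U b) :
    restrictForm Ω U = Ω b • hb.basis.det := by
  have e : restrictForm Ω U hb.basis = Ω b := congrArg Ω (funext hb.coe_basis)
  rw [(restrictForm Ω U).eq_smul_basis_det hb.basis, e]

/-- On `U`, both forms are multiples of the same determinant. -/
theorem form_mul_comm {m : ℕ} (Ω η : V [⋀^Fin m]→ₗ[ℝ] ℝ) {U : Submodule ℝ V}
    [FiniteDimensional ℝ U] {x y : Fin m → V} (hx : IsFrame U x) (hy : ∀ i, y i ∈ U) :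
    Ω x * η y = Ω y * η x := by
  have key : ∀ ω : V [⋀^Fin m]→ₗ[ℝ] ℝ, ω y = ω x * hx.basis.det fun i => ⟨y i, hy i⟩ := by
    intro ω
    have := congrArg (fun f => f fun i => (⟨y i, hy i⟩ : U)) (restrictForm_basis ω hx)
    exact this
  rw [key Ω, key η]
  ring

theorem form_ne_zero {m : ℕ} {Ω : V [⋀^Fin m]→ₗ[ℝ] ℝ} {U : Submodule ℝ V}
    [FiniteDimensional ℝ U] (hΩ : restrictForm Ω U ≠ 0) {x : Fin m → V} (hx : IsFrame U x) :
    Ω x ≠ 0 := by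
  intro h0
  apply hΩ
  rw [restrictForm_basis Ω hx, h0, zero_smul]

/-- By proportionality on `U`, the products of the two values at different frames differ by a
positive factor, so one sign serves all frames. -/
theorem exists_sign {m : ℕ} {Ω η : V [⋀^Fin m]→ₗ[ℝ] ℝ} {U : Submodule ℝ V}
    [FiniteDimensional ℝ U] (hΩ : ∀ x, IsFrame U x → Ω x ≠ 0) (hη : ∀ x, IsFrame U x → η x ≠ 0) :
    ∃ ε : ℤ, (ε = 1 ∨ ε = -1) ∧ ∀ x : Fin m → V, IsFrame U x → 0 < ε * (Ω x * η x) := by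
  by_cases h : ∃ x, IsFrame U x ∧ 0 < Ω x * η x
  · obtain ⟨y, hy, hpos⟩ := h
    refine ⟨1, Or.inl rfl, fun x hx => ?_⟩
    have h1 := form_mul_comm Ω η hx hy.mem
    have h2 : (Ω y * η y) * (Ω x * η x) = (Ω x * η y) ^ 2 := by
      linear_combination (-Ω x * η y) * h1
    have h3 : 0 < (Ω x * η y) ^ 2 := by
      have := mul_ne_zero (hΩ x hx) (hη y hy)
      positivity
    rw [← h2] at h3
    simpa using pos_of_mul_pos_right h3 hpos.le
  · push Not at h
    refine ⟨-1, Or.inr rfl, fun x hx => ?_⟩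
    have h1 := lt_of_le_of_ne (h x hx) (mul_ne_zero (hΩ x hx) (hη x hx))
    push_cast
    linarith

/-- Fix the last argument of an alternating form. -/
noncomputable def snocForm {m : ℕ} (Ω : V [⋀^Fin (m + 1)]→ₗ[ℝ] ℝ) (v : V) :
    V [⋀^Fin m]→ₗ[ℝ] ℝ where
  toFun b := Ω (Fin.snoc b v)
  map_update_add' b i x y := by
    obtain rfl : ‹DecidableEq (Fin m)› = instDecidableEqFin m := Subsingleton.elim _ _
    simp only [Fin.snoc_update, Ω.map_update_add]
  map_update_smul' b i c x := by
    obtain rfl : ‹DecidableEq (Fin m)› = instDecidableEqFin m := Subsingleton.elim _ _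
    simp only [Fin.snoc_update, Ω.map_update_smul]
  map_eq_zero_of_eq' b i j hij hne :=
    Ω.map_eq_zero_of_eq (Fin.snoc b v) (i := i.castSucc) (j := j.castSucc) (by simpa using hij)
      (by simpa using hne)

theorem update_append_right {α : Type*} {d e : ℕ} (b : Fin d → α) (c : Fin e → α) (i : Fin e)
    (x : α) : Fin.append b (Function.update c i x) =
      Function.update (Fin.append b c) (Fin.natAdd d i) x := by
  ext j
  refine Fin.addCases (fun j => ?_) (fun j => ?_) j
  · rw [Fin.append_left, Function.update_of_ne, Fin.append_left]
    simp only [ne_eq, Fin.ext_iff, Fin.val_castAdd, Fin.val_natAdd]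
    omega
  · rw [Fin.append_right]
    by_cases h : j = i
    · subst h
      simp
    · rw [Function.update_of_ne h, Function.update_of_ne, Fin.append_right]
      simpa [Fin.ext_iff] using h

/-- Fix the first arguments of an alternating form. -/
noncomputable def appendForm {d e : ℕ} (Ω : V [⋀^Fin (d + e)]→ₗ[ℝ] ℝ) (b : Fin d → V) :
    V [⋀^Fin e]→ₗ[ℝ] ℝ where
  toFun c := Ω (Fin.append b c)
  map_update_add' c i x y := by
    obtain rfl : ‹DecidableEq (Fin e)› = instDecidableEqFin e := Subsingleton.elim _ _
    simp only [update_append_right, Ω.map_update_add]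
  map_update_smul' c i r x := by
    obtain rfl : ‹DecidableEq (Fin e)› = instDecidableEqFin e := Subsingleton.elim _ _
    simp only [update_append_right, Ω.map_update_smul]
  map_eq_zero_of_eq' c i j hij hne :=
    Ω.map_eq_zero_of_eq (Fin.append b c) (i := Fin.natAdd d i) (j := Fin.natAdd d j)
      (by simpa using hij) (by simpa [Fin.ext_iff] using hne)

theorem form_snoc_eq_zero {m : ℕ} (Ω : V [⋀^Fin (m + 1)]→ₗ[ℝ] ℝ) {U : Submodule ℝ V}
    [FiniteDimensional ℝ U] {b : Fin m → V} (hb : IsFrame U b) {v : V} (hv : v ∈ U) :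
    Ω (Fin.snoc b v) = 0 := by
  apply AlternatingMap.map_linearDependent
  rw [linearIndependent_finSnoc, hb.span_eq]
  exact fun h => h.2 hv

theorem form_snoc_add {m : ℕ} (Ω : V [⋀^Fin (m + 1)]→ₗ[ℝ] ℝ) (b : Fin m → V) (v w : V) :
    Ω (Fin.snoc b (v + w)) = Ω (Fin.snoc b v) + Ω (Fin.snoc b w) := by
  have := Ω.map_update_add (Fin.snoc b (0 : V)) (Fin.last m) v w
  simpa only [Fin.update_snoc_last] using this

theorem form_snoc_smul {m : ℕ} (Ω : V [⋀^Fin (m + 1)]→ₗ[ℝ] ℝ) (b : Fin m → V) (c : ℝ) (v : V) :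
    Ω (Fin.snoc b (c • v)) = c * Ω (Fin.snoc b v) := by
  have := Ω.map_update_smul (Fin.snoc b (0 : V)) (Fin.last m) c v
  simpa only [Fin.update_snoc_last, smul_eq_mul] using this

/-- After a frame of `U`, only the class of the last vector modulo `U` matters. This makes
coefficients independent of the chosen inward vector. -/
theorem form_snoc_congr {m : ℕ} (Ω : V [⋀^Fin (m + 1)]→ₗ[ℝ] ℝ) {U : Submodule ℝ V}
    [FiniteDimensional ℝ U] {b : Fin m → V} (hb : IsFrame U b) {v w : V} (hv : v - w ∈ U) :
    Ω (Fin.snoc b v) = Ω (Fin.snoc b w) := by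
  have := form_snoc_add Ω b (v - w) w
  rwa [sub_add_cancel, form_snoc_eq_zero Ω hb hv, zero_add] at this

theorem form_snoc_swap {m : ℕ} (Ω : V [⋀^Fin (m + 2)]→ₗ[ℝ] ℝ) (b : Fin m → V) (v w : V) :
    Ω (Fin.snoc (Fin.snoc b v : Fin (m + 1) → V) w) =
      -Ω (Fin.snoc (Fin.snoc b w : Fin (m + 1) → V) v) := by
  have hne : (Fin.last m).castSucc ≠ Fin.last (m + 1) := (Fin.castSucc_lt_last _).ne
  rw [← Ω.map_swap _ hne]
  congr 1
  ext i
  refine Fin.lastCases ?_ (fun i => Fin.lastCases ?_ (fun i => ?_) i) i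
  · simp
  · simp
  · rw [Function.comp_apply, Equiv.swap_apply_of_ne_of_ne]
    · simp
    · simp [Fin.ext_iff, i.2.ne]
    · exact (Fin.castSucc_lt_last _).ne

end Forms

/-! ### Orientation signs in diamonds and across walls. -/

section Orientations

open Module

variable {V : Type u} [AddCommGroup V] [Module ℝ V] [FiniteDimensional ℝ V]
variable {Δ : Finset (PointedCone ℝ V)}

theorem exists_lspanProj (σ : PointedCone ℝ V) :
    ∃ f : V →ₗ[ℝ] lspan σ, f ∘ₗ (lspan σ).subtype = LinearMap.id :=
  (lspan σ).subtype.exists_leftInverse_of_injective (lspan σ).ker_subtype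

/-- A linear projection of `V` onto `V_σ`. -/
noncomputable def lspanProj (σ : PointedCone ℝ V) : V →ₗ[ℝ] lspan σ := (exists_lspanProj σ).choose

theorem lspanProj_coe (σ : PointedCone ℝ V) (x : lspan σ) : lspanProj σ x = x :=
  LinearMap.congr_fun (exists_lspanProj σ).choose_spec x

/-- A form on `V` whose restriction to `V_σ` represents the orientation of `V_σ`. -/
noncomputable def Orient.vol (o : Orient Δ) (σ : Δ) {m : ℕ} (h : cdim σ.1 = m) :
    V [⋀^Fin m]→ₗ[ℝ] ℝ :=
  ((o.or σ).someVector.compLinearMap (lspanProj σ.1)).domDomCongr (finCongr h)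

theorem Orient.vol_apply (o : Orient Δ) (σ : Δ) (c : Fin (cdim σ.1) → lspan σ.1) {m : ℕ}
    (h : cdim σ.1 = m) {b : Fin m → V}
    (hb : ∀ (i : Fin m) (j : Fin (cdim σ.1)), (i : ℕ) = j → b i = c j) :
    o.vol σ h b = (o.or σ).someVector c := by
  change (o.or σ).someVector (fun j => lspanProj σ.1 (b (finCongr h j))) = _
  congr 1
  ext j
  rw [hb (finCongr h j) j rfl, lspanProj_coe]

theorem Orient.vol_ne_zero (o : Orient Δ) (σ : Δ) {m : ℕ} (h : cdim σ.1 = m) {x : Fin m → V}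
    (hx : IsFrame (lspan σ.1) x) : o.vol σ h x ≠ 0 := by
  subst h
  refine form_ne_zero (fun h0 => (o.or σ).someVector_ne_zero ?_) hx
  ext c
  have := congrArg (fun f => f c) h0
  rw [← o.vol_apply σ c rfl (b := fun i => c i) (fun i j hij => by rw [Fin.ext hij])]
  exact this

/-- The characterization of the orientation coefficient of a facet `τ` of `σ`. -/
theorem Orient.coeff_spec (o : Orient Δ) {σ τ : Δ} (hf : IsFace τ.1 σ.1) {m : ℕ}
    (hτ : cdim τ.1 = m) (hσ : cdim σ.1 = m + 1) {b : Fin m → V} (hb : IsFrame (lspan τ.1) b)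
    {v : V} (hv : v ∈ σ.1) (hvτ : v ∉ lspan τ.1) :
    0 < (o.coeff σ τ : ℝ) * (o.vol τ hτ b * o.vol σ hσ (Fin.snoc b v)) := by
  obtain ⟨β, b1, b2⟩ := hf
  have hle : τ.1 ≤ σ.1 := fun v hv => ((b2 v).1 hv).1
  have b3 : ∀ v ∈ lspan τ.1, β v = 0 := fun v hv =>
    dual_eq_zero_of_mem_lspan (fun w hw => ((b2 w).1 hw).2) hv
  have hfr : ∀ {b : Fin m → V} (_ : IsFrame (lspan τ.1) b),
      IsFrame (lspan σ.1) (Fin.snoc b v : Fin (m + 1) → V) := fun hb =>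
    hb.snoc (lspan_mono hle) (mem_lspan hv) hvτ hσ
  -- The candidate `ε` compares the orientation of `V_τ` with that of `V_σ` contracted in the last
  -- slot with the inward vector `v`.
  obtain ⟨ε, hε, hsign⟩ := exists_sign (Ω := o.vol τ hτ) (η := snocForm (o.vol σ hσ) v)
    (fun x hx => o.vol_ne_zero τ hτ hx) (fun x hx => o.vol_ne_zero σ hσ (hfr hx))
  suffices o.coeff σ τ = ε by
    rw [this]
    exact hsign b hb
  -- compare different vectors of `σ` outside `V_τ`
  have hpos : ∀ {w : V}, w ∈ σ.1 → w ∉ lspan τ.1 → 0 < β w := fun {w} hw hwτ =>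
    lt_of_le_of_ne (b1 w hw) fun h0 => hwτ (mem_lspan ((b2 w).2 ⟨hw, h0.symm⟩))
  have hcomp : ∀ {b : Fin m → V} (_ : IsFrame (lspan τ.1) b) {w : V}, w ∈ σ.1 →
      w ∉ lspan τ.1 → ∃ r : ℝ, 0 < r ∧
        o.vol σ hσ (Fin.snoc b w) = r * o.vol σ hσ (Fin.snoc b v) := by
    intro b hb w hw hwτ
    have hd : finrank ℝ (lspan σ.1) ≤ finrank ℝ (lspan τ.1) + 1 := (hσ.trans (by rw [← hτ]; rfl)).le
    obtain ⟨r, hr⟩ := exists_eq_add_smul_of_finrank (lspan_mono hle) hd (mem_lspan hv) hvτ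
      (mem_lspan hw)
    refine ⟨r, ?_, ?_⟩
    · have := b3 _ hr
      rw [map_sub, map_smul, smul_eq_mul, sub_eq_zero] at this
      have h1 := hpos hw hwτ
      rw [this] at h1
      exact pos_of_mul_pos_left h1 (hpos hv hvτ).le
    · rw [form_snoc_congr _ hb hr, form_snoc_smul]
  subst hτ
  have hiff : (∃ (b : Fin (cdim τ.1) → lspan τ.1) (c : Fin (cdim σ.1) → lspan σ.1),
      (∀ (i : Fin (cdim τ.1)) (j : Fin (cdim σ.1)), (i : ℕ) = j → (b i : V) = c j) ∧
      (∀ j : Fin (cdim σ.1), (j : ℕ) = cdim τ.1 → (c j : V) ∈ σ.1) ∧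
      0 < (o.or τ).someVector b * (o.or σ).someVector c) ↔ ε = 1 := by
    constructor
    · rintro ⟨b, c, h1, h2, h3⟩
      let b' : Fin (cdim τ.1) → V := fun i => b i
      let w : V := c (finCongr hσ.symm (Fin.last _))
      have hwσ : w ∈ σ.1 := h2 _ rfl
      have e1 : o.vol τ rfl b' = (o.or τ).someVector b :=
        o.vol_apply τ b rfl fun i j hij => by rw [← Fin.ext hij]
      have e2 : o.vol σ hσ (Fin.snoc b' w) = (o.or σ).someVector c := by
        refine o.vol_apply σ c hσ fun i j => ?_
        refine Fin.lastCases (fun hij => ?_) (fun i hij => ?_) i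
        · rw [Fin.snoc_last]
          refine congrArg (fun k => (c k : V)) (?_ : finCongr hσ.symm (Fin.last _) = j)
          exact Fin.ext hij
        · rw [Fin.snoc_castSucc]
          exact h1 i j hij
      rw [← e1, ← e2] at h3
      -- A strictly positive product excludes degenerate witnesses: a dependent family, or a last
      -- vector inside `V_τ`, would make it zero.
      have hb' : IsFrame (lspan τ.1) b' := by
        refine ⟨fun i => (b i).2, ?_, rfl⟩
        by_contra hli
        rw [(o.vol τ rfl).map_linearDependent _ hli, zero_mul] at h3
        exact h3.false
      have hw : w ∉ lspan τ.1 := fun hw => by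
        rw [form_snoc_eq_zero _ hb' hw, mul_zero] at h3
        exact h3.false
      obtain ⟨r, hr, e⟩ := hcomp hb' hwσ hw
      rw [e, mul_left_comm] at h3
      have h4 := pos_of_mul_pos_right h3 hr.le
      have h5 := hsign b' hb'
      have h6 : (0 : ℝ) < ε := pos_of_mul_pos_left h5 h4.le
      rcases hε with h | h
      · exact h
      · rw [h] at h6
        norm_num at h6
    · rintro rfl
      refine ⟨fun i => ⟨b i, hb.mem i⟩, fun j => ⟨(Fin.snoc b v : Fin (cdim τ.1 + 1) → V)
        (finCongr hσ j), (hfr hb).mem _⟩, ?_, ?_, ?_⟩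
      · intro i j hij
        have : finCongr hσ j = i.castSucc := Fin.ext hij.symm
        simp only [this, Fin.snoc_castSucc]
      · intro j hj
        have : finCongr hσ j = Fin.last _ := Fin.ext hj
        simp only [this, Fin.snoc_last]
        exact hv
      · rw [← o.vol_apply τ (b := b) _ rfl (fun i j hij => by rw [Fin.ext hij]),
          ← o.vol_apply σ (b := Fin.snoc b v) _ hσ
            (fun i j hij => by
              have : finCongr hσ j = i := Fin.ext hij.symm
              simp only [this])]
        have := hsign b hb
        change 0 < ((1 : ℤ) : ℝ) * (_ * o.vol σ hσ (Fin.snoc b v)) at this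
        simpa using this
  rw [Orient.coeff]
  rcases hε with rfl | rfl
  · rw [if_pos (hiff.2 rfl)]
  · rw [if_neg (fun hc => by simpa using hiff.1 hc)]

theorem IsFan.isFace (hΔ : IsFan Δ) {τ σ : Δ} (h : τ.1 ≤ σ.1) : IsFace τ.1 σ.1 :=
  (hΔ.isFace_iff_le τ.2 σ.2).2 h

theorem Orient.coeff_eq (o : Orient Δ) (σ τ : Δ) : o.coeff σ τ = 1 ∨ o.coeff σ τ = -1 := by
  rw [Orient.coeff]
  split_ifs <;> simp

/-- The two ways through a diamond have opposite signs. -/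
theorem Orient.coeff_diamond (o : Orient Δ) (hΔ : IsFan Δ) {γ ρ₁ ρ₂ τ : Δ} (h₁ : τ.1 ≤ ρ₁.1)
    (h₂ : τ.1 ≤ ρ₂.1) (k₁ : ρ₁.1 ≤ γ.1) (k₂ : ρ₂.1 ≤ γ.1) (hne : ρ₁ ≠ ρ₂)
    (hd₁ : cdim ρ₁.1 = cdim τ.1 + 1) (hd₂ : cdim ρ₂.1 = cdim τ.1 + 1)
    (hd : cdim γ.1 = cdim τ.1 + 2) :
    o.coeff γ ρ₁ * o.coeff ρ₁ τ + o.coeff γ ρ₂ * o.coeff ρ₂ τ = 0 := by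
  have aux : ∀ ρ : Δ, cdim ρ.1 = cdim τ.1 + 1 → τ.1 ≠ ρ.1 := by
    rintro ρ hρ heq
    rw [heq] at hρ
    omega
  obtain ⟨b, hb⟩ := exists_isFrame (lspan τ.1) (m := cdim τ.1) rfl
  obtain ⟨v₁, hv₁, hn₁⟩ := hΔ.exists_mem_notMem_lspan τ.2 ρ₁.2 h₁ (aux _ hd₁)
  obtain ⟨v₂, hv₂, hn₂⟩ := hΔ.exists_mem_notMem_lspan τ.2 ρ₂.2 h₂ (aux _ hd₂)
  have m₂ : v₂ ∉ lspan ρ₁.1 := fun hm => hne (Subtype.ext (hΔ.eq_of_mem_lspan ρ₁.2 ρ₂.2 γ.2 h₁ h₂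
    k₁ k₂ hd₁ hd₂ hm (mem_lspan hv₂) hn₂))
  have m₁ : v₁ ∉ lspan ρ₂.1 := fun hm => hne (Subtype.ext (hΔ.eq_of_mem_lspan ρ₁.2 ρ₂.2 γ.2 h₁ h₂
    k₁ k₂ hd₁ hd₂ (mem_lspan hv₁) hm hn₁))
  have f₁ := hb.snoc (lspan_mono h₁) (mem_lspan hv₁) hn₁ hd₁
  have f₂ := hb.snoc (lspan_mono h₂) (mem_lspan hv₂) hn₂ hd₂
  have a₁ := o.coeff_spec (hΔ.isFace h₁) rfl hd₁ hb hv₁ hn₁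
  have a₂ := o.coeff_spec (hΔ.isFace h₂) rfl hd₂ hb hv₂ hn₂
  have a₃ := o.coeff_spec (hΔ.isFace k₁) hd₁ hd f₁ (k₂ hv₂) m₂
  have a₄ := o.coeff_spec (hΔ.isFace k₂) hd₂ hd f₂ (k₁ hv₁) m₁
  -- The two paths complete the frame of `V_τ` to frames of `V_γ` that differ by a transposition.
  -- This is the only source of the minus sign; all other factors occur squared or in common.
  rw [form_snoc_swap] at a₄
  have p₁ := mul_pos a₁ a₃
  have p₂ := mul_pos a₂ a₄
  generalize o.vol τ rfl b = A at *
  generalize o.vol ρ₁ hd₁ (Fin.snoc b v₁) = B₁ at *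
  generalize o.vol ρ₂ hd₂ (Fin.snoc b v₂) = B₂ at *
  generalize o.vol γ hd (Fin.snoc (Fin.snoc b v₁ : Fin (cdim τ.1 + 1) → V) v₂) = C at *
  have q₁ : 0 < (o.coeff γ ρ₁ * o.coeff ρ₁ τ : ℝ) * (A * C) * B₁ ^ 2 := lt_of_lt_of_eq p₁ (by ring)
  have q₂ : 0 < -(o.coeff γ ρ₂ * o.coeff ρ₂ τ : ℝ) * (A * C) * B₂ ^ 2 := lt_of_lt_of_eq p₂ (by ring)
  have r₁ := pos_of_mul_pos_left q₁ (sq_nonneg _)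
  have r₂ := pos_of_mul_pos_left q₂ (sq_nonneg _)
  rcases o.coeff_eq γ ρ₁ with e₁ | e₁ <;> rcases o.coeff_eq ρ₁ τ with e₂ | e₂ <;>
    rcases o.coeff_eq γ ρ₂ with e₃ | e₃ <;> rcases o.coeff_eq ρ₂ τ with e₄ | e₄ <;>
    rw [e₁, e₂] at r₁ <;> rw [e₃, e₄] at r₂ <;> rw [e₁, e₂, e₃, e₄] <;> norm_num at r₁ r₂ ⊢ <;>
    linarith

/-- The constancy of the orientations on the full-dimensional cones, expressed by forms on the
common space `V`. -/
theorem Orient.vol_mul_nonneg (o : Orient Δ) {γ₁ γ₂ : Δ} {n : ℕ} (hn : finrank ℝ V = n)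
    (hd₁ : cdim γ₁.1 = n) (hd₂ : cdim γ₂.1 = n) (x : Fin n → V) :
    0 ≤ o.vol γ₁ hd₁ x * o.vol γ₂ hd₂ x := by
  have key : ∀ {σ : Δ}, cdim σ.1 = n → ∀ v, v ∈ lspan σ.1 := fun {σ} hσ v => by
    have : lspan σ.1 = ⊤ := Submodule.eq_top_of_finrank_eq (hσ.trans hn.symm)
    rw [this]
    trivial
  rw [o.vol_apply γ₁ (fun j => ⟨x (finCongr hd₁ j), key hd₁ _⟩) hd₁
      (fun i j hij => congrArg x (Fin.ext hij)),
    o.vol_apply γ₂ (fun j => ⟨x (finCongr hd₂ j), key hd₂ _⟩) hd₂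
      (fun i j hij => congrArg x (Fin.ext hij))]
  exact o.const γ₁ γ₂ (hd₁.trans hn.symm) (hd₂.trans hn.symm) _ _ fun i j hij =>
    congrArg x (Fin.ext hij)

/-- The coefficients of a wall in its two adjacent full-dimensional cones are opposite. -/
theorem Orient.coeff_wall (o : Orient Δ) (hΔ : IsFan Δ) {γ₁ γ₂ ρ : Δ} (h₁ : ρ.1 ≤ γ₁.1)
    (h₂ : ρ.1 ≤ γ₂.1) (hd : cdim ρ.1 + 1 = finrank ℝ V) (hd₁ : cdim γ₁.1 = finrank ℝ V)
    (hd₂ : cdim γ₂.1 = finrank ℝ V) (hne : γ₁ ≠ γ₂) : o.coeff γ₁ ρ + o.coeff γ₂ ρ = 0 := by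
  have aux : ∀ γ : Δ, cdim γ.1 = finrank ℝ V → ρ.1 ≠ γ.1 := by
    rintro γ hγ heq
    rw [heq] at hd
    omega
  rw [← hd] at hd₁ hd₂
  obtain ⟨b, hb⟩ := exists_isFrame (lspan ρ.1) (m := cdim ρ.1) rfl
  obtain ⟨v₁, hv₁, hn₁⟩ := hΔ.exists_mem_notMem_lspan ρ.2 γ₁.2 h₁ (aux _ (hd₁.trans hd))
  obtain ⟨v₂, hv₂, hn₂⟩ := hΔ.exists_mem_notMem_lspan ρ.2 γ₂.2 h₂ (aux _ (hd₂.trans hd))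
  obtain ⟨c, hc, e⟩ := hΔ.wall_opposite ρ.2 γ₁.2 γ₂.2 h₁ h₂ hd (hd₁.trans hd) (hd₂.trans hd)
    (fun h => hne (Subtype.ext h)) hv₁ hv₂ hn₁ hn₂
  have a₁ := o.coeff_spec (hΔ.isFace h₁) rfl hd₁ hb hv₁ hn₁
  have a₂ := o.coeff_spec (hΔ.isFace h₂) rfl hd₂ hb hv₂ hn₂
  -- The inward vectors of the two cones are opposite modulo `V_ρ`, while the orientations agree;
  -- hence opposite coefficients.
  have hsn : o.vol γ₂ hd₂ (Fin.snoc b v₂) = -c * o.vol γ₂ hd₂ (Fin.snoc b v₁) := by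
    rw [← form_snoc_smul]
    refine form_snoc_congr _ hb ?_
    convert e using 1
    module
  have hnn := o.vol_mul_nonneg hd.symm hd₁ hd₂ (Fin.snoc b v₁ : Fin (cdim ρ.1 + 1) → V)
  rw [hsn] at a₂
  generalize o.vol ρ rfl b = A at *
  generalize o.vol γ₁ hd₁ (Fin.snoc b v₁) = B₁ at *
  generalize o.vol γ₂ hd₂ (Fin.snoc b v₁) = B₂ at *
  have p := mul_pos a₁ a₂
  have q : 0 < -(o.coeff γ₁ ρ * o.coeff γ₂ ρ : ℝ) * (A ^ 2 * c * (B₁ * B₂)) := lt_of_lt_of_eq p (by ring)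
  have r : (0 : ℝ) < -(o.coeff γ₁ ρ * o.coeff γ₂ ρ : ℝ) := by
    refine pos_of_mul_pos_left q ?_
    positivity
  rcases o.coeff_eq γ₁ ρ with e₁ | e₁ <;> rcases o.coeff_eq γ₂ ρ with e₂ | e₂ <;>
    first
    | (simp [e₁, e₂]; done)
    | (exfalso; rw [e₁, e₂] at r; norm_num at r)

end Orientations

/-! ### Exactness of cellular complexes -/

section SheafMaps

universe w₁ w₂

variable {V : Type u} [AddCommGroup V] [Module ℝ V]
variable {R R' : Type*} [CommRing R] [CommRing R'] {Δ : Finset (PointedCone ℝ V)}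

namespace FanSheaf

open Classical in
theorem coboundary_apply (F : FanSheaf.{u, w} R Δ) (o : Orient Δ) (Λ : Set (PointedCone ℝ V))
    (k : ℕ) (f : F.Cochain Λ k) (τ : Cell Δ Λ (k + 1)) :
    F.coboundary o Λ k f τ = ∑ σ : Cell Δ Λ k,
      if h : τ.1.1 ≤ σ.1.1 then o.coeff σ.1 τ.1 • F.res h (f σ) else 0 := by
  simp only [coboundary, LinearMap.pi_apply, LinearMap.sum_apply]
  refine Finset.sum_congr rfl fun σ _ => ?_
  split_ifs <;> simp

theorem augmentation_apply (F : FanSheaf.{u, w} R Δ) (f : F.global) (σ : Cell Δ (boundary Δ) 0) :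
    F.augmentation f σ = f.1 ⟨σ.1, trivial⟩ := rfl

/-- Exactness of the augmented relative cellular complex at its `k`-th module, where `k = 0` stands
for `C⁰`. -/
def ExactAt (F : FanSheaf.{u, w} R Δ) (o : Orient Δ) : ℕ → Prop
  | 0 => Function.Exact F.augmentation (F.coboundary o (boundary Δ) 0)
  | k + 1 => Function.Exact (F.coboundary o (boundary Δ) k) (F.coboundary o (boundary Δ) (k + 1))

theorem isAugAcyclic_iff (F : FanSheaf.{u, w} R Δ) (o : Orient Δ) :
    F.IsAugAcyclic o ↔ Function.Injective F.augmentation ∧ ∀ k, F.ExactAt o k :=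
  and_congr_right fun _ => ⟨fun h k => by cases k; exacts [h.1, h.2 _],
    fun h => ⟨h 0, fun k => h (k + 1)⟩⟩

/-- An additive map of sheaves. -/
structure Hom (F : FanSheaf.{u, w₁} R Δ) (G : FanSheaf.{u, w₂} R' Δ) where
  app : ∀ σ, F.obj σ →+ G.obj σ
  comm : ∀ {σ τ : Δ} (h : τ.1 ≤ σ.1) (x : F.obj σ), app τ (F.res h x) = G.res h (app σ x)

variable {F : FanSheaf.{u, w₁} R Δ} {G : FanSheaf.{u, w₂} R' Δ}

namespace Hom

/-- The induced map of cochains. -/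
def cochain (φ : Hom F G) {Λ : Set (PointedCone ℝ V)} {k : ℕ} (f : F.Cochain Λ k) :
    G.Cochain Λ k := fun σ => φ.app σ.1 (f σ)

/-- The induced map of global sections. -/
def global (φ : Hom F G) (f : F.global) : G.global :=
  ⟨fun σ => φ.app σ.1 (f.1 σ), fun σ τ h => by rw [← φ.comm h, f.2 σ τ h]⟩

/-- The coefficients are integers, so additivity suffices and the two sheaves may live over
different rings. This matters because the splittings below are only ℝ-linear. -/
theorem coboundary_cochain (φ : Hom F G) (o : Orient Δ) (Λ : Set (PointedCone ℝ V)) {k : ℕ}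
    (f : F.Cochain Λ k) :
    G.coboundary o Λ k (φ.cochain f) = φ.cochain (F.coboundary o Λ k f) := by
  funext τ
  rw [coboundary_apply, cochain, coboundary_apply, map_sum]
  refine Finset.sum_congr rfl fun σ _ => ?_
  split_ifs with h
  · rw [map_zsmul, φ.comm, cochain]
  · rw [map_zero]

theorem augmentation_global (φ : Hom F G) (f : F.global) :
    G.augmentation (φ.global f) = φ.cochain (F.augmentation f) := rfl

theorem cochain_zero (φ : Hom F G) {Λ : Set (PointedCone ℝ V)} {k : ℕ} :
    φ.cochain (0 : F.Cochain Λ k) = 0 := funext fun σ => map_zero (φ.app σ.1)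

end Hom

/-- Exactness passes to retracts. -/
theorem ExactAt.of_retract (i : Hom F G) (p : Hom G F) (hpi : ∀ σ x, p.app σ (i.app σ x) = x)
    {o : Orient Δ} {k : ℕ} (h : G.ExactAt o k) : F.ExactAt o k := by
  have hc : ∀ {k} (f : F.Cochain (boundary Δ) k), p.cochain (i.cochain f) = f :=
    fun f => funext fun σ => hpi _ _
  cases k with
  | zero =>
    intro f
    constructor
    · intro hf
      have h1 : G.coboundary o (boundary Δ) 0 (i.cochain f) = 0 := by
        rw [i.coboundary_cochain, hf, i.cochain_zero]
      obtain ⟨g, hg⟩ := (h _).1 h1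
      exact ⟨p.global g, by rw [p.augmentation_global, hg, hc]⟩
    · rintro ⟨g, rfl⟩
      have h1 := (h _).2 ⟨i.global g, rfl⟩
      rw [i.augmentation_global, i.coboundary_cochain] at h1
      have h2 := congrArg p.cochain h1
      rwa [hc, p.cochain_zero] at h2
  | succ k =>
    intro f
    constructor
    · intro hf
      have h1 : G.coboundary o (boundary Δ) (k + 1) (i.cochain f) = 0 := by
        rw [i.coboundary_cochain, hf, i.cochain_zero]
      obtain ⟨g, hg⟩ := (h _).1 h1
      exact ⟨p.cochain g, by rw [p.coboundary_cochain, hg, hc]⟩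
    · rintro ⟨g, rfl⟩
      have h1 := (h _).2 ⟨i.cochain g, rfl⟩
      rw [i.coboundary_cochain, i.coboundary_cochain] at h1
      have h2 := congrArg p.cochain h1
      rwa [hc, p.cochain_zero] at h2

/-- The product of a family of sheaves. -/
def pi {ι : Type*} (F : ι → FanSheaf.{u, w} R Δ) : FanSheaf R Δ where
  obj σ := ∀ i, (F i).obj σ
  res h := LinearMap.pi fun i => (F i).res h ∘ₗ LinearMap.proj i
  res_self σ h x := funext fun i => (F i).res_self σ h (x i)
  res_res h h' x := funext fun i => (F i).res_res h h' (x i)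

/-- The projections of a product of sheaves. -/
def pi.proj {ι : Type*} (F : ι → FanSheaf.{u, w} R Δ) (i : ι) : Hom (pi F) (F i) where
  app σ := Pi.evalAddMonoidHom (fun i => (F i).obj σ) i
  comm _ _ := rfl

open Classical in
/-- The inclusion of a factor of a product of sheaves. -/
def pi.single {ι : Type*} (F : ι → FanSheaf.{u, w} R Δ) (i : ι) : Hom (F i) (pi F) where
  app σ := AddMonoidHom.single (fun i => (F i).obj σ) i
  comm {σ τ} h x := by
    funext j
    change Pi.single (M := fun i => (F i).obj τ) i ((F i).res h x) j =
      (F j).res h (Pi.single (M := fun i => (F i).obj σ) i x j)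
    by_cases hj : j = i
    · subst hj
      simp
    · simp [Pi.single_eq_of_ne hj]

theorem pi.proj_single {ι : Type*} (F : ι → FanSheaf.{u, w} R Δ) (i : ι) (σ : Δ)
    (x : (F i).obj σ) : (pi.proj F i).app σ ((pi.single F i).app σ x) = x := by
  classical
  exact Pi.single_eq_same (M := fun i => (F i).obj σ) i x

/-- Cocycles and primitives are chosen factor by factor, with no finiteness of the index type. -/
theorem ExactAt.pi {ι : Type*} {F : ι → FanSheaf.{u, w} R Δ} {o : Orient Δ} {k : ℕ}
    (h : ∀ i, (F i).ExactAt o k) : (FanSheaf.pi F).ExactAt o k := by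
  have hz : ∀ {k} {f : (FanSheaf.pi F).Cochain (boundary Δ) k},
      (∀ i, (FanSheaf.pi.proj F i).cochain f = 0) → f = 0 := fun hf => by
    funext σ
    funext i
    exact congrFun (hf i) σ
  cases k with
  | zero =>
    intro f
    constructor
    · intro hf
      have h1 : ∀ i, (F i).coboundary o (boundary Δ) 0 ((FanSheaf.pi.proj F i).cochain f) = 0 := fun i => by
        rw [Hom.coboundary_cochain, hf, Hom.cochain_zero]
      choose g hg using fun i => (h i _).1 (h1 i)
      refine ⟨⟨fun σ i => (g i).1 σ, fun σ τ hle => funext fun i => (g i).2 σ τ hle⟩, ?_⟩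
      funext σ
      funext i
      exact congrFun (hg i) σ
    · rintro ⟨g, rfl⟩
      refine hz fun i => ?_
      rw [← Hom.coboundary_cochain, ← Hom.augmentation_global]
      exact (h i _).2 ⟨_, rfl⟩
  | succ k =>
    intro f
    constructor
    · intro hf
      have h1 : ∀ i, (F i).coboundary o (boundary Δ) (k + 1) ((FanSheaf.pi.proj F i).cochain f) = 0 :=
        fun i => by rw [Hom.coboundary_cochain, hf, Hom.cochain_zero]
      choose g hg using fun i => (h i _).1 (h1 i)
      let g' : (FanSheaf.pi F).Cochain (boundary Δ) k := fun σ i => g i σ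
      refine ⟨g', ?_⟩
      funext σ
      funext i
      have := congrFun ((FanSheaf.pi.proj F i).coboundary_cochain o (boundary Δ) g') σ
      exact this.symm.trans (congrFun (hg i) σ)
    · rintro ⟨g, rfl⟩
      refine hz fun i => ?_
      rw [← Hom.coboundary_cochain, ← Hom.coboundary_cochain]
      exact (h i _).2 ⟨_, rfl⟩

end FanSheaf

end SheafMaps

/-! ### Star sheaves with coefficients in a vector space. -/

section Star

universe w₁ w₂

variable {V : Type u} [AddCommGroup V] [Module ℝ V] {Δ : Finset (PointedCone ℝ V)}

/-- The sheaf with value `K` on the cones that contain `s`, and zero elsewhere. -/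
def starSheaf (s : Δ) (K : Type w) [AddCommGroup K] [Module ℝ K] : FanSheaf.{u, w} ℝ Δ where
  obj σ := PLift (s.1 ≤ σ.1) → K
  res h := { toFun := fun f hs => f ⟨hs.down.trans h⟩
             map_add' := fun _ _ => rfl
             map_smul' := fun _ _ => rfl }
  res_self _ _ _ := rfl
  res_res _ _ _ := rfl

/-- The map of star sheaves induced by a map of coefficients. -/
def starMap (s : Δ) {K : Type w₁} {L : Type w₂} [AddCommGroup K] [Module ℝ K] [AddCommGroup L]
    [Module ℝ L] (φ : K →ₗ[ℝ] L) : (starSheaf s K).Hom (starSheaf s L) where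
  app _ := { toFun := fun f hs => φ (f hs)
             map_zero' := funext fun _ => map_zero φ
             map_add' := fun _ _ => funext fun _ => map_add φ _ _ }
  comm _ _ := rfl

/-- A basis embeds `K` as a retract of a product of copies of ℝ, and exactness passes to products
and retracts. -/
theorem starSheaf_exactAt (s : Δ) (K : Type w) [AddCommGroup K] [Module ℝ K] {o : Orient Δ}
    {k : ℕ} (h : (starSheaf s ℝ).ExactAt o k) : (starSheaf s K).ExactAt o k := by
  let b := Module.Basis.ofVectorSpace ℝ K
  let I := Module.Basis.ofVectorSpaceIndex ℝ K
  let φ : K →ₗ[ℝ] (I → ℝ) := Finsupp.lcoeFun ∘ₗ b.repr.toLinearMap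
  obtain ⟨ψ, hψ⟩ := φ.exists_leftInverse_of_injective (LinearMap.ker_eq_bot.2
    (DFunLike.coe_injective.comp b.repr.injective))
  have h1 : (starSheaf s (I → ℝ)).ExactAt o k := by
    let i : (starSheaf s (I → ℝ)).Hom (FanSheaf.pi fun _ : I => starSheaf s ℝ) :=
      ⟨fun _ => ⟨⟨fun f i hs => f hs i, rfl⟩, fun _ _ => rfl⟩, fun _ _ => rfl⟩
    let p : (FanSheaf.pi fun _ : I => starSheaf s ℝ).Hom (starSheaf s (I → ℝ)) :=
      ⟨fun _ => ⟨⟨fun f hs i => f i hs, rfl⟩, fun _ _ => rfl⟩, fun _ _ => rfl⟩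
    exact FanSheaf.ExactAt.of_retract i p (fun _ _ => rfl) (FanSheaf.ExactAt.pi fun _ => h)
  exact h1.of_retract (starMap s φ) (starMap s ψ)
    (fun σ x => funext fun hs => LinearMap.congr_fun hψ (x hs))

/-- The map of star sheaves given by a vector. -/
def starVec (s : Δ) {K : Type w} [AddCommGroup K] [Module ℝ K] (κ : K) :
    (starSheaf s ℝ).Hom (starSheaf s K) :=
  starMap s (LinearMap.toSpanSingleton ℝ K κ)

theorem exists_starVec_leftInverse (s : Δ) {K : Type w} [AddCommGroup K] [Module ℝ K] {κ : K}
    (hκ : κ ≠ 0) : ∃ p : (starSheaf s K).Hom (starSheaf s ℝ),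
      ∀ σ x, p.app σ ((starVec s κ).app σ x) = x := by
  obtain ⟨ψ, hψ⟩ := (LinearMap.toSpanSingleton ℝ K κ).exists_leftInverse_of_injective
    (LinearMap.ker_toSpanSingleton ℝ hκ)
  exact ⟨starMap s ψ, fun σ x => funext fun hs => LinearMap.congr_fun hψ (x hs)⟩

end Star

/-! ### Transversal fans -/

section Transversal

open Module

variable {V : Type u} [AddCommGroup V] [Module ℝ V] [FiniteDimensional ℝ V]
variable {Δ : Finset (PointedCone ℝ V)}

theorem IsPure.exists_top (hp : IsPure Δ) {σ : PointedCone ℝ V} (hσ : σ ∈ Δ) :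
    ∃ γ ∈ Δ, σ ≤ γ ∧ cdim γ = finrank ℝ V := by
  obtain ⟨γ, hle, hγ⟩ := Δ.exists_le_maximal hσ
  exact ⟨γ, hγ.1, hle, (hp γ hγ.1).1 hγ⟩

theorem notMem_boundary {σ : PointedCone ℝ V} (h : cdim σ = finrank ℝ V) : σ ∉ boundary Δ := by
  rintro ⟨-, ρ, -, hρ, -, hle⟩
  have := cdim_mono hle
  omega

theorem boundary_mono {σ τ : PointedCone ℝ V} (hτ : τ ∈ Δ) (hle : τ ≤ σ) (hσ : σ ∈ boundary Δ) :
    τ ∈ boundary Δ := by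
  obtain ⟨-, ρ, h1, h2, h3, h4⟩ := hσ
  exact ⟨hτ, ρ, h1, h2, h3, hle.trans h4⟩

theorem lspan_map (s γ : PointedCone ℝ V) :
    lspan (PointedCone.map (lspan s).mkQ γ) = (lspan γ).map (lspan s).mkQ := by
  change _ = (Submodule.span ℝ (γ : Set V)).map _
  rw [Submodule.map_span]
  rfl

theorem mem_coneMap {s γ : PointedCone ℝ V} {x : V ⧸ lspan s} :
    x ∈ PointedCone.map (lspan s).mkQ γ ↔ ∃ v ∈ γ, (lspan s).mkQ v = x :=
  PointedCone.mem_map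

/-- Rank and nullity of the projection `V_γ → V / V_s`, whose kernel is `V_s`. -/
theorem cdim_map {s γ : PointedCone ℝ V} (h : s ≤ γ) :
    cdim (PointedCone.map (lspan s).mkQ γ) + cdim s = cdim γ := by
  have h1 := LinearMap.finrank_range_add_finrank_ker ((lspan s).mkQ.domRestrict (lspan γ))
  have h2 : LinearMap.range ((lspan s).mkQ.domRestrict (lspan γ)) =
      lspan (PointedCone.map (lspan s).mkQ γ) := by
    rw [lspan_map, LinearMap.range_domRestrict]
  have h3 : (LinearMap.ker ((lspan s).mkQ.domRestrict (lspan γ))).map (lspan γ).subtype =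
      lspan s := by
    ext v
    simp only [Submodule.mem_map, LinearMap.mem_ker, LinearMap.domRestrict_apply,
      Submodule.mkQ_apply, Submodule.Quotient.mk_eq_zero, Submodule.subtype_apply, Subtype.exists,
      exists_and_right, exists_eq_right]
    exact ⟨fun hv => hv.2, fun hv => ⟨lspan_mono h hv, hv⟩⟩
  rw [h2, ← Submodule.finrank_map_subtype_eq, h3] at h1
  exact h1

theorem finrank_quotient_lspan (s : PointedCone ℝ V) :
    finrank ℝ (V ⧸ lspan s) + cdim s = finrank ℝ V :=
  Submodule.finrank_quotient_add_finrank (lspan s)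

/-- Forms active at a relative interior point `p` vanish on `V_s`, so `p + ε • v` stays in `s`;
rescale and subtract. -/
theorem IsFan.exists_sub_of_mem_lspan (h : IsFan Δ) {s : PointedCone ℝ V} (hs : s ∈ Δ) {v : V}
    (hv : v ∈ lspan s) : ∃ a ∈ s, ∃ b ∈ s, v = a - b := by
  obtain ⟨S, hS, -⟩ := h.exists_definedBy hs
  obtain ⟨p, hp⟩ := exists_isRelInt s
  obtain ⟨ε, hε, hm⟩ := hS.exists_add_smul_mem (v := v) hp.1 fun α hα h0 =>
    (hp.2 α (hS.nonneg hα) h0 v hv).ge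
  refine ⟨ε⁻¹ • (p + ε • v), cone_smul_mem (by positivity) hm, ε⁻¹ • p,
    cone_smul_mem (by positivity) hp.1, ?_⟩
  rw [smul_add, smul_smul, inv_mul_cancel₀ hε.ne', one_smul, add_sub_cancel_left]

theorem IsFan.map_le_map_iff (h : IsFan Δ) {s γ γ' : PointedCone ℝ V} (hs : s ∈ Δ) (hγ : γ ∈ Δ)
    (hγ' : γ' ∈ Δ) (hsγ : s ≤ γ) (hsγ' : s ≤ γ') :
    PointedCone.map (lspan s).mkQ γ ≤ PointedCone.map (lspan s).mkQ γ' ↔ γ ≤ γ' := by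
  constructor
  · intro hle v hv
    obtain ⟨v', hv', he⟩ := mem_coneMap.1 (hle (mem_coneMap.2 ⟨v, hv, rfl⟩))
    have hd : v - v' ∈ lspan s := (Submodule.Quotient.eq _).1 he.symm
    obtain ⟨a, ha, b, hb, e⟩ := h.exists_sub_of_mem_lspan hs hd
    -- Adding an element `b` of `s` moves `v` into the common face of `γ` and `γ'`. A sum of
    -- elements of `γ` lies in a face only if the summands do, so `v` itself is in `γ'`.
    obtain ⟨β, b1, b2⟩ := h.inter_left γ hγ γ' hγ'
    have hm : v + b ∈ γ ⊓ γ' := by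
      refine ⟨add_mem hv (hsγ hb), ?_⟩
      have : v + b = v' + a := by
        rw [← sub_eq_zero] at e ⊢
        rw [← e]
        abel
      rw [this]
      exact add_mem hv' (hsγ' ha)
    have h0 := ((b2 _).1 hm).2
    rw [map_add] at h0
    have h1 := b1 v hv
    have h2 := b1 b (hsγ hb)
    exact ((b2 v).2 ⟨hv, by linarith⟩).2
  · rintro hle _ hx
    obtain ⟨v, hv, rfl⟩ := mem_coneMap.1 hx
    exact mem_coneMap.2 ⟨v, hle hv, rfl⟩

theorem mem_transversal {s : PointedCone ℝ V} {x : PointedCone ℝ (V ⧸ lspan s)} :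
    x ∈ transversal Δ s ↔ ∃ γ ∈ Δ, s ≤ γ ∧ PointedCone.map (lspan s).mkQ γ = x := by
  classical
  simp [transversal, and_assoc]

/-- Passing to the quotient preserves inclusions among cones over `s` and lowers all dimensions by
`cdim s`. The cones relevant to a wall over `s` all contain `s`, so nothing is lost. -/
theorem IsFan.map_mem_boundary_iff (h : IsFan Δ) {s γ : PointedCone ℝ V} (hs : s ∈ Δ) (hγ : γ ∈ Δ)
    (hsγ : s ≤ γ) :
    PointedCone.map (lspan s).mkQ γ ∈ boundary (transversal Δ s) ↔ γ ∈ boundary Δ := by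
  have hq := finrank_quotient_lspan s
  have key : ∀ ρ ∈ Δ, s ≤ ρ → ((∃! σ, σ ∈ transversal Δ s ∧ cdim σ = finrank ℝ (V ⧸ lspan s) ∧
      PointedCone.map (lspan s).mkQ ρ ≤ σ) ↔ ∃! σ, σ ∈ Δ ∧ cdim σ = finrank ℝ V ∧ ρ ≤ σ) := by
    intro ρ hρ hsρ
    constructor
    · rintro ⟨σ', ⟨h1, h2, h3⟩, huniq⟩
      obtain ⟨σ, hσ, hsσ, rfl⟩ := mem_transversal.1 h1
      have hc := cdim_map hsσ
      refine ⟨σ, ⟨hσ, by omega, (h.map_le_map_iff hs hρ hσ hsρ hsσ).1 h3⟩, ?_⟩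
      rintro σ₂ ⟨k1, k2, k3⟩
      have hsσ₂ := hsρ.trans k3
      have hc₂ := cdim_map hsσ₂
      have := huniq (PointedCone.map (lspan s).mkQ σ₂)
        ⟨mem_transversal.2 ⟨σ₂, k1, hsσ₂, rfl⟩, by omega,
          (h.map_le_map_iff hs hρ k1 hsρ hsσ₂).2 k3⟩
      exact le_antisymm ((h.map_le_map_iff hs k1 hσ hsσ₂ hsσ).1 this.le)
        ((h.map_le_map_iff hs hσ k1 hsσ hsσ₂).1 this.ge)
    · rintro ⟨σ, ⟨h1, h2, h3⟩, huniq⟩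
      have hsσ := hsρ.trans h3
      have hc := cdim_map hsσ
      refine ⟨PointedCone.map (lspan s).mkQ σ, ⟨mem_transversal.2 ⟨σ, h1, hsσ, rfl⟩, by omega,
        (h.map_le_map_iff hs hρ h1 hsρ hsσ).2 h3⟩, ?_⟩
      rintro _ ⟨k1, k2, k3⟩
      obtain ⟨σ₂, hσ₂, hsσ₂, rfl⟩ := mem_transversal.1 k1
      have hc₂ := cdim_map hsσ₂
      rw [huniq σ₂ ⟨hσ₂, by omega, (h.map_le_map_iff hs hρ hσ₂ hsρ hsσ₂).1 k3⟩]
  constructor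
  · rintro ⟨-, ρ', h1, h2, h3, h4⟩
    obtain ⟨ρ, hρ, hsρ, rfl⟩ := mem_transversal.1 h1
    have hc := cdim_map hsρ
    exact ⟨hγ, ρ, hρ, by omega, (key ρ hρ hsρ).1 h3, (h.map_le_map_iff hs hγ hρ hsγ hsρ).1 h4⟩
  · rintro ⟨-, ρ, h1, h2, h3, h4⟩
    have hsρ := hsγ.trans h4
    have hc := cdim_map hsρ
    exact ⟨mem_transversal.2 ⟨γ, hγ, hsγ, rfl⟩, _, mem_transversal.2 ⟨ρ, h1, hsρ, rfl⟩, by omega,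
      (key ρ h1 hsρ).2 h3, (h.map_le_map_iff hs hγ h1 hsγ hsρ).2 h4⟩

theorem IsFan.isFace_map (h : IsFan Δ) {s τ γ : PointedCone ℝ V} (hτ : τ ∈ Δ) (hγ : γ ∈ Δ)
    (hsτ : s ≤ τ) (hle : τ ≤ γ) :
    IsFace (PointedCone.map (lspan s).mkQ τ) (PointedCone.map (lspan s).mkQ γ) := by
  obtain ⟨β, b1, b2, b3⟩ := h.exists_dual hτ hγ hle
  refine ⟨(lspan s).liftQ β fun v hv => b3 v (lspan_mono hsτ hv), ?_, ?_⟩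
  · rintro _ hx
    obtain ⟨v, hv, rfl⟩ := mem_coneMap.1 hx
    exact b1 v hv
  · intro x
    constructor
    · intro hx
      obtain ⟨v, hv, rfl⟩ := mem_coneMap.1 hx
      exact ⟨mem_coneMap.2 ⟨v, hle hv, rfl⟩, ((b2 v).1 hv).2⟩
    · rintro ⟨hx, h0⟩
      obtain ⟨v, hv, rfl⟩ := mem_coneMap.1 hx
      exact mem_coneMap.2 ⟨v, (b2 v).2 ⟨hv, h0⟩, rfl⟩

/-- The image in the transversal fan of a cone that contains `s`. -/
def barCone (s γ : Δ) (h : s.1 ≤ γ.1) : transversal Δ s.1 :=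
  ⟨PointedCone.map (lspan s.1).mkQ γ.1, mem_transversal.2 ⟨γ.1, γ.2, h, rfl⟩⟩

theorem exists_lift {U : Submodule ℝ V} : ∃ L : (V ⧸ U) →ₗ[ℝ] V, U.mkQ ∘ₗ L = LinearMap.id :=
  U.mkQ.exists_rightInverse_of_surjective U.range_mkQ

theorem isFrame_append {s γ : PointedCone ℝ V} (hsγ : s ≤ γ) {L : (V ⧸ lspan s) →ₗ[ℝ] V}
    (hL : (lspan s).mkQ ∘ₗ L = LinearMap.id) {d e : ℕ} {b : Fin d → V} (hb : IsFrame (lspan s) b)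
    {x : Fin e → V ⧸ lspan s} (hx : IsFrame (lspan (PointedCone.map (lspan s).mkQ γ)) x) :
    IsFrame (lspan γ) (Fin.append b (L ∘ x)) := by
  have hLx : ∀ z, (lspan s).mkQ (L z) = z := LinearMap.congr_fun hL
  refine ⟨fun i => ?_, ?_, ?_⟩
  · refine Fin.addCases (fun i => ?_) (fun i => ?_) i
    · rw [Fin.append_left]
      exact lspan_mono hsγ (hb.mem i)
    · rw [Fin.append_right]
      have := hx.mem i
      rw [lspan_map] at this
      obtain ⟨v, hv, he⟩ := this
      have h1 : L (x i) - v ∈ lspan s := by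
        rw [← Submodule.Quotient.eq]
        exact (hLx _).trans he.symm
      have := Submodule.add_mem _ (lspan_mono hsγ h1) hv
      rwa [sub_add_cancel] at this
  · have h1 := LinearIndependent.sumElim_of_quotient (M' := lspan s)
      (f := fun i => (⟨b i, hb.mem i⟩ : lspan s)) (LinearIndependent.of_comp (lspan s).subtype hb.li)
      (L ∘ x) (by
        have : Submodule.Quotient.mk (p := lspan s) ∘ (L ∘ x) = x := funext fun i => hLx _
        rw [this]
        exact hx.li)
    rw [← linearIndependent_equiv finSumFinEquiv]
    have h2 : Fin.append b (L ∘ x) ∘ finSumFinEquiv = Sum.elim b (L ∘ x) := by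
      ext (i | j) <;> simp
    rw [h2]
    exact h1
  · have h1 := cdim_map hsγ
    have h2 : cdim s = d := hb.finrank_eq
    have h3 : cdim (PointedCone.map (lspan s).mkQ γ) = e := hx.finrank_eq
    change cdim γ = _
    omega

/-- The orientation coefficients of a transversal fan agree with those of the fan up to signs
attached to the cones. -/
theorem IsFan.exists_transversal_sign (h : IsFan Δ) (o : Orient Δ) (s : Δ)
    (o' : Orient (transversal Δ s.1)) : ∃ ε : Δ → ℤ, (∀ γ, ε γ = 1 ∨ ε γ = -1) ∧
      (∀ γ γ' : Δ, s.1 ≤ γ.1 → s.1 ≤ γ'.1 → cdim γ.1 = finrank ℝ V → cdim γ'.1 = finrank ℝ V →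
        ε γ = ε γ') ∧
      ∀ (γ τ : Δ) (hτ : s.1 ≤ τ.1) (hle : τ.1 ≤ γ.1), cdim γ.1 = cdim τ.1 + 1 →
        o'.coeff (barCone s γ (hτ.trans hle)) (barCone s τ hτ) = ε γ * ε τ * o.coeff γ τ := by
  obtain ⟨b, hb⟩ := exists_isFrame (lspan s.1) (m := cdim s.1) rfl
  obtain ⟨L, hL⟩ := exists_lift (U := lspan s.1)
  have hLx : ∀ z, (lspan s.1).mkQ (L z) = z := LinearMap.congr_fun hL
  -- The sign of `γ` compares the orientation of `V_γ` with a fixed frame of `V_s` followed by a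
  -- lift of the orientation of `V_γ / V_s`.
  have hex : ∀ γ : Δ, ∃ ε : ℤ, (ε = 1 ∨ ε = -1) ∧ ∀ (hsγ : s.1 ≤ γ.1) (e : ℕ)
      (h1 : cdim γ.1 = cdim s.1 + e) (h2 : cdim (barCone s γ hsγ).1 = e)
      (x : Fin e → V ⧸ lspan s.1), IsFrame (lspan (barCone s γ hsγ).1) x →
        0 < ε * (o.vol γ h1 (Fin.append b (L ∘ x)) * o'.vol (barCone s γ hsγ) h2 x) := by
    intro γ
    by_cases hsγ : s.1 ≤ γ.1
    · have h1 : cdim γ.1 = cdim s.1 + cdim (barCone s γ hsγ).1 := by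
        rw [← cdim_map hsγ, add_comm]
        rfl
      obtain ⟨ε, hε, hpos⟩ := exists_sign
        (Ω := (appendForm (o.vol γ h1) b).compLinearMap L) (η := o'.vol (barCone s γ hsγ) rfl)
        (U := lspan (barCone s γ hsγ).1)
        (fun x hx => o.vol_ne_zero γ h1 (isFrame_append hsγ hL hb hx))
        (fun x hx => o'.vol_ne_zero _ rfl hx)
      refine ⟨ε, hε, fun hs e k1 k2 x hx => ?_⟩
      subst k2
      exact hpos x hx
    · exact ⟨1, Or.inl rfl, fun hs => absurd hs hsγ⟩
  choose ε hε hpos using hex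
  refine ⟨ε, hε, ?_, ?_⟩
  · intro γ γ' hs hs' hd hd'
    have hq := finrank_quotient_lspan s.1
    set e := finrank ℝ (V ⧸ lspan s.1) with he
    have k1 := cdim_map hs
    have k2 := cdim_map hs'
    have e1 : cdim (barCone s γ hs).1 = e := by
      change cdim (PointedCone.map _ _) = e
      omega
    have e2 : cdim (barCone s γ' hs').1 = e := by
      change cdim (PointedCone.map _ _) = e
      omega
    have d1 : cdim γ.1 = cdim s.1 + e := by omega
    have d2 : cdim γ'.1 = cdim s.1 + e := by omega
    obtain ⟨x, hx⟩ := exists_isFrame (lspan (barCone s γ hs).1) e1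
    have hx' : IsFrame (lspan (barCone s γ' hs').1) x := by
      have htop : lspan (barCone s γ' hs').1 = ⊤ := Submodule.eq_top_of_finrank_eq e2
      exact ⟨fun i => by rw [htop]; trivial, hx.li, e2⟩
    have p1 := hpos γ hs e d1 e1 x hx
    have p2 := hpos γ' hs' e d2 e2 x hx'
    have q1 := o.vol_mul_nonneg (by omega : finrank ℝ V = cdim s.1 + e) d1 d2
      (Fin.append b (L ∘ x))
    have q2 := o'.vol_mul_nonneg he.symm e1 e2 x
    rcases hε γ with r1 | r1 <;> rcases hε γ' with r2 | r2
    · rw [r1, r2]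
    · exfalso
      rw [r1] at p1
      rw [r2] at p2
      push_cast at p1 p2
      nlinarith [mul_pos p1 p2, mul_nonneg q1 q2]
    · exfalso
      rw [r1] at p1
      rw [r2] at p2
      push_cast at p1 p2
      nlinarith [mul_pos p1 p2, mul_nonneg q1 q2]
    · rw [r1, r2]
  · intro γ τ hτ hle hd
    have hγ := hτ.trans hle
    have hne : τ.1 ≠ γ.1 := by
      intro heq
      rw [heq] at hd
      omega
    have k1 := cdim_map hτ
    have k2 := cdim_map hγ
    obtain ⟨v, hv, hvτ⟩ := h.exists_mem_notMem_lspan τ.2 γ.2 hle hne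
    obtain ⟨e, he⟩ : ∃ e, cdim (barCone s τ hτ).1 = e := ⟨_, rfl⟩
    obtain ⟨x, hx⟩ := exists_isFrame (lspan (barCone s τ hτ).1) he
    have he' : cdim (PointedCone.map (lspan s.1).mkQ τ.1) = e := he
    have e2 : cdim (barCone s γ hγ).1 = e + 1 := by
      change cdim (PointedCone.map _ _) = _
      omega
    have d1 : cdim τ.1 = cdim s.1 + e := by omega
    have d2 : cdim γ.1 = cdim s.1 + e + 1 := by omega
    have hvb : (lspan s.1).mkQ v ∈ (barCone s γ hγ).1 := mem_coneMap.2 ⟨v, hv, rfl⟩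
    have hvn : (lspan s.1).mkQ v ∉ lspan (barCone s τ hτ).1 := by
      intro hm
      change _ ∈ lspan (PointedCone.map _ _) at hm
      rw [lspan_map] at hm
      obtain ⟨t, ht, hte⟩ := hm
      have h1 : v - t ∈ lspan s.1 := (Submodule.Quotient.eq _).1 hte.symm
      have := Submodule.add_mem _ (lspan_mono hτ h1) ht
      rw [sub_add_cancel] at this
      exact hvτ this
    have hf' : IsFace (barCone s τ hτ).1 (barCone s γ hγ).1 := h.isFace_map τ.2 γ.2 hτ hle
    have hfr := isFrame_append hτ hL hb hx
    have hsn := hx.snoc (lspan_mono (fun _ hw => by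
      obtain ⟨t, ht, rfl⟩ := mem_coneMap.1 hw
      exact mem_coneMap.2 ⟨t, hle ht, rfl⟩)) (mem_lspan hvb) hvn e2
    have p1 := o.coeff_spec (h.isFace hle) d1 d2 hfr hv hvτ
    have p2 := o'.coeff_spec hf' he e2 hx hvb hvn
    have p3 := hpos τ hτ e d1 he x hx
    have p4 := hpos γ hγ (e + 1) d2 e2 _ hsn
    -- The lift of the class of `v` differs from `v` by an element of `V_s`, so one frame of `V_γ`
    -- can be read in both ways.
    have hvol : o.vol γ (m := cdim s.1 + (e + 1)) d2
        (Fin.append b (L ∘ (Fin.snoc x ((lspan s.1).mkQ v) : Fin (e + 1) → _))) =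
        o.vol γ (m := cdim s.1 + e + 1) d2 (Fin.snoc (Fin.append b (L ∘ x)) v) := by
      have : L ∘ (Fin.snoc x ((lspan s.1).mkQ v) : Fin (e + 1) → _) =
          Fin.snoc (L ∘ x) (L ((lspan s.1).mkQ v)) := by
        rw [Fin.comp_snoc]
      rw [this, Fin.append_snoc]
      refine form_snoc_congr _ hfr ?_
      refine lspan_mono hτ ?_
      rw [← Submodule.Quotient.eq]
      exact hLx _
    rw [hvol] at p4
    generalize o.vol τ d1 (Fin.append b (L ∘ x)) = A at *
    generalize o'.vol (barCone s τ hτ) he x = A' at *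
    generalize o.vol γ d2 (Fin.snoc (Fin.append b (L ∘ x)) v) = B at *
    generalize o'.vol (barCone s γ hγ) e2 (Fin.snoc x ((lspan s.1).mkQ v)) = B' at *
    -- Each of the four volumes occurs twice, so only the product of the four signs remains, and it
    -- is positive.
    have q := mul_pos (mul_pos p1 p2) (mul_pos p3 p4)
    have q' : 0 < (o.coeff γ τ * o'.coeff (barCone s γ hγ) (barCone s τ hτ) * ε τ * ε γ : ℝ) *
        (A * A' * B * B') ^ 2 := lt_of_lt_of_eq q (by ring)
    have r := pos_of_mul_pos_left q' (sq_nonneg _)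
    have r' : 0 < o.coeff γ τ * o'.coeff (barCone s γ hγ) (barCone s τ hτ) * ε τ * ε γ := by
      exact_mod_cast r
    rcases o.coeff_eq γ τ with e₁ | e₁ <;>
      rcases o'.coeff_eq (barCone s γ hγ) (barCone s τ hτ) with e₂ | e₂ <;>
      rcases hε τ with e₃ | e₃ <;> rcases hε γ with e₄ | e₄ <;>
      first
      | (exfalso; rw [e₁, e₂, e₃, e₄] at r'; norm_num at r'; done)
      | (rw [e₁, e₂, e₃, e₄]; rfl)


end Transversal

/-! ### Identification of the transversal complex with the complex of a star sheaf. -/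

section TransversalComplex

open Module

variable {V : Type u} [AddCommGroup V] [Module ℝ V] [FiniteDimensional ℝ V]
variable {Δ : Finset (PointedCone ℝ V)}

/-- The cone of `Δ` with a given image in the transversal fan. -/
def liftCone {s : Δ} (x : transversal Δ s.1) : Δ :=
  ⟨(mem_transversal.1 x.2).choose, (mem_transversal.1 x.2).choose_spec.1⟩

theorem le_liftCone {s : Δ} (x : transversal Δ s.1) : s.1 ≤ (liftCone x).1 :=
  (mem_transversal.1 x.2).choose_spec.2.1

theorem bar_liftCone {s : Δ} (x : transversal Δ s.1) :
    barCone s (liftCone x) (le_liftCone x) = x :=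
  Subtype.ext (mem_transversal.1 x.2).choose_spec.2.2

theorem IsFan.bar_le_bar_iff (h : IsFan Δ) {s γ γ' : Δ} (hγ : s.1 ≤ γ.1) (hγ' : s.1 ≤ γ'.1) :
    (barCone s γ hγ).1 ≤ (barCone s γ' hγ').1 ↔ γ.1 ≤ γ'.1 :=
  h.map_le_map_iff s.2 γ.2 γ'.2 hγ hγ'

theorem IsFan.lift_barCone (h : IsFan Δ) {s γ : Δ} (hγ : s.1 ≤ γ.1) :
    liftCone (barCone s γ hγ) = γ := by
  have e := bar_liftCone (barCone s γ hγ)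
  have h1 := (h.bar_le_bar_iff (le_liftCone _) hγ).1 (congrArg Subtype.val e).le
  have h2 := (h.bar_le_bar_iff hγ (le_liftCone _)).1 (congrArg Subtype.val e).ge
  exact Subtype.ext (le_antisymm h1 h2)

theorem IsFan.liftCone_le_iff (h : IsFan Δ) {s : Δ} (x y : transversal Δ s.1) :
    (liftCone x).1 ≤ (liftCone y).1 ↔ x.1 ≤ y.1 := by
  rw [← h.bar_le_bar_iff (le_liftCone x) (le_liftCone y), bar_liftCone, bar_liftCone]

/-- The cell of the transversal fan that corresponds to a cell of `Δ`. -/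
def IsFan.barCell (h : IsFan Δ) {s : Δ} {k : ℕ} (σ : Cell Δ (boundary Δ) k) (hs : s.1 ≤ σ.1.1) :
    Cell (transversal Δ s.1) (boundary (transversal Δ s.1)) k :=
  ⟨barCone s σ.1 hs, fun hb => σ.2.1 ((h.map_mem_boundary_iff s.2 σ.1.2 hs).1 hb), by
    have h1 := cdim_map hs
    have h2 := finrank_quotient_lspan s.1
    have h3 := σ.2.2
    change cdim (PointedCone.map _ _) + k = _
    omega⟩

/-- The cell of `Δ` that corresponds to a cell of the transversal fan. -/
def IsFan.liftCell (h : IsFan Δ) {s : Δ} {k : ℕ}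
    (x : Cell (transversal Δ s.1) (boundary (transversal Δ s.1)) k) : Cell Δ (boundary Δ) k :=
  ⟨liftCone x.1, fun hb => x.2.1 (by
    rw [← bar_liftCone x.1]
    exact (h.map_mem_boundary_iff s.2 (liftCone x.1).2 (le_liftCone x.1)).2 hb), by
    have h1 := cdim_map (le_liftCone x.1)
    have h2 := finrank_quotient_lspan s.1
    have h3 := x.2.2
    rw [← bar_liftCone x.1] at h3
    change cdim (PointedCone.map _ _) + k = _ at h3
    omega⟩

theorem IsFan.bar_liftCell (h : IsFan Δ) {s : Δ} {k : ℕ}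
    (x : Cell (transversal Δ s.1) (boundary (transversal Δ s.1)) k) :
    h.barCell (h.liftCell x) (le_liftCone x.1) = x := Subtype.ext (bar_liftCone x.1)

theorem IsFan.lift_barCell (h : IsFan Δ) {s : Δ} {k : ℕ} (σ : Cell Δ (boundary Δ) k)
    (hs : s.1 ≤ σ.1.1) : h.liftCell (h.barCell σ hs) = σ := Subtype.ext (h.lift_barCone hs)

theorem sign_mul_sign_mul {c : ℤ} (hc : c = 1 ∨ c = -1) (x : ℝ) : (c : ℝ) * ((c : ℝ) * x) = x := by
  rcases hc with e | e <;> rw [e] <;> simp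

theorem sign_mul_zsmul {c : ℤ} (hc : c = 1 ∨ c = -1) (a b : ℤ) (x : ℝ) :
    (c : ℝ) * ((a * c * b) • x) = b • ((a : ℝ) * x) := by
  simp only [zsmul_eq_mul]
  rcases hc with e | e <;> rw [e] <;> push_cast <;> ring

/-- Cochains of the transversal fan correspond to cochains of the star sheaf. -/
def IsFan.cochainEquiv (h : IsFan Δ) (s : Δ) {ε : Δ → ℤ} (hε : ∀ γ, ε γ = 1 ∨ ε γ = -1) (k : ℕ) :
    (constSheaf ℝ (transversal Δ s.1)).Cochain (boundary (transversal Δ s.1)) k ≃+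
      (starSheaf s ℝ).Cochain (boundary Δ) k where
  toFun g σ hs := (ε σ.1 : ℝ) * (show ℝ from g (h.barCell σ hs.down))
  invFun f x := (ε (liftCone x.1) : ℝ) * f (h.liftCell x) ⟨le_liftCone x.1⟩
  left_inv g := by
    funext x
    change (ε (liftCone x.1) : ℝ) * ((ε (liftCone x.1) : ℝ) *
      (show ℝ from g (h.barCell (h.liftCell x) (le_liftCone x.1)))) = g x
    rw [h.bar_liftCell]
    exact sign_mul_sign_mul (hε _) _
  right_inv f := by
    funext σ hs
    obtain ⟨hs⟩ := hs
    have key : ∀ σ' : Cell Δ (boundary Δ) k, σ' = σ → ∀ hs' : s.1 ≤ σ'.1.1,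
        f σ' ⟨hs'⟩ = f σ ⟨hs⟩ := by
      rintro _ rfl _
      rfl
    have h1 : liftCone (h.barCell σ hs).1 = σ.1 := h.lift_barCone hs
    have h2 : f (h.liftCell (h.barCell σ hs)) ⟨le_liftCone (h.barCell σ hs).1⟩ = f σ ⟨hs⟩ :=
      key _ (h.lift_barCell σ hs) _
    refine Eq.trans (congrArg₂ (fun a b : ℝ => (ε σ.1 : ℝ) * (a * b))
      (congrArg (fun γ => (ε γ : ℝ)) h1) h2) ?_
    exact sign_mul_sign_mul (hε _) _
  map_add' g g' := by
    funext σ hs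
    exact mul_add _ _ _

/-- Global sections of the constant sheaf on the transversal fan correspond to global sections of
the star sheaf. -/
def IsFan.globalEquiv (h : IsFan Δ) (s : Δ) {c : ℤ} (hc : c = 1 ∨ c = -1) :
    (constSheaf ℝ (transversal Δ s.1)).global ≃+ (starSheaf s ℝ).global where
  toFun g := ⟨fun σ hs => (c : ℝ) * (show ℝ from g.1 ⟨barCone s σ.1 hs.down, trivial⟩),
    fun σ τ hle => by
      funext hs
      have := g.2 ⟨barCone s σ.1 (hs.down.trans hle), trivial⟩ ⟨barCone s τ.1 hs.down, trivial⟩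
        ((h.bar_le_bar_iff hs.down (hs.down.trans hle)).2 hle)
      exact congrArg (fun r : ℝ => (c : ℝ) * r) this⟩
  invFun f := ⟨fun x => (c : ℝ) * f.1 ⟨liftCone x.1, trivial⟩ ⟨le_liftCone x.1⟩, fun x y hle => by
      have := congrFun (f.2 ⟨liftCone x.1, trivial⟩ ⟨liftCone y.1, trivial⟩
        ((h.liftCone_le_iff y.1 x.1).2 hle)) ⟨le_liftCone y.1⟩
      exact congrArg (fun r : ℝ => (c : ℝ) * r) this⟩
  left_inv g := by
    refine Subtype.ext (funext fun x => ?_)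
    obtain ⟨x, -⟩ := x
    change (c : ℝ) * ((c : ℝ) *
      (show ℝ from g.1 ⟨barCone s (liftCone x) (le_liftCone x), trivial⟩)) = g.1 ⟨x, trivial⟩
    rw [bar_liftCone]
    exact sign_mul_sign_mul hc _
  right_inv f := by
    refine Subtype.ext (funext fun σ => funext fun hs => ?_)
    obtain ⟨σ, -⟩ := σ
    obtain ⟨hs⟩ := hs
    have key : ∀ σ' : Δ, σ' = σ → ∀ hs' : s.1 ≤ σ'.1,
        f.1 ⟨σ', trivial⟩ ⟨hs'⟩ = f.1 ⟨σ, trivial⟩ ⟨hs⟩ := by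
      rintro _ rfl _
      rfl
    refine Eq.trans (congrArg (fun a : ℝ => (c : ℝ) * ((c : ℝ) * a))
      (key _ (h.lift_barCone hs) (le_liftCone _))) ?_
    exact sign_mul_sign_mul hc _
  map_add' g g' := by
    refine Subtype.ext (funext fun σ => funext fun hs => ?_)
    exact mul_add _ _ _

/-- Rescaling by `ε` absorbs the discrepancy `ε γ * ε τ` of the coefficients, since signs square to
one. -/
theorem IsFan.coboundary_cochainEquiv (h : IsFan Δ) (o : Orient Δ) (s : Δ)
    (o' : Orient (transversal Δ s.1)) {ε : Δ → ℤ} (hε : ∀ γ, ε γ = 1 ∨ ε γ = -1)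
    (hsign : ∀ (γ τ : Δ) (hτ : s.1 ≤ τ.1) (hle : τ.1 ≤ γ.1), cdim γ.1 = cdim τ.1 + 1 →
        o'.coeff (barCone s γ (hτ.trans hle)) (barCone s τ hτ) = ε γ * ε τ * o.coeff γ τ) (k : ℕ)
    (g : (constSheaf ℝ (transversal Δ s.1)).Cochain (boundary (transversal Δ s.1)) k) :
    (starSheaf s ℝ).coboundary o (boundary Δ) k (h.cochainEquiv s hε k g) =
      h.cochainEquiv s hε (k + 1) ((constSheaf ℝ (transversal Δ s.1)).coboundary o'
        (boundary (transversal Δ s.1)) k g) := by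
  classical
  funext τ hs
  obtain ⟨hs⟩ := hs
  have e1 := FanSheaf.coboundary_apply (constSheaf ℝ (transversal Δ s.1)) o'
    (boundary (transversal Δ s.1)) k g (h.barCell τ hs)
  have e2 := congrFun (FanSheaf.coboundary_apply (starSheaf s ℝ) o (boundary Δ) k
    (h.cochainEquiv s hε k g) τ) ⟨hs⟩
  refine e2.trans (Eq.trans (Finset.sum_apply (M := fun _ : PLift (s.1 ≤ τ.1.1) => ℝ) _ _ _) ?_)
  change _ = (ε τ.1 : ℝ) * (show ℝ from (constSheaf ℝ (transversal Δ s.1)).coboundary o'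
    (boundary (transversal Δ s.1)) k g (h.barCell τ hs))
  rw [e1]
  change _ = (ε τ.1 : ℝ) * (∑ x : Cell (transversal Δ s.1) (boundary (transversal Δ s.1)) k,
    if (barCone s τ.1 hs).1 ≤ x.1.1 then o'.coeff x.1 (barCone s τ.1 hs) • (show ℝ from g x) else 0)
  rw [Finset.mul_sum]
  symm
  -- Cells over `τ` contain `s` and are therefore lifts; all other terms vanish.
  refine Finset.sum_of_injOn h.liftCell ?_ (fun _ _ => Finset.mem_coe.2 (Finset.mem_univ _)) ?_ ?_
  · intro x _ y _ hxy
    rw [← bar_liftCell h x, ← bar_liftCell h y]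
    congr 1
  · intro σ _ hσ
    rw [dif_neg]
    · rfl
    · intro hle
      exact hσ ⟨h.barCell σ (hs.trans hle), Finset.mem_coe.2 (Finset.mem_univ _), h.lift_barCell _ _⟩
  · intro x _
    have hiff : (barCone s τ.1 hs).1 ≤ x.1.1 ↔ τ.1.1 ≤ (h.liftCell x).1.1 := by
      refine Iff.trans ?_ (h.bar_le_bar_iff hs (le_liftCone x.1))
      rw [bar_liftCone]
    by_cases hle : τ.1.1 ≤ (h.liftCell x).1.1
    · rw [if_pos (hiff.2 hle), dif_pos hle]
      have hd : cdim (h.liftCell x).1.1 = cdim τ.1.1 + 1 := by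
        have h1 := (h.liftCell x).2.2
        have h2 := τ.2.2
        omega
      have hx := h.bar_liftCell x
      have hc := hsign (h.liftCell x).1 τ.1 hs hle hd
      have hc' : o'.coeff x.1 (barCone s τ.1 hs) =
          ε (h.liftCell x).1 * ε τ.1 * o.coeff (h.liftCell x).1 τ.1 := by
        rw [← hc]
        congr 1
        exact (bar_liftCone x.1).symm
      rw [hc']
      change _ = o.coeff (h.liftCell x).1 τ.1 • ((ε (h.liftCell x).1 : ℝ) *
        (show ℝ from g (h.barCell (h.liftCell x) (le_liftCone x.1))))
      rw [hx]
      exact sign_mul_zsmul (hε _) _ _ _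
    · rw [if_neg (fun h' => hle (hiff.1 h')), dif_neg hle, mul_zero]
      rfl

/-- A global section must be rescaled by a single sign. This is possible because `ε` is constant on
the full-dimensional cones over `s`, which exist by purity. -/
theorem IsFan.transversal_isAugAcyclic_iff (h : IsFan Δ) (hp : IsPure Δ) (o : Orient Δ) (s : Δ)
    (o' : Orient (transversal Δ s.1)) :
    (constSheaf ℝ (transversal Δ s.1)).IsAugAcyclic o' ↔ (starSheaf s ℝ).IsAugAcyclic o := by
  obtain ⟨ε, hε, htop, hsign⟩ := h.exists_transversal_sign o s o'
  obtain ⟨γ₀, hγ₀, hsγ₀, hd₀⟩ := hp.exists_top s.2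
  have hcob := h.coboundary_cochainEquiv o s o' hε hsign
  have haug : ∀ g, (starSheaf s ℝ).augmentation (h.globalEquiv s (hε ⟨γ₀, hγ₀⟩) g) =
      h.cochainEquiv s hε 0 ((constSheaf ℝ (transversal Δ s.1)).augmentation g) := by
    intro g
    funext σ hs
    have := htop ⟨γ₀, hγ₀⟩ σ.1 hsγ₀ hs.down hd₀ (by simpa using σ.2.2)
    change (ε ⟨γ₀, hγ₀⟩ : ℝ) * _ = (ε σ.1 : ℝ) * _
    rw [this]
    rfl
  refine and_congr ?_ (and_congr ?_ (forall_congr' fun k => ?_))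
  · have hcomm : (starSheaf s ℝ).augmentation ∘ h.globalEquiv s (hε ⟨γ₀, hγ₀⟩) =
        h.cochainEquiv s hε 0 ∘ (constSheaf ℝ (transversal Δ s.1)).augmentation := funext haug
    rw [← (h.cochainEquiv s hε 0).injective.of_comp_iff, ← hcomm,
      Function.Injective.of_comp_iff' _ (h.globalEquiv s (hε ⟨γ₀, hγ₀⟩)).bijective]
  · exact (Function.Exact.iff_of_ladder_addEquiv
      (f₁₂ := (constSheaf ℝ (transversal Δ s.1)).augmentation.toAddMonoidHom)
      (f₂₃ := ((constSheaf ℝ (transversal Δ s.1)).coboundary o' _ 0).toAddMonoidHom)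
      (g₁₂ := (starSheaf s ℝ).augmentation.toAddMonoidHom)
      (g₂₃ := ((starSheaf s ℝ).coboundary o _ 0).toAddMonoidHom)
      (h.globalEquiv s (hε ⟨γ₀, hγ₀⟩)) (h.cochainEquiv s hε 0) (h.cochainEquiv s hε 1)
      (AddMonoidHom.ext haug) (AddMonoidHom.ext (hcob 0))).symm
  · exact (Function.Exact.iff_of_ladder_addEquiv
      (f₁₂ := ((constSheaf ℝ (transversal Δ s.1)).coboundary o' _ k).toAddMonoidHom)
      (f₂₃ := ((constSheaf ℝ (transversal Δ s.1)).coboundary o' _ (k + 1)).toAddMonoidHom)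
      (g₁₂ := ((starSheaf s ℝ).coboundary o _ k).toAddMonoidHom)
      (g₂₃ := ((starSheaf s ℝ).coboundary o _ (k + 1)).toAddMonoidHom)
      (h.cochainEquiv s hε k) (h.cochainEquiv s hε (k + 1)) (h.cochainEquiv s hε (k + 2))
      (AddMonoidHom.ext (hcob k)) (AddMonoidHom.ext (hcob (k + 1)))).symm

end TransversalComplex

/-! ### Decomposition of flabby sheaves into star sheaves -/

section Flabby

universe w₁ w₂

variable {V : Type u} [AddCommGroup V] [Module ℝ V]
variable {R R' : Type*} [CommRing R] [CommRing R'] {Δ : Finset (PointedCone ℝ V)}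

namespace FanSheaf

/-- The image of the preceding module of the augmented relative cellular complex in `C^k`. -/
def coboundaries (F : FanSheaf.{u, w} R Δ) (o : Orient Δ) :
    ∀ k, Submodule R (F.Cochain (boundary Δ) k)
  | 0 => LinearMap.range F.augmentation
  | k + 1 => LinearMap.range (F.coboundary o (boundary Δ) k)

theorem exactAt_iff (F : FanSheaf.{u, w} R Δ) (o : Orient Δ) (k : ℕ) : F.ExactAt o k ↔
    ∀ z, F.coboundary o (boundary Δ) k z = 0 ↔ z ∈ F.coboundaries o k := by
  cases k <;> rfl

theorem Hom.mem_coboundaries {F : FanSheaf.{u, w₁} R Δ} {G : FanSheaf.{u, w₂} R' Δ} (φ : Hom F G)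
    {o : Orient Δ} {k : ℕ} {z : F.Cochain (boundary Δ) k} (hz : z ∈ F.coboundaries o k) :
    φ.cochain z ∈ G.coboundaries o k := by
  cases k with
  | zero =>
    obtain ⟨g, rfl⟩ := hz
    exact ⟨φ.global g, φ.augmentation_global g⟩
  | succ k =>
    obtain ⟨g, rfl⟩ := hz
    exact ⟨φ.cochain g, φ.coboundary_cochain o _ g⟩

theorem pi.mem_coboundaries {ι : Type*} {F : ι → FanSheaf.{u, w} R Δ} {o : Orient Δ} {k : ℕ}
    {z : (FanSheaf.pi F).Cochain (boundary Δ) k}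
    (h : ∀ i, (pi.proj F i).cochain z ∈ (F i).coboundaries o k) :
    z ∈ (FanSheaf.pi F).coboundaries o k := by
  cases k with
  | zero =>
    choose g hg using h
    refine ⟨⟨fun σ i => (g i).1 σ, fun σ τ hle => funext fun i => (g i).2 σ τ hle⟩, ?_⟩
    funext σ
    funext i
    exact congrFun (hg i) σ
  | succ k =>
    choose g hg using h
    let g' : (FanSheaf.pi F).Cochain (boundary Δ) k := fun σ i => g i σ
    refine ⟨g', ?_⟩
    funext σ
    funext i
    have := congrFun ((pi.proj F i).coboundary_cochain o (boundary Δ) g') σ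
    exact this.symm.trans (congrFun (hg i) σ)

theorem pi.single_of_ne {ι : Type*} (F : ι → FanSheaf.{u, w} R Δ) {i j : ι} (hne : j ≠ i) (σ : Δ)
    (x : (F i).obj σ) : (pi.single F i).app σ x j = 0 := by
  classical
  exact Pi.single_eq_of_ne (M := fun i => (F i).obj σ) hne x

/-- Composition of additive maps of sheaves. -/
def Hom.comp {R₂ : Type*} [CommRing R₂] {F : FanSheaf.{u, w} R Δ}
    {G : FanSheaf.{u, w₁} R' Δ} {H : FanSheaf.{u, w₂} R₂ Δ} (ψ : Hom G H) (φ : Hom F G) :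
    Hom F H where
  app σ := (ψ.app σ).comp (φ.app σ)
  comm h x := by
    change ψ.app _ (φ.app _ _) = H.res h (ψ.app _ (φ.app _ x))
    rw [φ.comm, ψ.comm]

variable [Algebra ℝ R]

/-- The kernel of the restriction `F(γ) → F(∂γ)`. -/
def LocKer (F : FanSheaf.{u, w} R Δ) (γ : Δ) : Type w := LinearMap.ker (F.resBoundary γ)

instance (F : FanSheaf.{u, w} R Δ) (γ : Δ) : AddCommGroup (F.LocKer γ) :=
  inferInstanceAs (AddCommGroup (LinearMap.ker (F.resBoundary γ)))

instance (F : FanSheaf.{u, w} R Δ) (γ : Δ) : Module ℝ (F.LocKer γ) :=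
  Module.compHom (LinearMap.ker (F.resBoundary γ)) (algebraMap ℝ R)

/-- The inclusion of the kernel of `F(γ) → F(∂γ)`. -/
def LocKer.incl (F : FanSheaf.{u, w} R Δ) (γ : Δ) : F.LocKer γ →+ F.obj γ :=
  (LinearMap.ker (F.resBoundary γ)).subtype.toAddMonoidHom

theorem res_eq_zero_iff (F : FanSheaf.{u, w} R Δ) {γ : Δ} {x : F.obj γ} :
    F.resBoundary γ x = 0 ↔ ∀ (τ : Δ) (h : τ.1 ≤ γ.1), τ ≠ γ → F.res h x = 0 :=
  ⟨fun hx τ h hne => congrFun (congrArg Subtype.val hx) ⟨τ, h, hne⟩,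
    fun hx => Subtype.ext (funext fun τ => hx τ.1 τ.2.1 τ.2.2)⟩

theorem LocKer.incl_injective (F : FanSheaf.{u, w} R Δ) (γ : Δ) :
    Function.Injective (LocKer.incl F γ) := Subtype.val_injective

theorem LocKer.res_incl (F : FanSheaf.{u, w} R Δ) {γ : Δ} (x : F.LocKer γ) {τ : Δ}
    (h : τ.1 ≤ γ.1) (hne : τ ≠ γ) : F.res h (LocKer.incl F γ x) = 0 :=
  F.res_eq_zero_iff.1 x.2 τ h hne

theorem LocKer.exists_incl (F : FanSheaf.{u, w} R Δ) {γ : Δ} {x : F.obj γ}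
    (hx : ∀ (τ : Δ) (h : τ.1 ≤ γ.1), τ ≠ γ → F.res h x = 0) : ∃ y, LocKer.incl F γ y = x :=
  ⟨⟨x, F.res_eq_zero_iff.2 hx⟩, rfl⟩

/-- The kernel is a direct summand as a real vector space, in general not as an `R`-module. -/
theorem exists_retraction (F : FanSheaf.{u, w} R Δ) (γ : Δ) :
    ∃ r : F.obj γ →+ F.LocKer γ, ∀ x, r (LocKer.incl F γ x) = x := by
  let _ : Module ℝ (F.obj γ) := Module.compHom (F.obj γ) (algebraMap ℝ R)
  let i : F.LocKer γ →ₗ[ℝ] F.obj γ := { LocKer.incl F γ with map_smul' := fun _ _ => rfl }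
  obtain ⟨r, hr⟩ := i.exists_leftInverse_of_injective
    (LinearMap.ker_eq_bot.2 (LocKer.incl_injective F γ))
  exact ⟨r.toAddMonoidHom, fun x => LinearMap.congr_fun hr x⟩

/-- An `ℝ`-linear retraction of `F(γ)` onto the kernel of `F(γ) → F(∂γ)`. -/
def retraction (F : FanSheaf.{u, w} R Δ) (γ : Δ) : F.obj γ →+ F.LocKer γ :=
  (F.exists_retraction γ).choose

theorem retraction_incl (F : FanSheaf.{u, w} R Δ) (γ : Δ) (x : F.LocKer γ) :
    F.retraction γ (LocKer.incl F γ x) = x := (F.exists_retraction γ).choose_spec x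

/-- The product of star sheaves with the coefficients `ker (F(γ) → F(∂γ))`. -/
abbrev starProd (F : FanSheaf.{u, w} R Δ) : FanSheaf ℝ Δ :=
  FanSheaf.pi fun γ => starSheaf γ (F.LocKer γ)

/-- The decomposition map of a sheaf. -/
def decomp (F : FanSheaf.{u, w} R Δ) : F.Hom F.starProd where
  app σ :=
    { toFun := fun x γ h => F.retraction γ (F.res h.down x)
      map_zero' := funext fun γ => funext fun h => by
        change F.retraction γ (F.res h.down 0) = 0
        simp
      map_add' := fun x y => funext fun γ => funext fun h => by
        change F.retraction γ (F.res h.down (x + y)) = F.retraction γ _ + F.retraction γ _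
        simp }
  comm {σ τ} h x := by
    refine funext fun γ => funext fun h' => ?_
    change F.retraction γ (F.res h'.down (F.res h x)) = F.retraction γ (F.res _ x)
    rw [F.res_res]

theorem decomp_apply (F : FanSheaf.{u, w} R Δ) {σ γ : Δ} (x : F.obj σ) (h : γ.1 ≤ σ.1) :
    F.decomp.app σ x γ ⟨h⟩ = F.retraction γ (F.res h x) := rfl

/-- By induction on the cone, `x` restricts to zero on all proper faces. It then lies in the local
kernel, where the retraction is the identity. -/
theorem eq_zero_of_retraction (F : FanSheaf.{u, w} R Δ) (σ : Δ) : ∀ x : F.obj σ,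
    (∀ (γ : Δ) (h : γ.1 ≤ σ.1), F.retraction γ (F.res h x) = 0) → x = 0 := by
  induction σ using WellFoundedLT.induction with
  | ind σ ih =>
    intro x hx
    obtain ⟨y, rfl⟩ := LocKer.exists_incl F (x := x) fun τ h hne =>
      ih τ (lt_of_le_of_ne h hne) _ fun γ hγ => by
        rw [F.res_res]
        exact hx _ _
    have := hx σ le_rfl
    rw [F.res_self, retraction_incl] at this
    rw [this, map_zero]

theorem decomp_injective (F : FanSheaf.{u, w} R Δ) (σ : Δ) :
    Function.Injective (F.decomp.app σ) :=
  (injective_iff_map_eq_zero _).2 fun x hx => F.eq_zero_of_retraction σ x fun γ h =>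
    congrFun (congrFun hx γ) ⟨h⟩

/-- Solve on the proper faces by induction, extend by flabbiness, and correct the component at `σ`
by an element of the local kernel, which is invisible on proper faces. -/
theorem decomp_surjective (F : FanSheaf.{u, w} R Δ)
    (hF : ∀ σ, Function.Surjective (F.resBoundary σ)) (σ : Δ) :
    Function.Surjective (F.decomp.app σ) := by
  induction σ using WellFoundedLT.induction with
  | ind σ ih =>
    intro y
    have hex : ∀ τ : properFaces σ, ∃ x, F.decomp.app τ.1 x = F.starProd.res τ.2.1 y :=
      fun τ => ih τ.1 (lt_of_le_of_ne τ.2.1 τ.2.2) _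
    choose x hx using hex
    -- The solutions on the proper faces are compatible because the decomposition map is injective.
    obtain ⟨x₀, hx₀⟩ := hF σ ⟨x, fun τ ρ h => F.decomp_injective _ (by
      rw [F.decomp.comm, hx, hx, F.starProd.res_res])⟩
    have hres : ∀ (τ : Δ) (h : τ.1 ≤ σ.1) (hne : τ ≠ σ), F.res h x₀ = x ⟨τ, h, hne⟩ :=
      fun τ h hne => congrFun (congrArg Subtype.val hx₀) ⟨τ, h, hne⟩
    refine ⟨x₀ + LocKer.incl F σ (y σ ⟨le_rfl⟩ - F.retraction σ x₀),
      funext fun γ => funext fun h => ?_⟩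
    obtain ⟨h⟩ := h
    rw [decomp_apply]
    by_cases hne : γ = σ
    · subst hne
      rw [F.res_self, map_add, retraction_incl, add_sub_cancel]
    · rw [map_add, LocKer.res_incl F _ h hne, add_zero, hres γ h hne]
      have := congrFun (congrFun (hx ⟨γ, h, hne⟩) γ) ⟨le_rfl⟩
      rw [decomp_apply, F.res_self] at this
      exact this

/-- The inverse of the decomposition map of a flabby sheaf. -/
def decompInv (F : FanSheaf.{u, w} R Δ) (hF : ∀ σ, Function.Surjective (F.resBoundary σ)) :
    F.starProd.Hom F where
  app σ := (AddEquiv.ofBijective (F.decomp.app σ)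
    ⟨F.decomp_injective σ, F.decomp_surjective hF σ⟩).symm.toAddMonoidHom
  comm {σ τ} h x := F.decomp_injective τ (by
    rw [F.decomp.comm]
    refine (AddEquiv.apply_symm_apply (AddEquiv.ofBijective (F.decomp.app τ) _) _).trans ?_
    congr 1
    exact (AddEquiv.apply_symm_apply (AddEquiv.ofBijective (F.decomp.app σ) _) _).symm)

theorem decomp_decompInv (F : FanSheaf.{u, w} R Δ)
    (hF : ∀ σ, Function.Surjective (F.resBoundary σ)) (σ : Δ) (y : F.starProd.obj σ) :
    F.decomp.app σ ((F.decompInv hF).app σ y) = y :=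
  AddEquiv.apply_symm_apply (AddEquiv.ofBijective (F.decomp.app σ) _) _

theorem decompInv_decomp (F : FanSheaf.{u, w} R Δ)
    (hF : ∀ σ, Function.Surjective (F.resBoundary σ)) (σ : Δ) (x : F.obj σ) :
    (F.decompInv hF).app σ (F.decomp.app σ x) = x :=
  AddEquiv.symm_apply_apply (AddEquiv.ofBijective (F.decomp.app σ) _) _

theorem exactAt_of_starSheaf (F : FanSheaf.{u, w} R Δ)
    (hF : ∀ σ, Function.Surjective (F.resBoundary σ)) {o : Orient Δ} {k : ℕ}
    (h : ∀ γ, (starSheaf γ ℝ).ExactAt o k) : F.ExactAt o k :=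
  ExactAt.of_retract F.decomp (F.decompInv hF) (F.decompInv_decomp hF)
    (ExactAt.pi fun γ => starSheaf_exactAt γ _ (h γ))

/-- The map of a star sheaf to a flabby sheaf `F` given by a vector of `ker (F(γ) → F(∂γ))`. -/
def starHom (F : FanSheaf.{u, w} R Δ) (hF : ∀ σ, Function.Surjective (F.resBoundary σ)) (γ : Δ)
    (κ : F.LocKer γ) : (starSheaf γ ℝ).Hom F :=
  ((F.decompInv hF).comp (pi.single _ γ)).comp (starVec γ κ)

theorem exists_starHom_leftInverse (F : FanSheaf.{u, w} R Δ)
    (hF : ∀ σ, Function.Surjective (F.resBoundary σ)) (γ : Δ) {κ : F.LocKer γ} (hκ : κ ≠ 0) :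
    ∃ p : F.Hom (starSheaf γ ℝ), ∀ σ x, p.app σ ((F.starHom hF γ κ).app σ x) = x := by
  obtain ⟨p, hp⟩ := exists_starVec_leftInverse γ hκ
  refine ⟨(p.comp (pi.proj _ γ)).comp F.decomp, fun σ x => ?_⟩
  change p.app σ ((pi.proj _ γ).app σ (F.decomp.app σ ((F.decompInv hF).app σ
    ((pi.single _ γ).app σ ((starVec γ κ).app σ x))))) = x
  rw [decomp_decompInv, pi.proj_single, hp]

theorem retraction_starHom (F : FanSheaf.{u, w} R Δ)
    (hF : ∀ σ, Function.Surjective (F.resBoundary σ)) (γ : Δ) (κ : F.LocKer γ) {σ : Δ}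
    (x : (starSheaf γ ℝ).obj σ) {γ' : Δ} (hne : γ' ≠ γ) (h : γ'.1 ≤ σ.1) :
    F.retraction γ' (F.res h ((F.starHom hF γ κ).app σ x)) = 0 := by
  rw [← decomp_apply]
  change F.decomp.app σ ((F.decompInv hF).app σ
    ((pi.single _ γ).app σ ((starVec γ κ).app σ x))) γ' ⟨h⟩ = 0
  rw [decomp_decompInv]
  have := pi.single_of_ne (fun γ => starSheaf γ (F.LocKer γ)) hne σ ((starVec γ κ).app σ x)
  exact congrFun this (⟨h⟩ : PLift (γ'.1 ≤ σ.1))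

/-- Multiples of images of cocycles of a star sheaf by elements that annihilate `F(γ)` are
coboundaries, provided that the star sheaves of the larger cones are exact. -/
theorem smul_starHom_mem (F : FanSheaf.{u, w} R Δ)
    (hF : ∀ σ, Function.Surjective (F.resBoundary σ)) (γ : Δ) (κ : F.LocKer γ) {o : Orient Δ}
    {k : ℕ} (h : ∀ γ' : Δ, γ < γ' → (starSheaf γ' ℝ).ExactAt o k) {a : R}
    (ha : ∀ x : F.obj γ, a • x = 0) {z : (starSheaf γ ℝ).Cochain (boundary Δ) k}
    (hz : (starSheaf γ ℝ).coboundary o (boundary Δ) k z = 0) :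
    a • (F.starHom hF γ κ).cochain z ∈ F.coboundaries o k := by
  set Z := (F.starHom hF γ κ).cochain z with hZ
  have hZ0 : F.coboundary o (boundary Δ) k (a • Z) = 0 := by
    rw [map_smul, hZ, Hom.coboundary_cochain, hz, Hom.cochain_zero, smul_zero]
  have key : F.decomp.cochain (a • Z) ∈ F.starProd.coboundaries o k := by
    refine pi.mem_coboundaries fun γ' => ?_
    -- The decomposition is not `R`-linear, so multiplication by `a` may create components at larger
    -- cones, where exactness is assumed. At all other cones the component vanishes.
    by_cases hlt : γ < γ'
    · refine ((exactAt_iff _ o k).1 (starSheaf_exactAt γ' (F.LocKer γ') (h γ' hlt)) _).1 ?_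
      rw [Hom.coboundary_cochain, Hom.coboundary_cochain, hZ0, Hom.cochain_zero, Hom.cochain_zero]
    · convert Submodule.zero_mem _
      funext σ
      funext hσ
      obtain ⟨hσ⟩ := hσ
      change F.retraction γ' (F.res hσ (a • Z σ)) = 0
      rw [map_smul]
      by_cases hγ : γ' = γ
      · subst hγ
        rw [ha, map_zero]
      -- As `γ'` does not contain `γ`, no face of `γ'` is `γ`, and `Z` has components only at `γ`.
      · have : F.res hσ (Z σ) = 0 := by
          refine F.eq_zero_of_retraction γ' _ fun ρ hρ => ?_
          rw [F.res_res]
          exact F.retraction_starHom hF γ κ (z σ)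
            (fun e => hlt (lt_of_le_of_ne (by rw [← e]; exact hρ) (Ne.symm hγ))) _
        rw [this, smul_zero, map_zero]
  have := (F.decompInv hF).mem_coboundaries key
  convert this using 1
  funext σ
  exact (F.decompInv_decomp hF _ _).symm

end FanSheaf

end Flabby

/-! ### Projective dimension and depth -/

section ProjectiveDimension

open CategoryTheory Abelian

universe w₁ w₂

variable (R : Type u) [CommRing R]

/-- The projective dimension of the `R`-module `M` is at most `n`. -/
def PdLE (M : Type w) [AddCommGroup M] [Module R M] (n : ℕ) : Prop :=
  HasProjectiveDimensionLT (ModuleCat.of R (ULift.{u} M)) (n + 1)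

variable {R}

theorem PdLE.mono {M : Type w} [AddCommGroup M] [Module R M] {m n : ℕ} (h : PdLE R M m)
    (hmn : m ≤ n) : PdLE R M n :=
  have : HasProjectiveDimensionLT (ModuleCat.of R (ULift.{u} M)) (m + 1) := h
  hasProjectiveDimensionLT_of_ge _ (m + 1) (n + 1) (by omega)

theorem PdLE.of_equiv {M : Type w₁} {N : Type w₂} [AddCommGroup M] [Module R M] [AddCommGroup N]
    [Module R N] (e : M ≃ₗ[R] N) {n : ℕ} (h : PdLE R M n) : PdLE R N n :=
  have : HasProjectiveDimensionLE (ModuleCat.of R (ULift.{u} M)) n := h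
  ModuleCat.hasProjectiveDimensionLE_of_linearEquiv.{max u w₁, max u w₂}
    (M := ModuleCat.of R (ULift.{u} M)) (N := ModuleCat.of R (ULift.{u} N))
    (ULift.moduleEquiv.trans (e.trans ULift.moduleEquiv.symm)) n

theorem pdLE_zero_iff {M : Type w} [AddCommGroup M] [Module R M] :
    PdLE R M 0 ↔ Module.Projective R M := by
  unfold PdLE
  rw [zero_add, ← projective_iff_hasProjectiveDimensionLT_one]
  exact (IsProjective.iff_projective (R := R) (ULift.{u} M)).symm.trans
    ⟨fun _ => Module.Projective.of_equiv (ULift.moduleEquiv (R := R) (M := M)),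
      fun _ => Module.Projective.of_equiv (ULift.moduleEquiv (R := R) (M := M)).symm⟩

theorem PdLE.of_subsingleton {M : Type w} [AddCommGroup M] [Module R M] [Subsingleton M] (n : ℕ) :
    PdLE R M n :=
  (pdLE_zero_iff.2 inferInstance).mono (Nat.zero_le n)

section Exact

variable {M N P : Type w} [AddCommGroup M] [Module R M] [AddCommGroup N] [Module R N]
  [AddCommGroup P] [Module R P]

/-- A linear map between modules lifted to a larger universe. -/
def uliftMap (f : M →ₗ[R] N) : ULift.{u} M →ₗ[R] ULift.{u} N where
  toFun x := ⟨f x.down⟩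
  map_add' _ _ := congrArg ULift.up (map_add f _ _)
  map_smul' _ _ := congrArg ULift.up (map_smul f _ _)

/-- The short complex of modules in a larger universe given by two linear maps. -/
abbrev uliftComplex (f : M →ₗ[R] N) (g : N →ₗ[R] P) (h : Function.Exact f g) :
    ShortComplex (ModuleCat.{max u w} R) :=
  ModuleCat.shortComplexOfCompEqZero (uliftMap f) (uliftMap g)
    (LinearMap.ext fun x => congrArg ULift.up (h.apply_apply_eq_zero x.down))

theorem uliftComplex_shortExact {f : M →ₗ[R] N} {g : N →ₗ[R] P} (h : Function.Exact f g)
    (hf : Function.Injective f) (hg : Function.Surjective g) :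
    (uliftComplex f g h).ShortExact := by
  refine ModuleCat.shortComplex_shortExact _ (fun y => ?_) (fun x y hxy => ?_) (fun y => ?_)
  · constructor
    · intro hy
      obtain ⟨x, hx⟩ := (h (ULift.down y)).1 (congrArg ULift.down hy)
      exact ⟨ULift.up x, congrArg ULift.up hx⟩
    · rintro ⟨x, rfl⟩
      exact congrArg ULift.up (h.apply_apply_eq_zero (ULift.down x))
  · exact ULift.ext _ _ (hf (congrArg ULift.down hxy))
  · obtain ⟨x, hx⟩ := hg (ULift.down y)
    exact ⟨ULift.up x, congrArg ULift.up hx⟩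

variable {f : M →ₗ[R] N} {g : N →ₗ[R] P} {n : ℕ}

theorem PdLE.middle (h : Function.Exact f g) (hf : Function.Injective f)
    (hg : Function.Surjective g) (h₁ : PdLE R M n) (h₃ : PdLE R P n) : PdLE R N n :=
  (uliftComplex_shortExact h hf hg).hasProjectiveDimensionLT_X₂ (n + 1) h₁ h₃

theorem PdLE.right (h : Function.Exact f g) (hf : Function.Injective f)
    (hg : Function.Surjective g) (h₁ : PdLE R M n) (h₂ : PdLE R N (n + 1)) : PdLE R P (n + 1) :=
  (uliftComplex_shortExact h hf hg).hasProjectiveDimensionLT_X₃ (n + 1) h₁ h₂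

theorem PdLE.left (h : Function.Exact f g) (hf : Function.Injective f)
    (hg : Function.Surjective g) (h₂ : PdLE R N n) (h₃ : PdLE R P (n + 1)) : PdLE R M n :=
  (uliftComplex_shortExact h hf hg).hasProjectiveDimensionLT_X₁ (n + 1) h₂ h₃

end Exact

theorem PdLE.pi_fin {n : ℕ} (b : ℕ) (M : Fin b → Type w) [∀ i, AddCommGroup (M i)]
    [∀ i, Module R (M i)] (h : ∀ i, PdLE R (M i) n) : PdLE R (∀ i, M i) n := by
  induction b with
  | zero => exact PdLE.of_subsingleton n
  | succ b ih =>
    let e := Fin.consLinearEquiv R M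
    refine PdLE.of_equiv e ?_
    exact PdLE.middle (f := LinearMap.inl R (M 0) (∀ i : Fin b, M i.succ))
      (g := LinearMap.snd R (M 0) (∀ i : Fin b, M i.succ)) Function.Exact.inl_snd
      LinearMap.inl_injective LinearMap.snd_surjective (h 0) (ih _ fun i => h i.succ)

theorem PdLE.pi {ι : Type w₁} [Finite ι] {n : ℕ} (M : ι → Type w) [∀ i, AddCommGroup (M i)]
    [∀ i, Module R (M i)] (h : ∀ i, PdLE R (M i) n) : PdLE R (∀ i, M i) n := by
  obtain ⟨b, ⟨e⟩⟩ := Finite.exists_equiv_fin ι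
  exact PdLE.of_equiv (LinearEquiv.piCongrLeft R M e.symm)
    (PdLE.pi_fin b (fun i => M (e.symm i)) fun i => h _)

/-- Vanishing of `Ext` into a finite projective module follows from its vanishing into the ring. -/
theorem ext_eq_zero_of_projective {N F P : ModuleCat.{max u w} R} (eF : R ≃ₗ[R] F) {i : ℕ}
    (hN : Subsingleton (Ext N F i)) [Module.Finite R P] [Module.Projective R P] (x : Ext N P i) :
    x = 0 := by
  obtain ⟨b, f, hf⟩ := Module.Finite.exists_fin' R P
  obtain ⟨s, hs⟩ := Module.projective_lifting_property f LinearMap.id hf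
  let p : Fin b → (P ⟶ F) := fun j => ModuleCat.ofHom (eF.toLinearMap ∘ₗ LinearMap.proj j ∘ₗ s)
  let q : Fin b → (F ⟶ P) := fun j =>
    ModuleCat.ofHom (f ∘ₗ LinearMap.single R (fun _ => R) j ∘ₗ eF.symm.toLinearMap)
  -- A finite projective module is a retract of some `R^b`, so its identity is a finite sum of maps
  -- through the ring.
  have hid : 𝟙 P = ∑ j, p j ≫ q j := by
    refine ModuleCat.hom_ext (LinearMap.ext fun y => ?_)
    have h1 : f (s y) = y := LinearMap.congr_fun hs y
    rw [ModuleCat.hom_sum, LinearMap.sum_apply]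
    change y = ∑ j, f (Pi.single j (eF.symm (eF (s y j))))
    simp only [LinearEquiv.symm_apply_apply]
    rw [← map_sum, Finset.univ_sum_single, h1]
  rw [← x.comp_mk₀_id, hid, Ext.mk₀_sum, Ext.comp_sum]
  refine Finset.sum_eq_zero fun j _ => ?_
  rw [← Ext.mk₀_comp_mk₀, ← Ext.comp_assoc_of_second_deg_zero,
    Subsingleton.elim (x.comp (Ext.mk₀ (p j)) _) 0, Ext.zero_comp]

/-- Dimension shifting along `0 → K → R^b → Q → 0`: `Ext^i(N, Q)` lies between `Ext^i(N, R^b)` and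
`Ext^{i+1}(N, K)`, and `K` has projective dimension one less. -/
theorem ext_eq_zero_of_hasProjectiveDimensionLT [IsNoetherianRing R] {N F : ModuleCat.{max u w} R}
    (eF : R ≃ₗ[R] F) {m : ℕ} (hN : ∀ i < m, Subsingleton (Ext N F i)) (k : ℕ) :
    ∀ (Q : ModuleCat.{max u w} R) [Module.Finite R Q] [HasProjectiveDimensionLT Q (k + 1)] (i : ℕ),
      i + k < m → ∀ x : Ext N Q i, x = 0 := by
  induction k with
  | zero =>
    intro Q _ hQ i hi x
    have : Module.Projective R Q := (IsProjective.iff_projective Q).2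
      (projective_iff_hasProjectiveDimensionLT_one.2 hQ)
    exact ext_eq_zero_of_projective eF (hN i hi) x
  | succ k ih =>
    intro Q _ hQ i hi x
    obtain ⟨b, f, hf⟩ := Module.Finite.exists_fin' R Q
    let f' : ULift.{max u w} (Fin b → R) →ₗ[R] Q := f ∘ₗ ULift.moduleEquiv.toLinearMap
    have hf' : Function.Surjective f' := hf.comp ULift.moduleEquiv.surjective
    have hS := LinearMap.shortExact_shortComplexKer hf'
    have : Module.Projective R (ULift.{max u w} (Fin b → R)) :=
      Module.Projective.of_equiv ULift.moduleEquiv.symm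
    have hP : Projective (ModuleCat.of R (ULift.{max u w} (Fin b → R))) :=
      (IsProjective.iff_projective _).1 this
    have hK : HasProjectiveDimensionLT (ModuleCat.of R (LinearMap.ker f')) (k + 1) :=
      hS.hasProjectiveDimensionLT_X₁ (k + 1)
        (hasProjectiveDimensionLT_of_ge _ 1 (k + 1) (by omega)) hQ
    have : Module.Finite R (ULift.{max u w} (Fin b → R)) :=
      Module.Finite.equiv ULift.moduleEquiv.symm
    obtain ⟨y, rfl⟩ := Ext.covariant_sequence_exact₃ N hS x rfl
      (ih (ModuleCat.of R (LinearMap.ker f')) (i + 1) (by omega) _)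
    have hy : y = 0 := ext_eq_zero_of_projective (P := ModuleCat.of R (ULift.{max u w} (Fin b → R)))
      eF (hN i (by omega)) y
    rw [hy, Ext.zero_comp]

/-- An element of a module of projective dimension at most `k` that is annihilated by a regular
sequence with more than `k` members is zero. -/
theorem PdLE.eq_zero_of_isRegular [IsNoetherianRing R] {rs : List R}
    (reg : RingTheory.Sequence.IsRegular R rs) {k : ℕ} {Q : Type w} [AddCommGroup Q] [Module R Q]
    [Module.Finite R Q] (hQ : PdLE R Q k) (hk : k < rs.length) {q : Q}
    (hq : ∀ r ∈ rs, r • q = 0) : q = 0 := by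
  let I := Ideal.ofList rs
  let N : ModuleCat.{max u w} R := ModuleCat.of R (ULift.{max u w} (R ⧸ I))
  let F : ModuleCat.{max u w} R := ModuleCat.of R (ULift.{max u w} R)
  let eF : R ≃ₗ[R] F := ULift.moduleEquiv.symm
  let eN : (R ⧸ I) ≃ₗ[R] N := ULift.moduleEquiv.symm
  have : Module.Finite R N := Module.Finite.equiv eN
  have : Module.Finite R F := Module.Finite.equiv eF
  have hI : I • (⊤ : Submodule R F) < ⊤ := by
    have := ((eF.isRegular_congr rs).1 reg).2
    exact lt_top_iff_ne_top.2 this.symm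
  -- A regular sequence in `I` kills `Ext^i(R/I, R)` for all `i` below its length.
  have hext := ModuleCat.subsingleton_ext_of_exists_isRegular I N
    (by rw [← eN.support_eq, Module.support_eq_zeroLocus, Ideal.annihilator_quotient]) F hI rs
    (fun r hr => Ideal.subset_span hr) ((eF.isRegular_congr rs).1 reg)
  have : Module.Finite R (ModuleCat.of R (ULift.{u} Q)) :=
    Module.Finite.equiv (ULift.moduleEquiv (R := R) (M := Q)).symm
  have : HasProjectiveDimensionLT (ModuleCat.of R (ULift.{u} Q)) (k + 1) := hQ
  have h0 := ext_eq_zero_of_hasProjectiveDimensionLT eF hext k (ModuleCat.of R (ULift.{u} Q)) 0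
    (by omega)
  -- The annihilated element `q` defines a map `R/I → Q`, and this is zero because `Ext^0` vanishes.
  have hle : I ≤ LinearMap.ker (LinearMap.toSpanSingleton R Q q) :=
    Ideal.span_le.2 fun r hr => hq r hr
  let φ : N →ₗ[R] ULift.{u} Q :=
    ULift.moduleEquiv.symm.toLinearMap ∘ₗ (I.liftQ _ hle) ∘ₗ eN.symm.toLinearMap
  have h1 : ModuleCat.ofHom φ = (0 : N ⟶ ModuleCat.of R (ULift.{u} Q)) := by
    have := h0 (Ext.mk₀ (ModuleCat.ofHom φ))
    exact Ext.homEquiv₀.symm.injective (by simpa using this)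
  have h2 : φ (eN (Ideal.Quotient.mk I 1)) = 0 :=
    congrArg (fun ψ : N ⟶ ModuleCat.of R (ULift.{u} Q) => ψ.hom (eN (Ideal.Quotient.mk I 1))) h1
  have h3 := congrArg ULift.down h2
  change (1 : R) • q = 0 at h3
  simpa using h3

end ProjectiveDimension

/-! ### Polynomial functions on subspaces -/

section Pol

open Module

section Basic

variable {M N : Type*} [AddCommGroup M] [Module ℝ M] [AddCommGroup N] [Module ℝ N]

instance [FiniteDimensional ℝ M] : IsNoetherianRing (Pol M) :=
  isNoetherianRing_of_ringEquiv _
    (SymmetricAlgebra.equivMvPolynomial (Module.finBasis ℝ (Dual ℝ M))).symm.toRingEquiv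

@[simp]
theorem Pol.comap_ι (f : M →ₗ[ℝ] N) (ℓ : Dual ℝ N) :
    Pol.comap f (SymmetricAlgebra.ι ℝ _ ℓ) = SymmetricAlgebra.ι ℝ _ (ℓ ∘ₗ f) := by
  simp only [Pol.comap, SymmetricAlgebra.lift_ι_apply]
  rfl

theorem Pol.comap_id (a : Pol M) : Pol.comap (LinearMap.id : M →ₗ[ℝ] M) a = a := by
  have : Pol.comap (LinearMap.id : M →ₗ[ℝ] M) = AlgHom.id ℝ _ := by
    apply SymmetricAlgebra.algHom_ext
    ext x
    simp
  rw [this]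
  rfl

theorem Pol.comap_surjective {f : M →ₗ[ℝ] N} (hf : Function.Injective f) :
    Function.Surjective (Pol.comap f) := by
  obtain ⟨g, hg⟩ := f.exists_leftInverse_of_injective (LinearMap.ker_eq_bot.2 hf)
  exact fun a => ⟨Pol.comap g a, by rw [Pol.comap_comap, hg, Pol.comap_id]⟩

theorem Pol.comap_injective {f : M →ₗ[ℝ] N} (hf : Function.Surjective f) :
    Function.Injective (Pol.comap f) := by
  obtain ⟨g, hg⟩ := f.exists_rightInverse_of_surjective (LinearMap.range_eq_top.2 hf)
  exact Function.LeftInverse.injective (g := Pol.comap g) fun a => by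
    rw [Pol.comap_comap, hg, Pol.comap_id]

/-- The value of a polynomial function at a point. -/
def Pol.eval (v : M) : Pol M →ₐ[ℝ] ℝ := SymmetricAlgebra.lift (Dual.eval ℝ M v)

theorem Pol.eval_ι (v : M) (ℓ : Dual ℝ M) : Pol.eval v (SymmetricAlgebra.ι ℝ _ ℓ) = ℓ v := by
  simp [Pol.eval]

theorem Pol.ι_ne_zero {ℓ : Dual ℝ M} (hℓ : ℓ ≠ 0) : SymmetricAlgebra.ι ℝ _ ℓ ≠ 0 := by
  obtain ⟨v, hv⟩ := DFunLike.ne_iff.1 hℓ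
  intro h
  have := Pol.eval_ι v ℓ
  rw [h, map_zero] at this
  exact hv this.symm

theorem Pol.maxIdeal_le_ker : Pol.maxIdeal M ≤ RingHom.ker (Pol.eval (0 : M)) := by
  refine Ideal.span_le.2 ?_
  rintro _ ⟨ℓ, rfl⟩
  simp [RingHom.mem_ker, Pol.eval_ι]

theorem Pol.sub_eval_mem (a : Pol M) : a - algebraMap ℝ _ (Pol.eval (0 : M) a) ∈ Pol.maxIdeal M := by
  have : (Ideal.Quotient.mkₐ ℝ (Pol.maxIdeal M)).comp ((Algebra.ofId ℝ (Pol M)).comp (Pol.eval 0)) =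
      Ideal.Quotient.mkₐ ℝ (Pol.maxIdeal M) := by
    apply SymmetricAlgebra.algHom_ext
    ext ℓ
    have h0 : Ideal.Quotient.mk (Pol.maxIdeal M) (SymmetricAlgebra.ι ℝ _ ℓ) = 0 :=
      Ideal.Quotient.eq_zero_iff_mem.2 (Ideal.subset_span ⟨ℓ, rfl⟩)
    simp [Pol.eval_ι, h0]
  rw [← Ideal.Quotient.eq_zero_iff_mem, map_sub, sub_eq_zero]
  exact (DFunLike.congr_fun this a).symm

/-- A polynomial function that vanishes on the kernel of a linear form is divisible by that form. -/
theorem Pol.ker_comap {f : M →ₗ[ℝ] N} (hf : Function.Injective f) {ℓ : Dual ℝ N}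
    (hℓ : LinearMap.range f = LinearMap.ker ℓ) :
    RingHom.ker (Pol.comap f) = Ideal.span {SymmetricAlgebra.ι ℝ _ ℓ} := by
  obtain ⟨p, hp⟩ := f.exists_leftInverse_of_injective (LinearMap.ker_eq_bot.2 hf)
  -- Here `f ∘ₗ p` is a projection onto the hyperplane `ker ℓ`, so `x` and its pullback differ by a
  -- form vanishing on that hyperplane.
  have hx : ∀ x : Dual ℝ N, ∃ c : ℝ, x - x ∘ₗ f ∘ₗ p = c • ℓ := by
    intro x
    have hle : LinearMap.ker ℓ ≤ LinearMap.ker (x - x ∘ₗ f ∘ₗ p) := by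
      intro v hv
      rw [← hℓ] at hv
      obtain ⟨u, rfl⟩ := hv
      have : p (f u) = u := LinearMap.congr_fun hp u
      simp [this]
    have hmem := mem_span_of_iInf_ker_le_ker (ι := Unit) (L := fun _ => ℓ)
      (K := x - x ∘ₗ f ∘ₗ p) (by simpa using hle)
    rw [Set.range_const] at hmem
    obtain ⟨c, hc⟩ := Submodule.mem_span_singleton.1 hmem
    exact ⟨c, hc.symm⟩
  -- Modulo `ℓ`, the pullback along the projection fixes the linear forms, hence every polynomial.
  have key : ∀ a : Pol N, a - Pol.comap (f ∘ₗ p) a ∈ Ideal.span {SymmetricAlgebra.ι ℝ _ ℓ} := by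
    intro a
    set I : Ideal (Pol N) := Ideal.span {SymmetricAlgebra.ι ℝ _ ℓ} with hI
    have : (Ideal.Quotient.mkₐ ℝ I).comp (Pol.comap (f ∘ₗ p)) = Ideal.Quotient.mkₐ ℝ I := by
      apply SymmetricAlgebra.algHom_ext
      ext x
      obtain ⟨c, hc⟩ := hx x
      change Ideal.Quotient.mk I (Pol.comap (f ∘ₗ p) (SymmetricAlgebra.ι ℝ _ x)) =
        Ideal.Quotient.mk I (SymmetricAlgebra.ι ℝ _ x)
      rw [Pol.comap_ι, eq_comm, ← sub_eq_zero, ← map_sub, ← map_sub, hc, map_smul,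
        Ideal.Quotient.eq_zero_iff_mem]
      exact Submodule.smul_of_tower_mem _ c (Ideal.subset_span rfl)
    rw [← Ideal.Quotient.eq_zero_iff_mem, map_sub, sub_eq_zero]
    exact (DFunLike.congr_fun this a).symm
  apply le_antisymm
  · intro a ha
    have := key a
    rwa [← Pol.comap_comap, RingHom.mem_ker.1 ha, map_zero, sub_zero] at this
  · refine Ideal.span_le.2 ?_
    rintro _ rfl
    have : ℓ ∘ₗ f = 0 := LinearMap.ext fun u => by
      have : f u ∈ LinearMap.ker ℓ := hℓ ▸ ⟨u, rfl⟩
      exact this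
    rw [SetLike.mem_coe, RingHom.mem_ker, Pol.comap_ι, this, map_zero]

end Basic

variable {V : Type u} [AddCommGroup V] [Module ℝ V]

/-- Polynomial functions on `V` restrict to subspaces. -/
instance (W : Submodule ℝ V) : Algebra (Pol V) (Pol W) := (Pol.comap W.subtype).toAlgebra

theorem Pol.smul_def {W : Submodule ℝ V} (a : Pol V) (b : Pol W) :
    a • b = Pol.comap W.subtype a * b := rfl

/-- Restriction to a smaller subspace, as a linear map. -/
def Pol.resLinear {W W' : Submodule ℝ V} (h : W ≤ W') : Pol W' →ₗ[Pol V] Pol W where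
  toFun := Pol.comap (Submodule.inclusion h)
  map_add' := map_add _
  map_smul' a b := by
    rw [Pol.smul_def, map_mul, Pol.comap_comap, Submodule.subtype_comp_inclusion]
    rfl

theorem Pol.resLinear_surjective {W W' : Submodule ℝ V} (h : W ≤ W') :
    Function.Surjective (Pol.resLinear h) :=
  Pol.comap_surjective (Submodule.inclusion_injective h)

theorem Pol.exact_resLinear {W W' : Submodule ℝ V} (h : W ≤ W') {ℓ : Dual ℝ W'}
    (hℓ : ∀ v : W', ℓ v = 0 ↔ (v : V) ∈ W) :
    Function.Exact (LinearMap.lsmul (Pol W') (Pol W') (SymmetricAlgebra.ι ℝ _ ℓ) |>.restrictScalars (Pol V))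
      (Pol.resLinear h) := by
  have hr : LinearMap.range (Submodule.inclusion h) = LinearMap.ker ℓ := by
    ext v
    rw [Submodule.range_inclusion, Submodule.mem_comap, LinearMap.mem_ker, hℓ]
    rfl
  intro a
  have := Pol.ker_comap (Submodule.inclusion_injective h) hr
  rw [show Pol.resLinear h a = 0 ↔ a ∈ RingHom.ker (Pol.comap (Submodule.inclusion h)) from Iff.rfl,
    this, Ideal.mem_span_singleton]
  exact ⟨fun ⟨c, hc⟩ => ⟨c, hc.symm⟩, fun ⟨c, hc⟩ => ⟨c, hc.symm⟩⟩

/-- The polynomial functions on `V` and on the subspace `⊤` of `V`. -/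
def Pol.topEquiv (V : Type u) [AddCommGroup V] [Module ℝ V] :
    Pol V ≃ₗ[Pol V] Pol (⊤ : Submodule ℝ V) :=
  LinearEquiv.ofBijective (Algebra.linearMap (Pol V) (Pol (⊤ : Submodule ℝ V)))
    ⟨Pol.comap_injective fun v => ⟨⟨v, trivial⟩, rfl⟩,
      Pol.comap_surjective Subtype.val_injective⟩

theorem exists_form_of_notMem (W : Submodule ℝ V) {w : V} (hw : w ∉ W) :
    ∃ ℓ : Dual ℝ V, ℓ w ≠ 0 ∧ ∀ v ∈ W, ℓ v = 0 := by
  obtain ⟨ℓ, h1, h2⟩ := W.exists_le_ker_of_notMem hw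
  exact ⟨ℓ, h1, fun v hv => h2 hv⟩

variable [FiniteDimensional ℝ V]

/-- If `W` is a hyperplane in `W'` with equation `ℓ`, then `Pol W` is the cokernel of the injective
multiplication by `ℓ` on `Pol W'`. Each step down costs one. -/
theorem Pol.pdLE (c : ℕ) : ∀ W : Submodule ℝ V, finrank ℝ W + c = finrank ℝ V →
    PdLE (Pol V) (Pol W) c := by
  induction c with
  | zero =>
    intro W hW
    obtain rfl : W = ⊤ := Submodule.eq_top_of_finrank_eq hW
    exact PdLE.of_equiv (Pol.topEquiv V) (pdLE_zero_iff.2 inferInstance)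
  | succ c ih =>
    intro W hW
    have hne : W ≠ ⊤ := by
      rintro rfl
      rw [finrank_top] at hW
      omega
    obtain ⟨w, -, hw⟩ := SetLike.exists_of_lt (lt_top_iff_ne_top.2 hne)
    obtain ⟨ℓ, hℓw, hℓ⟩ := exists_form_of_notMem W hw
    set W' : Submodule ℝ V := W ⊔ Submodule.span ℝ {w} with hW'
    have hle : W ≤ W' := le_sup_left
    have hker : ∀ v : W', (ℓ ∘ₗ W'.subtype) v = 0 ↔ (v : V) ∈ W := by
      rintro ⟨v, hv⟩
      refine ⟨fun h0 => ?_, fun h0 => hℓ _ h0⟩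
      obtain ⟨x, hx, y, hy, rfl⟩ := Submodule.mem_sup.1 hv
      obtain ⟨t, rfl⟩ := Submodule.mem_span_singleton.1 hy
      change ℓ (x + t • w) = 0 at h0
      rw [map_add, hℓ x hx, zero_add, map_smul, smul_eq_zero, or_iff_left hℓw] at h0
      change x + t • w ∈ W
      rw [h0, zero_smul, add_zero]
      exact hx
    have hw0 : w ≠ 0 := fun h => hw (by rw [h]; exact W.zero_mem)
    have hdim : finrank ℝ W' + c = finrank ℝ V := by
      have := Submodule.finrank_sup_add_finrank_inf_eq W (Submodule.span ℝ {w})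
      have h0 : W ⊓ Submodule.span ℝ {w} = ⊥ :=
        ((Submodule.disjoint_span_singleton' hw0).2 hw).eq_bot
      rw [h0, finrank_bot, finrank_span_singleton hw0, ← hW'] at this
      omega
    have hι : ℓ ∘ₗ W'.subtype ≠ 0 := fun h => hℓw (LinearMap.congr_fun h
      ⟨w, Submodule.mem_sup_right (Submodule.mem_span_singleton_self w)⟩)
    exact PdLE.right (Pol.exact_resLinear hle hker)
      (mul_right_injective₀ (Pol.ι_ne_zero hι)) (Pol.resLinear_surjective hle) (ih W' hdim)
      ((ih W' hdim).mono (Nat.le_succ c))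

-- Cut `U` by one form vanishing on `W` at a time. Such a form is a nonzerodivisor on `Pol U`, and
-- the quotient is `Pol` of the hyperplane section.
open RingTheory.Sequence Pointwise in
theorem Pol.exists_isWeaklyRegular (W : Submodule ℝ V) (c : ℕ) : ∀ U : Submodule ℝ V, W ≤ U →
    finrank ℝ W + c = finrank ℝ U → ∃ ls : List (Dual ℝ V), ls.length = c ∧
      (∀ ℓ ∈ ls, ∀ v ∈ W, ℓ v = 0) ∧ IsWeaklyRegular (Pol U) (ls.map (SymmetricAlgebra.ι ℝ _)) := by
  induction c with
  | zero => exact fun U _ _ => ⟨[], rfl, by simp, by simp⟩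
  | succ c ih =>
    intro U hU hd
    have hlt : W < U := lt_of_le_of_ne hU (by rintro rfl; omega)
    obtain ⟨w, hwU, hw⟩ := SetLike.exists_of_lt hlt
    obtain ⟨ℓ, hℓw, hℓ⟩ := exists_form_of_notMem W hw
    set U' : Submodule ℝ V := U ⊓ LinearMap.ker ℓ with hU'
    have hle : U' ≤ U := inf_le_left
    have hker : ∀ v : U, (ℓ ∘ₗ U.subtype) v = 0 ↔ (v : V) ∈ U' :=
      fun v => ⟨fun h => ⟨v.2, h⟩, fun h => h.2⟩
    have hι : ℓ ∘ₗ U.subtype ≠ 0 := fun h => hℓw (LinearMap.congr_fun h ⟨w, hwU⟩)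
    have hd' : finrank ℝ W + c = finrank ℝ U' := by
      have h1 := Module.Dual.finrank_ker_add_one_of_ne_zero hι
      have h2 : finrank ℝ (LinearMap.ker (ℓ ∘ₗ U.subtype)) = finrank ℝ U' := by
        have : LinearMap.ker (ℓ ∘ₗ U.subtype) = U'.comap U.subtype := by
          ext v
          exact hker v
        rw [this]
        exact (Submodule.comapSubtypeEquivOfLe hle).finrank_eq
      omega
    obtain ⟨ls, h1, h2, h3⟩ := ih U' (le_inf hU fun v hv => hℓ v hv) hd'
    refine ⟨ℓ :: ls, by simp [h1], by
      intro m hm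
      rcases List.mem_cons.1 hm with rfl | hm
      exacts [hℓ, h2 m hm], ?_⟩
    rw [List.map_cons, isWeaklyRegular_cons_iff]
    have hsm : ∀ a : Pol U, SymmetricAlgebra.ι ℝ _ ℓ • a =
        SymmetricAlgebra.ι ℝ _ (ℓ ∘ₗ U.subtype) * a := fun a => by
      rw [Pol.smul_def, Pol.comap_ι]
    refine ⟨fun a b hab => mul_right_injective₀ (Pol.ι_ne_zero hι) ?_, ?_⟩
    · simpa only [hsm] using hab
    · have hk : LinearMap.ker (Pol.resLinear hle) =
          (SymmetricAlgebra.ι ℝ _ ℓ : Pol V) • (⊤ : Submodule (Pol V) (Pol U)) := by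
        ext a
        rw [LinearMap.mem_ker, Pol.exact_resLinear hle hker a,
          Submodule.mem_smul_pointwise_iff_exists]
        exact ⟨fun ⟨b, hb⟩ => ⟨b, trivial, (hsm b).trans hb⟩,
          fun ⟨b, _, hb⟩ => ⟨b, (hsm b).symm.trans hb⟩⟩
      let e : QuotSMulTop (SymmetricAlgebra.ι ℝ _ ℓ : Pol V) (Pol U) ≃ₗ[Pol V] Pol U' :=
        (Submodule.quotEquivOfEq _ _ hk.symm).trans
          ((Pol.resLinear hle).quotKerEquivOfSurjective (Pol.resLinear_surjective hle))
      exact (e.isWeaklyRegular_congr _).2 h3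

open RingTheory.Sequence in
/-- The linear forms that vanish on `W` contain a regular sequence of length `codim W`. -/
theorem Pol.exists_isRegular (W : Submodule ℝ V) {c : ℕ} (hc : finrank ℝ W + c = finrank ℝ V) :
    ∃ ls : List (Dual ℝ V), ls.length = c ∧ (∀ ℓ ∈ ls, ∀ v ∈ W, ℓ v = 0) ∧
      IsRegular (Pol V) (ls.map (SymmetricAlgebra.ι ℝ _)) := by
  obtain ⟨ls, h1, h2, h3⟩ := Pol.exists_isWeaklyRegular W c ⊤ le_top (by rwa [finrank_top])
  refine ⟨ls, h1, h2, ((Pol.topEquiv V).isWeaklyRegular_congr _).2 h3, fun htop => ?_⟩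
  -- The generated ideal is proper since its elements vanish at the origin.
  have hle : Ideal.ofList (ls.map (SymmetricAlgebra.ι ℝ (Dual ℝ V))) ≤ Pol.maxIdeal V := by
    refine Ideal.span_le.2 fun a ha => ?_
    obtain ⟨ℓ, -, rfl⟩ := List.mem_map.1 ha
    exact Ideal.subset_span ⟨ℓ, rfl⟩
  have h4 : (1 : Pol V) ∈ Pol.maxIdeal V := by
    have : (1 : Pol V) ∈ Ideal.ofList (ls.map (SymmetricAlgebra.ι ℝ (Dual ℝ V))) •
        (⊤ : Submodule (Pol V) (Pol V)) := htop ▸ trivial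
    rw [smul_eq_mul, Ideal.mul_top] at this
    exact hle this
  have h5 := Pol.maxIdeal_le_ker h4
  rw [RingHom.mem_ker, map_one] at h5
  exact one_ne_zero h5

end Pol

/-! ### Graded modules -/

section Graded

open Module

variable {V : Type u} [AddCommGroup V] [Module ℝ V]

/-- A `ℤ`-grading of a module over the polynomial functions, given by the projections to the
homogeneous parts. Linear forms have degree `2`. -/
structure ProjGrading (V : Type u) [AddCommGroup V] [Module ℝ V] (M : Type*) [AddCommGroup M]
    [Module (Pol V) M] where
  p : ℤ → M →+ M
  p_p_self : ∀ j x, p j (p j x) = p j x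
  p_p_ne : ∀ i j x, i ≠ j → p i (p j x) = 0
  finite : ∀ x, ∃ s : Finset ℤ, x = ∑ j ∈ s, p j x
  p_ι : ∀ j (ℓ : Dual ℝ V) x,
    p j (SymmetricAlgebra.ι ℝ _ ℓ • x) = SymmetricAlgebra.ι ℝ _ ℓ • p (j - 2) x
  p_smul : ∀ j (c : ℝ) x, p j (algebraMap ℝ (Pol V) c • x) = algebraMap ℝ (Pol V) c • p j x

namespace ProjGrading

variable {M : Type*} [AddCommGroup M] [Module (Pol V) M] (g : ProjGrading V M)

/-- Generators have finitely many components, and polynomials have no parts of negative degree. -/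
theorem exists_forall_lt [Module.Finite (Pol V) M] : ∃ j₀, ∀ j < j₀, ∀ x, g.p j x = 0 := by
  obtain ⟨S, hS⟩ := Module.Finite.fg_top (R := Pol V) (M := M)
  have hx : ∀ x, ∃ j₀, ∀ j < j₀, g.p j x = 0 := by
    intro x
    obtain ⟨s, hs⟩ := g.finite x
    obtain ⟨j₀, hj₀⟩ := s.finite_toSet.bddBelow
    refine ⟨j₀, fun j hj => ?_⟩
    rw [hs, map_sum]
    exact Finset.sum_eq_zero fun i hi => g.p_p_ne j i x (by
      rintro rfl
      exact absurd (hj₀ hi) (not_le.2 hj))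
  choose d hd using hx
  obtain ⟨j₀, hj₀⟩ := (S.finite_toSet.image d).bddBelow
  refine ⟨j₀, fun j hj x => ?_⟩
  have hmem : x ∈ Submodule.span (Pol V) (S : Set M) := hS ▸ trivial
  revert j
  induction hmem using Submodule.span_induction with
  | mem x hx => exact fun j hj => hd x j (hj.trans_le (hj₀ ⟨x, hx, rfl⟩))
  | zero => exact fun j _ => map_zero _
  | add x y _ _ hx hy => exact fun j hj => by rw [map_add, hx j hj, hy j hj, add_zero]
  | smul a x _ hx =>
    induction a using SymmetricAlgebra.induction generalizing x with
    | algebraMap c => exact fun j hj => by rw [g.p_smul, hx j hj, smul_zero]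
    | ι ℓ => exact fun j hj => by rw [g.p_ι, hx (j - 2) (by omega), smul_zero]
    | mul a b ha hb =>
      rw [mul_smul]
      exact ha _ (Submodule.smul_mem _ _ ‹_›) (hb _ ‹_› hx)
    | add a b ha hb =>
      exact fun j hj => by rw [add_smul, map_add, ha _ ‹_› hx j hj, hb _ ‹_› hx j hj, add_zero]

/-- Nakayama's lemma for homogeneous submodules. -/
theorem eq_top_of_sup_eq_top [Module.Finite (Pol V) M] {N : Submodule (Pol V) M}
    (hN : ∀ x ∈ N, ∀ j, g.p j x ∈ N)
    (h : ⊤ ≤ N ⊔ Pol.maxIdeal V • (⊤ : Submodule (Pol V) M)) : N = ⊤ := by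
  obtain ⟨j₀, hj₀⟩ := g.exists_forall_lt
  -- Induction upwards from the lowest degree: a degree `j` component of `ℓ • w` comes from degree
  -- `j - 2`.
  have key : ∀ d : ℕ, ∀ j < j₀ + d, ∀ x, g.p j x ∈ N := by
    intro d
    induction d with
    | zero => exact fun j hj x => by rw [hj₀ j (by simpa using hj)]; exact N.zero_mem
    | succ d ih =>
      intro j hj x
      obtain ⟨y, hy, z, hz, rfl⟩ := Submodule.mem_sup.1 (h (Submodule.mem_top (x := x)))
      rw [map_add]
      refine N.add_mem (hN y hy j) ?_
      refine Submodule.smul_induction_on hz (fun a ha w _ => ?_) fun w w' hw hw' => by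
        rw [map_add]
        exact N.add_mem hw hw'
      clear hz
      induction ha using Submodule.span_induction generalizing w with
      | mem a ha =>
        obtain ⟨ℓ, rfl⟩ := ha
        rw [g.p_ι]
        exact N.smul_mem _ (ih _ (by push_cast at hj; omega) _)
      | zero => rw [zero_smul, map_zero]; exact N.zero_mem
      | add a b _ _ ha hb => rw [add_smul, map_add]; exact N.add_mem (ha _ trivial) (hb _ trivial)
      | smul b a _ ha => rw [smul_eq_mul, mul_comm, mul_smul]; exact ha _ trivial
  refine eq_top_iff.2 fun x _ => ?_
  obtain ⟨s, hs⟩ := g.finite x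
  rw [hs]
  exact N.sum_mem fun j _ => key (j + 1 - j₀).toNat j (by omega) x

theorem span_homogeneous {ι : Type*} {x : ι → M} {d : ι → ℤ} (hx : ∀ i, g.p (d i) (x i) = x i) :
    ∀ y ∈ Submodule.span (Pol V) (Set.range x), ∀ j,
      g.p j y ∈ Submodule.span (Pol V) (Set.range x) := by
  intro y hy
  induction hy using Submodule.span_induction with
  | mem y hy =>
    obtain ⟨i, rfl⟩ := hy
    intro j
    by_cases hj : j = d i
    · rw [hj, hx]
      exact Submodule.subset_span ⟨i, rfl⟩
    · rw [← hx, g.p_p_ne _ _ _ hj]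
      exact Submodule.zero_mem _
  | zero => exact fun j => by rw [map_zero]; exact Submodule.zero_mem _
  | add y z _ _ hy hz => exact fun j => by rw [map_add]; exact Submodule.add_mem _ (hy j) (hz j)
  | smul a y hy ha =>
    induction a using SymmetricAlgebra.induction generalizing y with
    | algebraMap c => exact fun j => by rw [g.p_smul]; exact Submodule.smul_mem _ _ (ha j)
    | ι ℓ => exact fun j => by rw [g.p_ι]; exact Submodule.smul_mem _ _ (ha _)
    | mul a b hha hhb =>
      rw [mul_smul]
      exact hha _ (Submodule.smul_mem _ _ hy) (hhb _ hy ha)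
    | add a b hha hhb =>
      exact fun j => by
        rw [add_smul, map_add]
        exact Submodule.add_mem _ (hha _ hy ha j) (hhb _ hy ha j)

theorem exists_homogeneous_generators [Module.Finite (Pol V) M] :
    ∃ (b : ℕ) (x : Fin b → M) (d : Fin b → ℤ), (∀ i, g.p (d i) (x i) = x i) ∧
      Submodule.span (Pol V) (Set.range x) = ⊤ := by
  classical
  obtain ⟨S, hS⟩ := Module.Finite.fg_top (R := Pol V) (M := M)
  choose s hs using g.finite
  let T := S.sigma fun x => s x
  let e := T.equivFin.symm
  refine ⟨T.card, fun i => g.p (e i).1.2 (e i).1.1, fun i => (e i).1.2, fun i => g.p_p_self _ _, ?_⟩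
  rw [eq_top_iff, ← hS]
  refine Submodule.span_le.2 fun x hx => ?_
  rw [hs x]
  refine Submodule.sum_mem _ fun j hj => Submodule.subset_span ?_
  exact ⟨e.symm ⟨⟨x, j⟩, Finset.mem_sigma.2 ⟨hx, hj⟩⟩, by simp⟩

/-- A finitely generated graded projective module is free. -/
theorem free_of_projective {M : Type*} [AddCommGroup M] [Module (Pol V) M] (g : ProjGrading V M)
    [FiniteDimensional ℝ V] [Module.Finite (Pol V) M]
    [Module.Projective (Pol V) M] : Module.Free (Pol V) M := by
  classical
  have hex := g.exists_homogeneous_generators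
  -- Homogeneous generators are taken with `b` minimal; they will form a basis.
  obtain ⟨b, ⟨x, d, hx, hspan⟩, hb⟩ : ∃ b, (∃ (x : Fin b → M) (d : Fin b → ℤ),
      (∀ i, g.p (d i) (x i) = x i) ∧ Submodule.span (Pol V) (Set.range x) = ⊤) ∧
      ∀ b' < b, ¬ ∃ (x : Fin b' → M) (d : Fin b' → ℤ),
        (∀ i, g.p (d i) (x i) = x i) ∧ Submodule.span (Pol V) (Set.range x) = ⊤ :=
    ⟨Nat.find hex, Nat.find_spec hex, fun _ h => Nat.find_min hex h⟩
  -- A coefficient with nonzero constant term would put that generator into the span of the others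
  -- modulo `𝔪M`; graded Nakayama would then make it superfluous.
  have hmin : ∀ i : Fin b, ∀ a : Fin b → Pol V, ∑ j, a j • x j = 0 → a i ∈ Pol.maxIdeal V := by
    intro i a ha
    by_contra hai
    have hc : Pol.eval (0 : V) (a i) ≠ 0 := fun h => hai (by
      have := Pol.sub_eval_mem (a i)
      rwa [h, map_zero, sub_zero] at this)
    cases b with
    | zero => exact i.elim0
    | succ b' =>
    refine hb b' (Nat.lt_succ_self b') ?_
    let f : Fin b' → Fin (b' + 1) := i.succAbove
    have hf : ∀ j, j ≠ i → ∃ k, f k = j := fun j hj => Fin.exists_succAbove_eq hj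
    refine ⟨x ∘ f, d ∘ f, fun j => hx _, ?_⟩
    refine g.eq_top_of_sup_eq_top (g.span_homogeneous (d := d ∘ f) fun j => hx _) ?_
    refine hspan.symm.le.trans (Submodule.span_le.2 ?_)
    rintro _ ⟨j, rfl⟩
    have hother : ∀ j, j ≠ i → x j ∈ Submodule.span (Pol V) (Set.range (x ∘ f)) := by
      intro j hj
      obtain ⟨k, hk⟩ := hf j hj
      exact Submodule.subset_span ⟨k, congrArg x hk⟩
    by_cases hj : j = i
    swap
    · exact Submodule.mem_sup_left (hother j hj)
    rw [hj]
    rw [← Finset.add_sum_erase _ _ (Finset.mem_univ i)] at ha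
    have e1 : algebraMap ℝ (Pol V) (Pol.eval (0 : V) (a i)) • x i =
        (-∑ j ∈ Finset.univ.erase i, a j • x j) +
          -((a i - algebraMap ℝ (Pol V) (Pol.eval (0 : V) (a i))) • x i) := by
      rw [sub_smul, ← eq_neg_of_add_eq_zero_left ha]
      abel
    have e2 : algebraMap ℝ (Pol V) (Pol.eval (0 : V) (a i)) • x i ∈
        Submodule.span (Pol V) (Set.range (x ∘ f)) ⊔
          Pol.maxIdeal V • (⊤ : Submodule (Pol V) M) := by
      rw [e1]
      refine Submodule.add_mem_sup (Submodule.neg_mem _ (Submodule.sum_mem _ fun j hj =>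
        Submodule.smul_mem _ _ (hother j (by simpa using hj)))) (Submodule.neg_mem _
          (Submodule.smul_mem_smul (Pol.sub_eval_mem _) trivial))
    have e3 := Submodule.smul_mem _ (algebraMap ℝ (Pol V) (Pol.eval (0 : V) (a i))⁻¹) e2
    rwa [smul_smul, ← map_mul, inv_mul_cancel₀ hc, map_one, one_smul] at e3
  let φ : (Fin b → Pol V) →ₗ[Pol V] M := Fintype.linearCombination (Pol V) x
  have hφ : Function.Surjective φ := by
    rw [← LinearMap.range_eq_top, Fintype.range_linearCombination, hspan]
  obtain ⟨s, hs⟩ := Module.projective_lifting_property φ LinearMap.id hφ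
  let K := LinearMap.ker φ
  -- The kernel lies in `𝔪` times the free module by minimality, and it is a direct summand by
  -- projectivity; project onto it.
  have hK : K ≤ Pol.maxIdeal V • K := by
    intro k hk
    have h1 : k ∈ Pol.maxIdeal V • (⊤ : Submodule (Pol V) (Fin b → Pol V)) := by
      rw [← Finset.univ_sum_single k]
      refine Submodule.sum_mem _ fun i _ => ?_
      have : Pi.single i (k i) = k i • (Pi.single i 1 : Fin b → Pol V) := by
        rw [← Pi.single_smul, smul_eq_mul, mul_one]
      rw [this]
      exact Submodule.smul_mem_smul (hmin i k hk) trivial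
    let π : (Fin b → Pol V) →ₗ[Pol V] (Fin b → Pol V) := LinearMap.id - s ∘ₗ φ
    have h2 : π k = k := by
      change k - s (φ k) = k
      rw [LinearMap.mem_ker.1 hk, map_zero, sub_zero]
    have h3 : (⊤ : Submodule (Pol V) (Fin b → Pol V)).map π ≤ K := by
      rintro _ ⟨y, -, rfl⟩
      change φ (y - s (φ y)) = 0
      rw [map_sub, sub_eq_zero]
      exact (LinearMap.congr_fun hs (φ y)).symm
    have h4 := Submodule.mem_map_of_mem (f := π) h1
    rw [h2, Submodule.map_smul''] at h4
    exact Submodule.smul_mono le_rfl h3 h4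
  -- Ordinary Nakayama suffices here: the kernel is killed by some `r ≡ 1` modulo `𝔪`, and a nonzero
  -- polynomial kills nothing in a free module.
  obtain ⟨r, hr, hr'⟩ := Submodule.exists_sub_one_mem_and_smul_eq_zero_of_fg_of_le_smul
    (Pol.maxIdeal V) K (IsNoetherian.noetherian K) hK
  have hr0 : r ≠ 0 := by
    rintro rfl
    have := Pol.maxIdeal_le_ker hr
    rw [RingHom.mem_ker, zero_sub, map_neg, map_one] at this
    norm_num at this
  have hinj : Function.Injective φ := by
    rw [← LinearMap.ker_eq_bot, eq_bot_iff]
    intro k hk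
    exact (smul_eq_zero.1 (hr' k hk)).resolve_left hr0
  exact Module.Free.of_equiv (LinearEquiv.ofBijective φ ⟨hinj, hφ⟩)

end ProjGrading

end Graded

/-! ### Minimal extension sheaves -/

section MinimalExtension

open Module

variable {V : Type u} [AddCommGroup V] [Module ℝ V] {Δ : Finset (PointedCone ℝ V)}

theorem Pol.ι_mem_deg {M : Type*} [AddCommGroup M] [Module ℝ M] (ℓ : Dual ℝ M) :
    SymmetricAlgebra.ι ℝ _ ℓ ∈ Pol.deg M 2 := by
  refine (le_iSup₂_of_le (f := fun (q : ℕ) (_ : (2 : ℤ) = 2 * (q : ℤ)) =>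
    (LinearMap.range (SymmetricAlgebra.ι ℝ (Dual ℝ M))) ^ q) 1 (by norm_num) le_rfl) ?_
  rw [pow_one]
  exact ⟨ℓ, rfl⟩

theorem Pol.algebraMap_mem_deg {M : Type*} [AddCommGroup M] [Module ℝ M] (c : ℝ) :
    algebraMap ℝ (Pol M) c ∈ Pol.deg M 0 := by
  refine (le_iSup₂_of_le (f := fun (q : ℕ) (_ : (0 : ℤ) = 2 * (q : ℤ)) =>
    (LinearMap.range (SymmetricAlgebra.ι ℝ (Dual ℝ M))) ^ q) 0 (by norm_num) le_rfl) ?_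
  rw [pow_zero]
  exact Submodule.algebraMap_mem c

theorem Pol.eval_comap {M N : Type*} [AddCommGroup M] [Module ℝ M] [AddCommGroup N] [Module ℝ N]
    (f : M →ₗ[ℝ] N) (v : M) (a : Pol N) : Pol.eval v (Pol.comap f a) = Pol.eval (f v) a := by
  have : (Pol.eval v).comp (Pol.comap f) = Pol.eval (f v) := by
    apply SymmetricAlgebra.algHom_ext
    ext x
    simp [Pol.eval_ι]
  exact DFunLike.congr_fun this a

namespace GradedSheaf

variable (E : GradedSheaf.{u, w} Δ)

/-- The projection of `E(σ)` onto the homogeneous part of degree `j`. -/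
def proj (σ : Δ) (j : ℤ) : E.obj σ →+ E.obj σ :=
  letI := (E.isInternal σ).chooseDecomposition
  { toFun := fun x => (DirectSum.decompose (E.gr σ) x j : E.obj σ)
    map_zero' := by simp
    map_add' := fun x y => by simp }

theorem proj_mem (σ : Δ) (j : ℤ) (x : E.obj σ) : E.proj σ j x ∈ E.gr σ j := Subtype.property _

theorem proj_of_mem {σ : Δ} {j : ℤ} {x : E.obj σ} (hx : x ∈ E.gr σ j) : E.proj σ j x = x :=
  letI := (E.isInternal σ).chooseDecomposition
  DirectSum.decompose_of_mem_same _ hx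

theorem proj_of_mem_ne {σ : Δ} {i j : ℤ} {x : E.obj σ} (hx : x ∈ E.gr σ i) (hij : i ≠ j) :
    E.proj σ j x = 0 :=
  letI := (E.isInternal σ).chooseDecomposition
  DirectSum.decompose_of_mem_ne _ hx hij

theorem exists_eq_sum_proj (σ : Δ) (x : E.obj σ) : ∃ s : Finset ℤ, x = ∑ j ∈ s, E.proj σ j x := by
  classical
  let _ := (E.isInternal σ).chooseDecomposition
  exact ⟨_, (DirectSum.sum_support_decompose (E.gr σ) x).symm⟩

theorem eq_sum_proj_of_subset {σ : Δ} {x : E.obj σ} {s t : Finset ℤ}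
    (hs : x = ∑ j ∈ s, E.proj σ j x) (hst : s ⊆ t) : x = ∑ j ∈ t, E.proj σ j x := by
  refine hs.trans (Finset.sum_subset hst fun j _ hj => ?_)
  rw [hs, map_sum]
  exact Finset.sum_eq_zero fun i hi => E.proj_of_mem_ne (E.proj_mem σ i x) (by
    rintro rfl
    exact hj hi)

theorem homogeneous_induction {σ : Δ} {P : E.obj σ → Prop} (hadd : ∀ x y, P x → P y → P (x + y))
    (hzero : P 0) (hmem : ∀ j, ∀ x ∈ E.gr σ j, P x) (x : E.obj σ) : P x := by
  obtain ⟨s, hs⟩ := E.exists_eq_sum_proj σ x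
  rw [hs]
  exact Finset.sum_induction _ P hadd hzero fun j _ => hmem j _ (E.proj_mem σ j x)

theorem proj_smul {σ : Δ} {i : ℤ} {a : Pol (lspan σ.1)} (ha : a ∈ Pol.deg _ i) (j : ℤ)
    (x : E.obj σ) : E.proj σ j (a • x) = a • E.proj σ (j - i) x := by
  induction x using E.homogeneous_induction with
  | hadd x y hx hy => rw [smul_add, map_add, hx, hy, map_add, smul_add]
  | hzero => rw [smul_zero, map_zero, map_zero, smul_zero]
  | hmem k x hx =>
    have h1 := E.smul_mem σ i k a x ha hx
    by_cases hk : k = j - i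
    · subst hk
      rw [E.proj_of_mem hx]
      exact E.proj_of_mem (by simpa using h1)
    · rw [E.proj_of_mem_ne hx hk, smul_zero]
      exact E.proj_of_mem_ne h1 (by omega)

theorem res_proj {σ τ : Δ} (h : τ.1 ≤ σ.1) (j : ℤ) (x : E.obj σ) :
    E.res h (E.proj σ j x) = E.proj τ j (E.res h x) := by
  induction x using E.homogeneous_induction with
  | hadd x y hx hy => simp only [map_add, hx, hy]
  | hzero => simp only [map_zero]
  | hmem k x hx =>
    by_cases hk : k = j
    · subst hk
      rw [E.proj_of_mem hx, E.proj_of_mem (E.res_mem h k x hx)]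
    · rw [E.proj_of_mem_ne hx hk, map_zero, E.proj_of_mem_ne (E.res_mem h k x hx) hk]

instance (σ : Δ) : Module (Pol (lspan σ.1)) (E.toFanSheaf.obj σ) := E.module σ

instance (σ : Δ) : IsScalarTower (Pol V) (Pol (lspan σ.1)) (E.toFanSheaf.obj σ) :=
  ⟨fun a b x => mul_smul (α := Pol (lspan σ.1)) (β := E.obj σ) (polToCone V σ.1 a) b x⟩

theorem smul_toFanSheaf {σ : Δ} (a : Pol V) (x : E.toFanSheaf.obj σ) :
    a • x = polToCone V σ.1 a • x := rfl

/-- The algebra `A` acts through `A_σ`. These forms are the annihilators needed in the depth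
argument. -/
theorem ι_smul_eq_zero {σ : Δ} {ℓ : Dual ℝ V} (hℓ : ∀ v ∈ lspan σ.1, ℓ v = 0)
    (x : E.toFanSheaf.obj σ) : SymmetricAlgebra.ι ℝ _ ℓ • x = 0 := by
  have : ℓ ∘ₗ (lspan σ.1).subtype = 0 := LinearMap.ext fun v => hℓ v.1 v.2
  rw [smul_toFanSheaf, polToCone, Pol.comap_ι, this, map_zero, zero_smul]

/-- The projection of `E(σ)`, as a module over `A`, onto the homogeneous part of degree `j`. -/
def coneProj (σ : Δ) (j : ℤ) : E.toFanSheaf.obj σ →+ E.toFanSheaf.obj σ := E.proj σ j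

theorem coneProj_ι_smul {σ : Δ} (j : ℤ) (ℓ : Dual ℝ V) (x : E.toFanSheaf.obj σ) :
    E.coneProj σ j (SymmetricAlgebra.ι ℝ _ ℓ • x) =
      SymmetricAlgebra.ι ℝ _ ℓ • E.coneProj σ (j - 2) x := by
  rw [smul_toFanSheaf, smul_toFanSheaf, polToCone, Pol.comap_ι]
  exact E.proj_smul (Pol.ι_mem_deg _) j x

theorem coneProj_algebraMap_smul {σ : Δ} (j : ℤ) (c : ℝ) (x : E.toFanSheaf.obj σ) :
    E.coneProj σ j (algebraMap ℝ (Pol V) c • x) =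
      algebraMap ℝ (Pol V) c • E.coneProj σ j x := by
  rw [smul_toFanSheaf, smul_toFanSheaf, AlgHom.commutes]
  refine (E.proj_smul (Pol.algebraMap_mem_deg c) j x).trans ?_
  rw [sub_zero]
  rfl

theorem res_coneProj {σ τ : Δ} (h : τ.1 ≤ σ.1) (j : ℤ) (x : E.toFanSheaf.obj σ) :
    E.toFanSheaf.res h (E.coneProj σ j x) = E.coneProj τ j (E.toFanSheaf.res h x) :=
  E.res_proj h j x

/-- The grading of the module of sections over a subfan. -/
def sectionsGrading (Λ : Set Δ) : ProjGrading V (E.toFanSheaf.sections Λ) where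
  p j :=
    { toFun := fun f => ⟨fun σ => E.coneProj σ.1 j (f.1 σ), fun σ τ h => by
        exact (E.res_coneProj h j _).trans (congrArg _ (f.2 σ τ h))⟩
      map_zero' := Subtype.ext (funext fun σ => map_zero (E.coneProj σ.1 j))
      map_add' := fun f g => Subtype.ext (funext fun σ => map_add (E.coneProj σ.1 j) _ _) }
  p_p_self j f := Subtype.ext (funext fun σ => E.proj_of_mem (E.proj_mem _ _ _))
  p_p_ne i j f h := Subtype.ext (funext fun σ => E.proj_of_mem_ne (E.proj_mem _ _ _) h.symm)
  finite f := by
    classical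
    choose s hs using fun σ : Λ => E.exists_eq_sum_proj σ.1 (f.1 σ)
    have : Fintype Λ := Fintype.ofFinite _
    refine ⟨Finset.univ.biUnion s, Subtype.ext (funext fun σ => ?_)⟩
    refine (E.eq_sum_proj_of_subset (hs σ)
      (Finset.subset_biUnion_of_mem s (Finset.mem_univ σ))).trans ?_
    rw [AddSubmonoidClass.coe_finsetSum, Finset.sum_apply]
    rfl
  p_ι j ℓ f := Subtype.ext (funext fun σ => E.coneProj_ι_smul j ℓ _)
  p_smul j c f := Subtype.ext (funext fun σ => E.coneProj_algebraMap_smul j c _)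

variable {E}

theorem finite_sections [FiniteDimensional ℝ V] {Λ : Set Δ}
    (h : ∀ σ ∈ Λ, Module.Finite (Pol V) (E.toFanSheaf.obj σ)) :
    Module.Finite (Pol V) (E.toFanSheaf.sections Λ) := by
  have h1 : ∀ σ : Λ, IsNoetherian (Pol V) (E.toFanSheaf.obj σ.1) := fun σ =>
    have := h σ.1 σ.2
    inferInstance
  infer_instance

instance [FiniteDimensional ℝ V] (W : Submodule ℝ V) : Module.Finite (Pol V) (Pol W) :=
  Module.Finite.of_surjective (Algebra.linearMap (Pol V) (Pol W))
    (Pol.comap_surjective Subtype.val_injective)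

/-- The residue class module of a free module over the polynomial functions on a subspace determines
the rank. -/
theorem finite_basis_of_le_sup [FiniteDimensional ℝ V] {σ : Δ} {ι : Type*} {n : ℕ}
    (b : Basis ι (Pol (lspan σ.1)) (E.toFanSheaf.obj σ))
    (f : (Fin n → Pol V) →ₗ[Pol V] E.toFanSheaf.obj σ)
    (hf : ∀ x, ∃ a, x - f a ∈ Pol.maxIdeal V • (⊤ : Submodule (Pol V) (E.toFanSheaf.obj σ))) :
    Finite ι := by
  classical
  -- A basis index outside these supports has a coordinate vanishing on the image of `f` and taking
  -- values in the maximal ideal on `𝔪E(σ)`, yet equal to `1` on its own basis vector.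
  let J : Finset ι := Finset.univ.biUnion fun j : Fin n => (b.repr (f (Pi.single j 1))).support
  refine Set.finite_univ_iff.1 (J.finite_toSet.subset fun i _ => ?_)
  by_contra hi
  let c : E.toFanSheaf.obj σ →ₗ[Pol V] Pol (lspan σ.1) := (b.coord i).restrictScalars (Pol V)
  have hc : c ∘ₗ f = 0 := by
    refine LinearMap.pi_ext' fun j => LinearMap.ext_ring ?_
    change b.repr (f (Pi.single j 1)) i = 0
    by_contra h
    exact hi (Finset.mem_coe.2 (Finset.mem_biUnion.2 ⟨j, Finset.mem_univ _,
      Finsupp.mem_support_iff.2 h⟩))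
  have hm : ∀ x ∈ Pol.maxIdeal V • (⊤ : Submodule (Pol V) (E.toFanSheaf.obj σ)),
      Pol.eval (0 : lspan σ.1) (c x) = 0 := by
    intro x hx
    refine Submodule.smul_induction_on hx (fun a ha y _ => ?_) fun x y hx hy => by
      rw [map_add, map_add, hx, hy, add_zero]
    rw [map_smul, Pol.smul_def, map_mul, Pol.eval_comap, map_zero,
      RingHom.mem_ker.1 (Pol.maxIdeal_le_ker ha), zero_mul]
  obtain ⟨a, ha⟩ := hf (b i)
  have h1 := hm _ ha
  have h2 : c (f a) = 0 := LinearMap.congr_fun hc a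
  have h3 : c (b i) = 1 := by
    change b.repr (b i) i = 1
    simp
  rw [map_sub, h2, sub_zero, h3, map_one] at h1
  exact one_ne_zero h1

namespace IsMinimalExtension

variable [FiniteDimensional ℝ V] (hE : E.IsMinimalExtension)

theorem free_toFanSheaf (hE : E.IsMinimalExtension) (σ : Δ) :
    Module.Free (Pol (lspan σ.1)) (E.toFanSheaf.obj σ) := hE.free σ

/-- By induction, `E(∂σ)` is finitely generated, so the residue module of `E(σ)` is too. For a free
module this bounds the rank. -/
theorem finite_cone (hE : E.IsMinimalExtension) (σ : Δ) :
    Module.Finite (Pol (lspan σ.1)) (E.toFanSheaf.obj σ) := by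
  induction σ using WellFoundedLT.induction with
  | ind σ ih =>
    by_cases hσ : σ.1 = ⊥
    · obtain ⟨e, -⟩ := hE.normalization σ hσ
      exact Module.Finite.equiv (M := Pol (lspan σ.1)) (N := E.obj σ) e.symm
    · have hfin : Module.Finite (Pol V)
          (E.toFanSheaf.sections (FanSheaf.properFaces σ)) := finite_sections fun τ hτ => by
        have := ih τ (lt_of_le_of_ne hτ.1 hτ.2)
        exact Module.Finite.trans (Pol (lspan τ.1)) _
      have hres : Module.Finite (Pol V) (Residue V (E.toFanSheaf.obj σ)) :=
        Module.Finite.equiv (LinearEquiv.ofBijective _ (hE.lme σ hσ)).symm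
      obtain ⟨n, f, hf⟩ := Module.Finite.exists_fin' (Pol V) (Residue V (E.toFanSheaf.obj σ))
      obtain ⟨f', hf'⟩ := Module.projective_lifting_property (Submodule.mkQ _) f
        (Submodule.mkQ_surjective _)
      have := hE.free_toFanSheaf σ
      have hι := finite_basis_of_le_sup
        (Module.Free.chooseBasis (Pol (lspan σ.1)) (E.toFanSheaf.obj σ)) f' fun x => by
          obtain ⟨a, ha⟩ := hf (Submodule.mkQ _ x)
          refine ⟨a, (Submodule.Quotient.eq _).1 ?_⟩
          exact ha.symm.trans (LinearMap.congr_fun hf' a).symm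
      exact Module.Finite.of_basis (Module.Free.chooseBasis (Pol (lspan σ.1)) (E.toFanSheaf.obj σ))

theorem finite (hE : E.IsMinimalExtension) (σ : Δ) :
    Module.Finite (Pol V) (E.toFanSheaf.obj σ) :=
  have := hE.finite_cone σ
  Module.Finite.trans (Pol (lspan σ.1)) _

theorem pdLE (hE : E.IsMinimalExtension) (σ : Δ) {c : ℕ} (hc : cdim σ.1 + c = finrank ℝ V) :
    PdLE (Pol V) (E.toFanSheaf.obj σ) c := by
  have := hE.finite_cone σ
  have := hE.free_toFanSheaf σ
  let b := Module.Free.chooseBasis (Pol (lspan σ.1)) (E.toFanSheaf.obj σ)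
  exact PdLE.of_equiv (b.equivFun.restrictScalars (Pol V)).symm
    (PdLE.pi _ fun _ => Pol.pdLE c _ hc)

/-- Minimal extension sheaves are flabby. -/
theorem resBoundary_surjective (hE : E.IsMinimalExtension) (σ : Δ) :
    Function.Surjective (E.toFanSheaf.resBoundary σ) := by
  by_cases hσ : σ.1 = ⊥
  · intro f
    refine ⟨0, Subtype.ext (funext fun τ => ?_)⟩
    exact absurd (Subtype.ext (le_antisymm τ.2.1 (hσ ▸ bot_le))) τ.2.2
  · rw [← LinearMap.range_eq_top]
    have hfin : Module.Finite (Pol V) (E.toFanSheaf.sections (FanSheaf.properFaces σ)) :=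
      finite_sections fun τ _ => hE.finite τ
    -- The image is a homogeneous submodule that is everything modulo `𝔪`; graded Nakayama applies.
    refine (E.sectionsGrading _).eq_top_of_sup_eq_top ?_ ?_
    · rintro _ ⟨x, rfl⟩ j
      exact ⟨E.proj σ j x, Subtype.ext (funext fun τ => E.res_proj _ _ _)⟩
    · intro f _
      obtain ⟨q, hq⟩ := (hE.lme σ hσ).2 (Submodule.mkQ _ f)
      obtain ⟨x, rfl⟩ := Submodule.mkQ_surjective _ q
      have h1 := (Submodule.Quotient.eq _).1 hq.symm
      rw [← sub_add_cancel f (E.toFanSheaf.resBoundary σ x), add_comm]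
      exact Submodule.add_mem_sup ⟨x, rfl⟩ h1

theorem exists_locKer_bot (hE : E.IsMinimalExtension) (σ : Δ) (hσ : σ.1 = ⊥) :
    ∃ κ : E.toFanSheaf.LocKer σ, κ ≠ 0 := by
  obtain ⟨e, -⟩ := hE.normalization σ hσ
  obtain ⟨κ, hκ⟩ := FanSheaf.LocKer.exists_incl E.toFanSheaf (γ := σ) (x := e.symm 1)
    fun τ h hne => absurd (Subtype.ext (le_antisymm h (hσ ▸ bot_le))) hne
  refine ⟨κ, fun h0 => ?_⟩
  rw [h0, map_zero] at hκ
  have : e.symm 1 = 0 := hκ.symm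
  rw [LinearEquiv.map_eq_zero_iff] at this
  exact one_ne_zero this

/-- The star sheaf of the zero cone lives on every cone, and by normalization it is a retract of
`E`. -/
theorem exists_ne_zero (hE : E.IsMinimalExtension) (hΔ : IsFan Δ) (σ : Δ) :
    ∃ x : E.toFanSheaf.obj σ, x ≠ 0 := by
  obtain ⟨κ, hκ⟩ := hE.exists_locKer_bot ⟨⊥, hΔ.bot_mem⟩ rfl
  obtain ⟨p, hp⟩ := E.toFanSheaf.exists_starHom_leftInverse hE.resBoundary_surjective _ hκ
  refine ⟨(E.toFanSheaf.starHom hE.resBoundary_surjective _ κ).app σ (fun _ => 1), fun h => ?_⟩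
  have h1 := hp σ (fun _ => 1)
  rw [h, map_zero] at h1
  exact zero_ne_one (congrFun h1 ⟨bot_le⟩)

/-- Multiply a nonzero element by a product of linear forms on `V_σ`, one vanishing on each proper
face. The product restricts to zero on all of them, and freeness over a domain keeps the result
nonzero. -/
theorem exists_locKer_ne_zero (hE : E.IsMinimalExtension) (hΔ : IsFan Δ) (σ : Δ) :
    ∃ κ : E.toFanSheaf.LocKer σ, κ ≠ 0 := by
  classical
  obtain ⟨x, hx⟩ := hE.exists_ne_zero hΔ σ
  have hform : ∀ τ : FanSheaf.properFaces σ, ∃ ℓ : Dual ℝ (lspan σ.1), ℓ ≠ 0 ∧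
      ℓ ∘ₗ Submodule.inclusion (lspan_mono τ.2.1) = 0 := by
    intro τ
    have hlt := hΔ.cdim_lt τ.1.2 σ.2 τ.2.1 (fun h => τ.2.2 (Subtype.ext h))
    have hne : LinearMap.range (Submodule.inclusion (lspan_mono τ.2.1)) ≠ ⊤ := by
      intro h
      have h1 := LinearMap.finrank_range_of_inj (Submodule.inclusion_injective (lspan_mono τ.2.1))
      rw [h, finrank_top] at h1
      exact hlt.ne h1.symm
    obtain ⟨v, -, hv⟩ := SetLike.exists_of_lt (lt_top_iff_ne_top.2 hne)
    obtain ⟨ℓ, h1, h2⟩ := exists_form_of_notMem _ hv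
    exact ⟨ℓ, fun h => h1 (by rw [h]; rfl), LinearMap.ext fun u => h2 _ ⟨u, rfl⟩⟩
  choose ℓ hℓ0 hℓ using hform
  have : Fintype (FanSheaf.properFaces σ) := Fintype.ofFinite _
  let a : Pol (lspan σ.1) := ∏ τ, SymmetricAlgebra.ι ℝ _ (ℓ τ)
  have ha : a ≠ 0 := Finset.prod_ne_zero_iff.2 fun τ _ => Pol.ι_ne_zero (hℓ0 τ)
  have hres : ∀ (τ : Δ) (h : τ.1 ≤ σ.1), τ ≠ σ → polRes h a = 0 := by
    intro τ h hne
    rw [map_prod]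
    refine Finset.prod_eq_zero (Finset.mem_univ ⟨τ, h, hne⟩) ?_
    rw [polRes, Pol.comap_ι, hℓ ⟨τ, h, hne⟩, map_zero]
  obtain ⟨κ, hκ⟩ := FanSheaf.LocKer.exists_incl E.toFanSheaf (γ := σ) (x := a • x)
    fun τ h hne => by
      refine (E.res_smul h a x).trans ?_
      rw [hres τ h hne, zero_smul]
      rfl
  refine ⟨κ, fun h0 => ?_⟩
  rw [h0, map_zero] at hκ
  have := hE.free_toFanSheaf σ
  exact (smul_ne_zero ha hx) hκ.symm

theorem finite_cochain (hE : E.IsMinimalExtension) (Λ : Set (PointedCone ℝ V)) (k : ℕ) :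
    Module.Finite (Pol V) (E.toFanSheaf.Cochain Λ k) :=
  have := hE.finite
  Module.Finite.pi

theorem pdLE_cochain (hE : E.IsMinimalExtension) (Λ : Set (PointedCone ℝ V)) (k : ℕ) :
    PdLE (Pol V) (E.toFanSheaf.Cochain Λ k) k :=
  PdLE.pi _ fun σ => hE.pdLE σ.1 σ.2.2

theorem finite_global (hE : E.IsMinimalExtension) :
    Module.Finite (Pol V) E.toFanSheaf.global := finite_sections fun σ _ => hE.finite σ

end IsMinimalExtension

end GradedSheaf

end MinimalExtension

/-! ### The cellular cochains form a complex -/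

section Complex

open Module

variable {V : Type u} [AddCommGroup V] [Module ℝ V] [FiniteDimensional ℝ V]
variable {R : Type*} [CommRing R] {Δ : Finset (PointedCone ℝ V)}

theorem notMem_boundary_of_le {σ τ : Δ} (h : τ.1 ≤ σ.1) (hτ : τ.1 ∉ boundary Δ) :
    σ.1 ∉ boundary Δ := fun hσ => hτ (boundary_mono τ.2 h hσ)

/-- An interior cone of codimension one is a facet of exactly two cones. -/
theorem IsFan.exists_wall_pair (h : IsFan Δ) (hp : IsPure Δ) (τ : Cell Δ (boundary Δ) 1) :
    ∃ γ₁ γ₂ : Cell Δ (boundary Δ) 0, γ₁ ≠ γ₂ ∧ τ.1.1 ≤ γ₁.1.1 ∧ τ.1.1 ≤ γ₂.1.1 ∧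
      ∀ γ : Cell Δ (boundary Δ) 0, τ.1.1 ≤ γ.1.1 → γ = γ₁ ∨ γ = γ₂ := by
  obtain ⟨γ₁, hγ₁, hle₁, hd₁⟩ := hp.exists_top τ.1.2
  -- With only one full-dimensional cone above it, `τ` would generate part of the boundary.
  have hex : ∃ γ₂ ∈ Δ, τ.1.1 ≤ γ₂ ∧ cdim γ₂ = finrank ℝ V ∧ γ₂ ≠ γ₁ := by
    by_contra! hcon
    refine τ.2.1 ⟨τ.1.2, τ.1.1, τ.1.2, τ.2.2, ⟨γ₁, ⟨hγ₁, hd₁, hle₁⟩, ?_⟩, le_rfl⟩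
    rintro γ ⟨hγ, hd, hle⟩
    exact hcon γ hγ hle hd
  obtain ⟨γ₂, hγ₂, hle₂, hd₂, hne⟩ := hex
  refine ⟨⟨⟨γ₁, hγ₁⟩, notMem_boundary hd₁, hd₁⟩, ⟨⟨γ₂, hγ₂⟩, notMem_boundary hd₂, hd₂⟩,
    fun e => hne (congrArg (fun γ => γ.1.1) e).symm, hle₁, hle₂, fun γ hγ => ?_⟩
  rcases h.wall_unique τ.1.2 hγ₁ hγ₂ γ.1.2 hle₁ hle₂ hγ τ.2.2 hd₁ hd₂ γ.2.2 hne.symm with e | e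
  · exact Or.inl (Subtype.ext (Subtype.ext e))
  · exact Or.inr (Subtype.ext (Subtype.ext e))

namespace FanSheaf

/-- At each interior wall the two adjacent cones contribute the same restriction with opposite
coefficients. -/
theorem coboundary_augmentation (F : FanSheaf.{u, w} R Δ) (h : IsFan Δ) (hp : IsPure Δ)
    (o : Orient Δ) (f : F.global) : F.coboundary o (boundary Δ) 0 (F.augmentation f) = 0 := by
  classical
  funext τ
  obtain ⟨γ₁, γ₂, hne, h₁, h₂, huniq⟩ := h.exists_wall_pair hp τ
  rw [coboundary_apply, Finset.sum_eq_add γ₁ γ₂ hne]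
  · rw [dif_pos h₁, dif_pos h₂, augmentation_apply, augmentation_apply,
      f.2 ⟨γ₁.1, trivial⟩ ⟨τ.1, trivial⟩ h₁, f.2 ⟨γ₂.1, trivial⟩ ⟨τ.1, trivial⟩ h₂, ← add_smul,
      o.coeff_wall h h₁ h₂ τ.2.2 γ₁.2.2 γ₂.2.2 (fun e => hne (Subtype.ext e)), zero_smul]
    rfl
  · rintro γ - ⟨hn₁, hn₂⟩
    exact dif_neg fun hle => (huniq γ hle).elim hn₁ hn₂
  · exact fun hn => absurd (Finset.mem_univ _) hn
  · exact fun hn => absurd (Finset.mem_univ _) hn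

theorem coboundary_coboundary (F : FanSheaf.{u, w} R Δ) (h : IsFan Δ) (o : Orient Δ) (k : ℕ)
    (f : F.Cochain (boundary Δ) k) :
    F.coboundary o (boundary Δ) (k + 1) (F.coboundary o (boundary Δ) k f) = 0 := by
  classical
  funext τ
  rw [coboundary_apply]
  have h1 : ∀ ρ : Cell Δ (boundary Δ) (k + 1),
      (if hτ : τ.1.1 ≤ ρ.1.1 then o.coeff ρ.1 τ.1 • F.res hτ (F.coboundary o (boundary Δ) k f ρ)
        else 0) = ∑ γ : Cell Δ (boundary Δ) k,
        if hh : τ.1.1 ≤ ρ.1.1 ∧ ρ.1.1 ≤ γ.1.1 then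
          (o.coeff γ.1 ρ.1 * o.coeff ρ.1 τ.1) • F.res (hh.1.trans hh.2) (f γ) else 0 := by
    intro ρ
    split_ifs with hτ
    · rw [coboundary_apply, map_sum, Finset.smul_sum]
      refine Finset.sum_congr rfl fun γ _ => ?_
      by_cases hγ : ρ.1.1 ≤ γ.1.1
      · rw [dif_pos hγ, dif_pos ⟨hτ, hγ⟩, map_zsmul, F.res_res, smul_smul, mul_comm]
      · rw [dif_neg hγ, dif_neg (fun hh => hγ hh.2), map_zero, smul_zero]
    · exact (Finset.sum_eq_zero fun γ _ => dif_neg fun hh => hτ hh.1).symm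
  rw [Finset.sum_congr rfl fun ρ _ => h1 ρ, Finset.sum_comm]
  refine Finset.sum_eq_zero fun γ _ => ?_
  by_cases hle : τ.1.1 ≤ γ.1.1
  swap
  · exact Finset.sum_eq_zero fun ρ _ => dif_neg fun hh => hle (hh.1.trans hh.2)
  have hdγ := γ.2.2
  have hdτ := τ.2.2
  have hd : cdim γ.1.1 = cdim τ.1.1 + 2 := by omega
  obtain ⟨ρ₁, hρ₁, ρ₂, hρ₂, hne, ⟨a₁, b₁, d₁⟩, ⟨a₂, b₂, d₂⟩, huniq⟩ :=
    h.diamond τ.1.2 γ.1.2 hle hd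
  -- Both middle cones of the diamond are interior because `τ` is, so neither cancelling term is
  -- missing.
  let c₁ : Cell Δ (boundary Δ) (k + 1) :=
    ⟨⟨ρ₁, hρ₁⟩, notMem_boundary_of_le (σ := ⟨ρ₁, hρ₁⟩) a₁ τ.2.1, by
      change cdim ρ₁ + (k + 1) = _
      omega⟩
  let c₂ : Cell Δ (boundary Δ) (k + 1) :=
    ⟨⟨ρ₂, hρ₂⟩, notMem_boundary_of_le (σ := ⟨ρ₂, hρ₂⟩) a₂ τ.2.1, by
      change cdim ρ₂ + (k + 1) = _
      omega⟩
  have hc : c₁ ≠ c₂ := fun e => hne (congrArg (fun γ => γ.1.1) e)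
  rw [Finset.sum_eq_add c₁ c₂ hc]
  · rw [dif_pos ⟨a₁, b₁⟩, dif_pos ⟨a₂, b₂⟩, ← add_smul,
      o.coeff_diamond h (ρ₁ := c₁.1) (ρ₂ := c₂.1) a₁ a₂ b₁ b₂ (fun e => hc (Subtype.ext e))
        d₁ d₂ hd, zero_smul]
  · rintro ρ - ⟨hn₁, hn₂⟩
    refine dif_neg fun hh => ?_
    have hdρ := ρ.2.2
    rcases huniq ρ.1.1 ρ.1.2 hh.1 hh.2 (by omega) with e | e
    · exact hn₁ (Subtype.ext (Subtype.ext e))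
    · exact hn₂ (Subtype.ext (Subtype.ext e))
  · exact fun hn => absurd (Finset.mem_univ _) hn
  · exact fun hn => absurd (Finset.mem_univ _) hn

theorem coboundary_eq_zero (F : FanSheaf.{u, w} R Δ) (h : IsFan Δ) (hp : IsPure Δ) (o : Orient Δ)
    {k : ℕ} {z : F.Cochain (boundary Δ) k} (hz : z ∈ F.coboundaries o k) :
    F.coboundary o (boundary Δ) k z = 0 := by
  cases k with
  | zero =>
    obtain ⟨g, rfl⟩ := hz
    exact F.coboundary_augmentation h hp o g
  | succ k =>
    obtain ⟨g, rfl⟩ := hz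
    exact F.coboundary_coboundary h o k g

theorem exactAt_of_forall (F : FanSheaf.{u, w} R Δ) (h : IsFan Δ) (hp : IsPure Δ) {o : Orient Δ}
    {k : ℕ} (hF : ∀ z, F.coboundary o (boundary Δ) k z = 0 → z ∈ F.coboundaries o k) :
    F.ExactAt o k :=
  (F.exactAt_iff o k).2 fun z => ⟨hF z, F.coboundary_eq_zero h hp o⟩

/-- A global section is determined by its values on the cones of full dimension. -/
theorem augmentation_injective (F : FanSheaf.{u, w} R Δ) (hp : IsPure Δ) :
    Function.Injective F.augmentation := by
  rw [injective_iff_map_eq_zero]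
  intro f hf
  refine Subtype.ext (funext fun σ => ?_)
  obtain ⟨γ, hγ, hle, hd⟩ := hp.exists_top σ.1.2
  rw [← f.2 ⟨⟨γ, hγ⟩, trivial⟩ σ hle]
  have h1 : f.1 ⟨⟨γ, hγ⟩, trivial⟩ = 0 := congrFun hf ⟨⟨γ, hγ⟩, notMem_boundary hd, hd⟩
  rw [h1, map_zero]
  rfl

theorem isAugAcyclic_iff_exactAt (F : FanSheaf.{u, w} R Δ) (hp : IsPure Δ) (o : Orient Δ) :
    F.IsAugAcyclic o ↔ ∀ k, F.ExactAt o k := by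
  rw [isAugAcyclic_iff, and_iff_right (F.augmentation_injective hp)]

end FanSheaf

end Complex

/-! ### Star sheaves: the last two degrees -/

section StarEnds

open Module

variable {V : Type u} [AddCommGroup V] [Module ℝ V] [FiniteDimensional ℝ V]
variable {Δ : Finset (PointedCone ℝ V)}

open Classical in
theorem starSheaf_coboundary_apply (o : Orient Δ) (s : Δ) {k : ℕ} {Λ : Set (PointedCone ℝ V)}
    (f : (starSheaf s ℝ).Cochain Λ k) (τ : Cell Δ Λ (k + 1)) (hτ : s.1 ≤ τ.1.1) :
    (starSheaf s ℝ).coboundary o Λ k f τ ⟨hτ⟩ = ∑ σ : Cell Δ Λ k,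
      if h : τ.1.1 ≤ σ.1.1 then (o.coeff σ.1 τ.1 : ℝ) * f σ ⟨hτ.trans h⟩ else 0 := by
  have e := congrFun (FanSheaf.coboundary_apply (starSheaf s ℝ) o Λ k f τ)
    (⟨hτ⟩ : PLift (s.1 ≤ τ.1.1))
  refine e.trans (Eq.trans (Finset.sum_apply (M := fun _ : PLift (s.1 ≤ τ.1.1) => ℝ) _ _ _) ?_)
  refine Finset.sum_congr rfl fun σ _ => ?_
  split_ifs with h
  · exact zsmul_eq_mul _ _
  · rfl

theorem starSheaf_cochain_ext {s : Δ} {k : ℕ} {Λ : Set (PointedCone ℝ V)}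
    {f g : (starSheaf s ℝ).Cochain Λ k} (h : ∀ σ (hσ : s.1 ≤ σ.1.1), f σ ⟨hσ⟩ = g σ ⟨hσ⟩) :
    f = g := funext fun σ => funext fun hσ => h σ hσ.down

/-- The constant global section of a star sheaf. -/
def starConst (s : Δ) (c : ℝ) : (starSheaf s ℝ).global :=
  ⟨fun _ _ => c, fun _ _ _ => rfl⟩

theorem starSheaf_mem_coboundaries_zero {o : Orient Δ} {s : Δ} (c : ℝ)
    {z : (starSheaf s ℝ).Cochain (boundary Δ) 0} (h : ∀ σ (hσ : s.1 ≤ σ.1.1), z σ ⟨hσ⟩ = c) :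
    z ∈ (starSheaf s ℝ).coboundaries o 0 :=
  ⟨starConst s c, (starSheaf_cochain_ext h).symm⟩

theorem starSheaf_exactAt_of_lt (h : IsFan Δ) (hp : IsPure Δ) (o : Orient Δ) (s : Δ) {k : ℕ}
    (hk : finrank ℝ V < cdim s.1 + k) : (starSheaf s ℝ).ExactAt o k := by
  refine FanSheaf.exactAt_of_forall _ h hp fun z _ => ?_
  convert Submodule.zero_mem _
  refine starSheaf_cochain_ext fun σ hσ => ?_
  have := cdim_mono hσ
  have := σ.2.2
  omega

open Classical in
/-- The cochain with value `r` at the cell `a`, and zero elsewhere. -/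
def starSingle (s : Δ) {k : ℕ} {Λ : Set (PointedCone ℝ V)} (a : Cell Δ Λ k) (r : ℝ) :
    (starSheaf s ℝ).Cochain Λ k := fun σ _ => if σ = a then r else 0

theorem starSheaf_coboundary_single (o : Orient Δ) (s : Δ) {k : ℕ} {Λ : Set (PointedCone ℝ V)}
    (a : Cell Δ Λ k) (r : ℝ) (τ : Cell Δ Λ (k + 1)) (hτ : s.1 ≤ τ.1.1) (hle : τ.1.1 ≤ a.1.1) :
    (starSheaf s ℝ).coboundary o Λ k (starSingle s a r) τ ⟨hτ⟩ = (o.coeff a.1 τ.1 : ℝ) * r := by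
  classical
  rw [starSheaf_coboundary_apply, Finset.sum_eq_single a]
  · rw [dif_pos hle, starSingle, if_pos rfl]
  · intro σ _ hσ
    split_ifs with h1
    · rw [starSingle, if_neg hσ, mul_zero]
    · rfl
  · exact fun hn => absurd (Finset.mem_univ _) hn

theorem starSheaf_coboundary_single_of_not_le (o : Orient Δ) (s : Δ) {k : ℕ}
    {Λ : Set (PointedCone ℝ V)} (a : Cell Δ Λ k) (r : ℝ) (τ : Cell Δ Λ (k + 1))
    (hτ : s.1 ≤ τ.1.1) (hle : ¬ τ.1.1 ≤ a.1.1) :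
    (starSheaf s ℝ).coboundary o Λ k (starSingle s a r) τ ⟨hτ⟩ = 0 := by
  classical
  rw [starSheaf_coboundary_apply]
  refine Finset.sum_eq_zero fun σ _ => ?_
  split_ifs with h1
  · rw [starSingle, if_neg (fun e : σ = a => hle (by rw [← e]; exact h1)), mul_zero]
  · rfl

theorem Orient.coeff_mul_self (o : Orient Δ) (σ τ : Δ) :
    (o.coeff σ τ : ℝ) * (o.coeff σ τ : ℝ) = 1 := by
  rcases o.coeff_eq σ τ with e | e <;> rw [e] <;> norm_num

/-- The only possible cell over `s` of this codimension is `s` itself. Its value is hit by a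
constant section if `k = 0`, and by a cochain on a single atom otherwise. -/
theorem starSheaf_exactAt_last (h : IsFan Δ) (hp : IsPure Δ) (o : Orient Δ) (s : Δ) {k : ℕ}
    (hk : cdim s.1 + k = finrank ℝ V) : (starSheaf s ℝ).ExactAt o k := by
  refine FanSheaf.exactAt_of_forall _ h hp fun z _ => ?_
  have heq : ∀ σ : Cell Δ (boundary Δ) k, s.1 ≤ σ.1.1 → σ.1 = s := fun σ hσ => by
    have := σ.2.2
    exact (Subtype.ext (h.eq_of_cdim_le s.2 σ.1.2 hσ (by omega))).symm
  by_cases hs : s.1 ∈ boundary Δ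
  · convert Submodule.zero_mem _
    exact starSheaf_cochain_ext fun σ hσ => absurd hs (heq σ hσ ▸ σ.2.1)
  let s' : Cell Δ (boundary Δ) k := ⟨s, hs, hk⟩
  have heq' : ∀ σ : Cell Δ (boundary Δ) k, s.1 ≤ σ.1.1 → σ = s' :=
    fun σ hσ => Subtype.ext (heq σ hσ)
  cases k with
  | zero =>
    refine starSheaf_mem_coboundaries_zero (z s' ⟨le_rfl⟩) fun σ hσ => ?_
    obtain rfl := heq' σ hσ
    rfl
  | succ k =>
    obtain ⟨γ, hγ, hle, hd⟩ := hp.exists_top s.2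
    obtain ⟨ρ, hρ, hsρ, -, hdρ⟩ := h.exists_atom s.2 hγ hle (by rintro rfl; omega)
    let a : Cell Δ (boundary Δ) k := ⟨⟨ρ, hρ⟩, notMem_boundary_of_le (σ := ⟨ρ, hρ⟩) hsρ hs, by
      change cdim ρ + k = _
      omega⟩
    refine ⟨starSingle s a ((o.coeff a.1 s : ℝ) * z s' ⟨le_rfl⟩),
      starSheaf_cochain_ext fun σ hσ => ?_⟩
    obtain rfl := heq' σ hσ
    rw [starSheaf_coboundary_single o s a _ s' hσ hsρ, ← mul_assoc]
    change (o.coeff a.1 s : ℝ) * (o.coeff a.1 s : ℝ) * _ = _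
    rw [o.coeff_mul_self, one_mul]

/-- Either `s` is a boundary wall below a single full-dimensional cone, or there are two, and the
cocycle condition equates their values. -/
theorem starSheaf_exactAt_wall (h : IsFan Δ) (hp : IsPure Δ) (o : Orient Δ) (s : Δ)
    (hd : cdim s.1 + 1 = finrank ℝ V) : (starSheaf s ℝ).ExactAt o 0 := by
  classical
  refine FanSheaf.exactAt_of_forall _ h hp fun z hz => ?_
  by_cases hs : s.1 ∈ boundary Δ
  · obtain ⟨-, ρ, hρ, hdρ, ⟨γ, ⟨hγ, hdγ, hργ⟩, huniq⟩, hsρ⟩ := hs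
    obtain rfl : s.1 = ρ := h.eq_of_cdim_le s.2 hρ hsρ (by omega)
    let γ' : Cell Δ (boundary Δ) 0 := ⟨⟨γ, hγ⟩, notMem_boundary hdγ, hdγ⟩
    refine starSheaf_mem_coboundaries_zero (z γ' ⟨hργ⟩) fun σ hσ => ?_
    obtain rfl : σ = γ' := Subtype.ext (Subtype.ext (huniq σ.1.1 ⟨σ.1.2, σ.2.2, hσ⟩))
    rfl
  · let s' : Cell Δ (boundary Δ) 1 := ⟨s, hs, hd⟩
    obtain ⟨γ₁, γ₂, hne, h₁, h₂, huniq⟩ := h.exists_wall_pair hp s'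
    have e := congrFun (congrFun hz s') (⟨le_rfl⟩ : PLift (s.1 ≤ s.1))
    have e' := (starSheaf_coboundary_apply o s z s' le_rfl).symm.trans e
    rw [Finset.sum_eq_add γ₁ γ₂ hne, dif_pos h₁, dif_pos h₂] at e'
    · have hw := o.coeff_wall h (ρ := s) h₁ h₂ hd γ₁.2.2 γ₂.2.2 (fun e => hne (Subtype.ext e))
      have hw' : (o.coeff γ₂.1 s : ℝ) = -(o.coeff γ₁.1 s : ℝ) := by
        rw [eq_neg_iff_add_eq_zero, add_comm]
        exact_mod_cast hw
      change (o.coeff γ₁.1 s : ℝ) * z γ₁ ⟨h₁⟩ + (o.coeff γ₂.1 s : ℝ) * z γ₂ ⟨h₂⟩ = (0 : ℝ) at e'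
      have hsq := o.coeff_mul_self γ₁.1 s
      have hz12 : z γ₂ ⟨h₂⟩ = z γ₁ ⟨h₁⟩ := by
        generalize z γ₁ ⟨h₁⟩ = x at *
        generalize z γ₂ ⟨h₂⟩ = y at *
        change ℝ at x y
        rw [hw'] at e'
        have : (o.coeff γ₁.1 s : ℝ) * (x - y) = 0 := by linarith
        have hx : x - y = 0 := by
          calc x - y = (o.coeff γ₁.1 s : ℝ) * ((o.coeff γ₁.1 s : ℝ) * (x - y)) := by
                rw [← mul_assoc, hsq, one_mul]
            _ = 0 := by rw [this, mul_zero]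
        linarith
      refine starSheaf_mem_coboundaries_zero (z γ₁ ⟨h₁⟩) fun σ hσ => ?_
      rcases huniq σ hσ with rfl | rfl
      exacts [rfl, hz12]
    · rintro γ - ⟨hn₁, hn₂⟩
      exact dif_neg fun hle => (huniq γ hle).elim hn₁ hn₂
    · exact fun hn => absurd (Finset.mem_univ _) hn
    · exact fun hn => absurd (Finset.mem_univ _) hn

end StarEnds

/-! ### Star sheaves: the degree before the last. -/

section StarPenultimate

open Module

variable {V : Type u} [AddCommGroup V] [Module ℝ V] [FiniteDimensional ℝ V]
variable {Δ : Finset (PointedCone ℝ V)}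

open Classical in
theorem starSheaf_functional_apply {s : Δ} {k : ℕ} {Λ : Set (PointedCone ℝ V)}
    (φ : (starSheaf s ℝ).Cochain Λ k →ₗ[ℝ] ℝ) (f : (starSheaf s ℝ).Cochain Λ k) :
    φ f = ∑ a : Cell Δ Λ k, if h : s.1 ≤ a.1.1 then f a ⟨h⟩ * φ (starSingle s a 1) else 0 := by
  have hf : f = ∑ a : Cell Δ Λ k,
      (if h : s.1 ≤ a.1.1 then f a ⟨h⟩ else 0 : ℝ) • starSingle s a 1 := by
    refine starSheaf_cochain_ext fun σ hσ => ?_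
    have e1 : (∑ a : Cell Δ Λ k,
        (if h : s.1 ≤ a.1.1 then f a ⟨h⟩ else 0 : ℝ) • starSingle s a 1) σ =
        ∑ a : Cell Δ Λ k, ((if h : s.1 ≤ a.1.1 then f a ⟨h⟩ else 0 : ℝ) • starSingle s a 1) σ :=
      Finset.sum_apply _ _ _
    have e2 := (congrFun e1 (⟨hσ⟩ : PLift (s.1 ≤ σ.1.1))).trans
      (Finset.sum_apply (M := fun _ : PLift (s.1 ≤ σ.1.1) => ℝ) _ _ _)
    refine Eq.trans ?_ e2.symm
    symm
    refine (Finset.sum_eq_single σ (fun a _ ha => ?_)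
      (fun hn => absurd (Finset.mem_univ _) hn)).trans ?_
    · change (_ : ℝ) * (if σ = a then (1 : ℝ) else 0) = 0
      rw [if_neg (Ne.symm ha), mul_zero]
    · change (if h : s.1 ≤ σ.1.1 then f σ ⟨h⟩ else 0 : ℝ) * (if σ = σ then (1 : ℝ) else 0) = _
      rw [if_pos rfl, mul_one, dif_pos hσ]
  conv_lhs => rw [hf]
  rw [map_sum]
  refine Finset.sum_congr rfl fun a _ => ?_
  rw [map_smul]
  split_ifs with h
  · rfl
  · exact zero_mul _

/-- By duality: a functional on cochains over the atoms that kills coboundaries becomes a locally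
constant function, and exactness at `C^0` makes it constant. It is then a multiple of the coboundary
at `s`, so it kills all cocycles. -/
theorem starSheaf_exactAt_penultimate (h : IsFan Δ) (hp : IsPure Δ) (o : Orient Δ) (s : Δ) {k : ℕ}
    (hd : cdim s.1 + (k + 1) + 1 = finrank ℝ V) (h0 : (starSheaf s ℝ).ExactAt o 0) :
    (starSheaf s ℝ).ExactAt o (k + 1) := by
  classical
  refine FanSheaf.exactAt_of_forall _ h hp fun z hz => ?_
  by_contra hzm
  obtain ⟨φ, hφz, hφ⟩ := Submodule.exists_le_ker_of_notMem hzm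
  refine hφz ?_
  -- The values of the functional on the atoms are normalized by the coefficient over `s` and
  -- extended by zero to boundary cones.
  let ψ : PointedCone ℝ V → ℝ := fun p =>
    if hp : ∃ a : Cell Δ (boundary Δ) (k + 1), a.1.1 = p then
      (o.coeff hp.choose.1 s : ℝ) * φ (starSingle s hp.choose 1) else 0
  have hψ : ∀ a : Cell Δ (boundary Δ) (k + 1),
      ψ a.1.1 = (o.coeff a.1 s : ℝ) * φ (starSingle s a 1) := by
    intro a
    have hex : ∃ a' : Cell Δ (boundary Δ) (k + 1), a'.1.1 = a.1.1 := ⟨a, rfl⟩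
    have e : hex.choose = a := Subtype.ext (Subtype.ext hex.choose_spec)
    change (if hp : _ then _ else _) = _
    rw [dif_pos hex, e]
  have hΦ : ∀ a : Cell Δ (boundary Δ) (k + 1),
      φ (starSingle s a 1) = (o.coeff a.1 s : ℝ) * ψ a.1.1 := fun a => by
    rw [hψ, ← mul_assoc, o.coeff_mul_self, one_mul]
  have hψ0 : ∀ p ∈ boundary Δ, ψ p = 0 := by
    intro p hpb
    refine dif_neg ?_
    rintro ⟨a, rfl⟩
    exact a.2.1 hpb
  -- `ψ` is constant on the atoms of the cones of relative dimension two
  have hrank : ∀ e ∈ Δ, s.1 ≤ e → cdim e = cdim s.1 + 2 → ∀ a ∈ Δ, ∀ a' ∈ Δ, s.1 ≤ a → s.1 ≤ a' →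
      a ≤ e → a' ≤ e → cdim a = cdim s.1 + 1 → cdim a' = cdim s.1 + 1 → ψ a = ψ a' := by
    intro e he hse hde a ha a' ha' hsa hsa' hae hae' hda hda'
    by_cases heb : e ∈ boundary Δ
    · rw [hψ0 a (boundary_mono ha hae heb), hψ0 a' (boundary_mono ha' hae' heb)]
    obtain ⟨ρ₁, hρ₁, ρ₂, hρ₂, hne, ⟨a₁, b₁, d₁⟩, ⟨a₂, b₂, d₂⟩, huniq⟩ := h.diamond s.2 he hse hde
    let c : Cell Δ (boundary Δ) k := ⟨⟨e, he⟩, heb, by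
      change cdim e + k = _
      omega⟩
    let T : Δ → ℝ := fun ρ => if s.1 ≤ ρ.1 ∧ ρ.1 ≤ e ∧ cdim ρ.1 = cdim s.1 + 1 then
      (o.coeff c.1 ρ : ℝ) * o.coeff ρ s * ψ ρ.1 else 0
    -- The functional kills the coboundary of the cochain concentrated on `e`. The diamond relation
    -- turns this into equality of `ψ` on the two atoms of `e`, also when one of them is in the
    -- boundary.
    have h1 : φ ((starSheaf s ℝ).coboundary o (boundary Δ) k (starSingle s c 1)) = 0 :=
      hφ ⟨_, rfl⟩
    have h2 : φ ((starSheaf s ℝ).coboundary o (boundary Δ) k (starSingle s c 1)) = ∑ ρ, T ρ := by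
      rw [starSheaf_functional_apply]
      refine Finset.sum_of_injOn (fun a => a.1) (fun _ _ _ _ e => Subtype.ext e)
        (fun _ _ => Finset.mem_coe.2 (Finset.mem_univ _)) ?_ ?_
      · intro ρ _ hρ
        by_cases hcond : s.1 ≤ ρ.1 ∧ ρ.1 ≤ e ∧ cdim ρ.1 = cdim s.1 + 1
        · by_cases hρb : ρ.1 ∈ boundary Δ
          · change (if _ then _ else _) = _
            rw [hψ0 _ hρb, mul_zero, ite_self]
          · exact absurd ⟨⟨ρ, hρb, by have := hcond.2.2; omega⟩,
              Finset.mem_coe.2 (Finset.mem_univ _), rfl⟩ hρ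
        · exact if_neg hcond
      · intro ρ _
        have hdρ := ρ.2.2
        by_cases hs : s.1 ≤ ρ.1.1
        · rw [dif_pos hs]
          by_cases hle : ρ.1.1 ≤ e
          · rw [starSheaf_coboundary_single o s c 1 ρ hs hle, hΦ]
            change _ = if _ then _ else _
            rw [if_pos ⟨hs, hle, by omega⟩]
            ring
          · rw [starSheaf_coboundary_single_of_not_le o s c 1 ρ hs hle, zero_mul]
            exact (if_neg fun hc => hle hc.2.1).symm
        · rw [dif_neg hs]
          exact (if_neg fun hc => hs hc.1).symm
    have hne' : (⟨ρ₁, hρ₁⟩ : Δ) ≠ ⟨ρ₂, hρ₂⟩ := fun e => hne (congrArg Subtype.val e)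
    have h3 : ∑ ρ, T ρ = T ⟨ρ₁, hρ₁⟩ + T ⟨ρ₂, hρ₂⟩ := by
      refine Finset.sum_eq_add _ _ hne' ?_ (fun hn => absurd (Finset.mem_univ _) hn)
        (fun hn => absurd (Finset.mem_univ _) hn)
      rintro ρ - ⟨hn₁, hn₂⟩
      refine if_neg fun hc => ?_
      rcases huniq ρ.1 ρ.2 hc.1 hc.2.1 hc.2.2 with e | e
      · exact hn₁ (Subtype.ext e)
      · exact hn₂ (Subtype.ext e)
    have e1 : T ⟨ρ₁, hρ₁⟩ = (o.coeff c.1 ⟨ρ₁, hρ₁⟩ : ℝ) * o.coeff ⟨ρ₁, hρ₁⟩ s * ψ ρ₁ :=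
      if_pos ⟨a₁, b₁, d₁⟩
    have e2 : T ⟨ρ₂, hρ₂⟩ = (o.coeff c.1 ⟨ρ₂, hρ₂⟩ : ℝ) * o.coeff ⟨ρ₂, hρ₂⟩ s * ψ ρ₂ :=
      if_pos ⟨a₂, b₂, d₂⟩
    have h4 := o.coeff_diamond h (γ := c.1) (ρ₁ := ⟨ρ₁, hρ₁⟩) (ρ₂ := ⟨ρ₂, hρ₂⟩) (τ := s)
      a₁ a₂ b₁ b₂ hne' d₁ d₂ hde
    have h4' : (o.coeff c.1 ⟨ρ₂, hρ₂⟩ : ℝ) * o.coeff ⟨ρ₂, hρ₂⟩ s =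
        -((o.coeff c.1 ⟨ρ₁, hρ₁⟩ : ℝ) * o.coeff ⟨ρ₁, hρ₁⟩ s) := by
      rw [eq_neg_iff_add_eq_zero, add_comm]
      exact_mod_cast h4
    have h5 : ψ ρ₁ = ψ ρ₂ := by
      rw [h1, h3, e1, e2, h4'] at h2
      have hu : (o.coeff c.1 ⟨ρ₁, hρ₁⟩ : ℝ) * o.coeff ⟨ρ₁, hρ₁⟩ s ≠ 0 :=
        mul_ne_zero (left_ne_zero_of_mul_eq_one (o.coeff_mul_self _ _))
          (left_ne_zero_of_mul_eq_one (o.coeff_mul_self _ _))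
      have h6 : ((o.coeff c.1 ⟨ρ₁, hρ₁⟩ : ℝ) * o.coeff ⟨ρ₁, hρ₁⟩ s) * (ψ ρ₁ - ψ ρ₂) = 0 := by
        linarith
      exact sub_eq_zero.1 ((mul_eq_zero.1 h6).resolve_left hu)
    rcases huniq a ha hsa hae hda with rfl | rfl <;>
      rcases huniq a' ha' hsa' hae' hda' with rfl | rfl <;> simp [h5]
  -- the induced function on the cones of full dimension is a cocycle, hence constant
  have hatom : ∀ σ ∈ Δ, s.1 ≤ σ → cdim s.1 < cdim σ →
      ∃ ρ ∈ Δ, s.1 ≤ ρ ∧ ρ ≤ σ ∧ cdim ρ = cdim s.1 + 1 := fun σ hσ hle hlt =>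
    h.exists_atom s.2 hσ hle (by
      rintro rfl
      exact lt_irrefl _ hlt)
  have hatom' : ∀ (σ : Cell Δ (boundary Δ) 0), s.1 ≤ σ.1.1 →
      ∃ c : ℝ, ∀ ρ ∈ Δ, s.1 ≤ ρ → ρ ≤ σ.1.1 → cdim ρ = cdim s.1 + 1 → ψ ρ = c := by
    intro σ hσ
    have hdσ := σ.2.2
    obtain ⟨a, ha, hsa, haσ, hda⟩ := hatom σ.1.1 σ.1.2 hσ (by omega)
    exact ⟨ψ a, fun ρ hρ hsρ hρσ hdρ => h.atoms_connected ψ s.2 hrank σ.1.2 hσ (by omega) hρ ha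
      hsρ hsa hρσ haσ hdρ hda⟩
  choose A hA using hatom'
  -- By connectedness of atoms, `ψ` has one value on each full-dimensional cone over `s`. Cones
  -- adjacent along a wall over `s` share an atom in it, so these values form a cocycle.
  let Ψ : (starSheaf s ℝ).Cochain (boundary Δ) 0 := fun σ hσ => A σ hσ.down
  have hΨ : (starSheaf s ℝ).coboundary o (boundary Δ) 0 Ψ = 0 := by
    refine starSheaf_cochain_ext fun τ hτ => ?_
    have hdτ := τ.2.2
    obtain ⟨ρ, hρ, hsρ, hρτ, hdρ⟩ := hatom τ.1.1 τ.1.2 hτ (by omega)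
    obtain ⟨γ₁, γ₂, hne, h₁, h₂, huniq⟩ := h.exists_wall_pair hp τ
    rw [starSheaf_coboundary_apply, Finset.sum_eq_add γ₁ γ₂ hne]
    · rw [dif_pos h₁, dif_pos h₂]
      change (o.coeff γ₁.1 τ.1 : ℝ) * A γ₁ _ + (o.coeff γ₂.1 τ.1 : ℝ) * A γ₂ _ = 0
      rw [← hA γ₁ (hτ.trans h₁) ρ hρ hsρ (hρτ.trans h₁) hdρ,
        ← hA γ₂ (hτ.trans h₂) ρ hρ hsρ (hρτ.trans h₂) hdρ, ← add_mul]
      have := o.coeff_wall h h₁ h₂ τ.2.2 γ₁.2.2 γ₂.2.2 (fun e => hne (Subtype.ext e))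
      have h' : (o.coeff γ₁.1 τ.1 : ℝ) + (o.coeff γ₂.1 τ.1 : ℝ) = 0 := by exact_mod_cast this
      rw [h', zero_mul]
    · rintro γ - ⟨hn₁, hn₂⟩
      exact dif_neg fun hle => (huniq γ hle).elim hn₁ hn₂
    · exact fun hn => absurd (Finset.mem_univ _) hn
    · exact fun hn => absurd (Finset.mem_univ _) hn
  obtain ⟨g, hg⟩ := ((FanSheaf.exactAt_iff _ _ _).1 h0 Ψ).1 hΨ
  obtain ⟨C, hC⟩ : ∃ C : ℝ, ∀ ρ ∈ Δ, s.1 ≤ ρ → cdim ρ = cdim s.1 + 1 → ψ ρ = C := by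
    refine ⟨g.1 ⟨s, trivial⟩ ⟨le_rfl⟩, fun ρ hρ hsρ hdρ => ?_⟩
    obtain ⟨γ, hγ, hle, hdγ⟩ := hp.exists_top hρ
    let γ' : Cell Δ (boundary Δ) 0 := ⟨⟨γ, hγ⟩, notMem_boundary hdγ, hdγ⟩
    rw [hA γ' (hsρ.trans hle) ρ hρ hsρ hle hdρ]
    have e1 : g.1 ⟨γ'.1, trivial⟩ ⟨hsρ.trans hle⟩ = A γ' (hsρ.trans hle) :=
      congrFun (congrFun hg γ') (⟨hsρ.trans hle⟩ : PLift (s.1 ≤ γ))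
    have e2 := congrFun (g.2 ⟨γ'.1, trivial⟩ ⟨s, trivial⟩ (hsρ.trans hle))
      (⟨le_rfl⟩ : PLift (s.1 ≤ s.1))
    exact e1.symm.trans e2
  have hφz' : φ z = C * ∑ a : Cell Δ (boundary Δ) (k + 1),
      if hs : s.1 ≤ a.1.1 then (o.coeff a.1 s : ℝ) * z a ⟨hs⟩ else 0 := by
    rw [starSheaf_functional_apply, Finset.mul_sum]
    refine Finset.sum_congr rfl fun a _ => ?_
    have hda := a.2.2
    split_ifs with hs
    · rw [hΦ, hC a.1.1 a.1.2 hs (by omega)]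
      ring
    · rw [mul_zero]
  rw [hφz']
  -- If `s` lies in a boundary wall, that wall contains an atom where `ψ` is zero, so `C = 0`.
  -- Otherwise the remaining sum is the coboundary of `z` at `s`.
  by_cases hs : s.1 ∈ boundary Δ
  · obtain ⟨-, ρ, hρ, hdρ, hu, hsρ⟩ := hs
    obtain ⟨a, ha, hsa, haρ, hda⟩ := hatom ρ hρ hsρ (by omega)
    rw [← hC a ha hsa hda, hψ0 a ⟨ha, ρ, hρ, hdρ, hu, haρ⟩, zero_mul]
  · let s' : Cell Δ (boundary Δ) (k + 1 + 1) := ⟨s, hs, hd⟩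
    have e := congrFun (congrFun hz s') (⟨le_rfl⟩ : PLift (s.1 ≤ s.1))
    have e' := (starSheaf_coboundary_apply o s z s' le_rfl).symm.trans e
    have e'' : (∑ a : Cell Δ (boundary Δ) (k + 1),
      if hs : s.1 ≤ a.1.1 then (o.coeff a.1 s : ℝ) * z a ⟨hs⟩ else 0) = 0 := e'
    rw [e'', mul_zero]

end StarPenultimate

/-! ### Quasi-convexity and acyclicity -/

section QuasiConvex

open Module

variable {V : Type u} [AddCommGroup V] [Module ℝ V] [FiniteDimensional ℝ V]
variable {Δ : Finset (PointedCone ℝ V)} {E : GradedSheaf.{u, w} Δ}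

namespace GradedSheaf.IsMinimalExtension

/-- Descend from degree `n + 1`, where there are no cells. The kernel in degree `k` is that of a
surjection from `C^k` onto the next kernel, so the bound drops by one. -/
theorem pdLE_ker_coboundary (hE : E.IsMinimalExtension) {o : Orient Δ}
    (hex : ∀ k, E.toFanSheaf.ExactAt o k) (j : ℕ) : ∀ k, k + j = finrank ℝ V + 1 →
    PdLE (Pol V) (LinearMap.ker (E.toFanSheaf.coboundary o (boundary Δ) k)) k := by
  induction j with
  | zero =>
    intro k hk
    have : IsEmpty (Cell Δ (boundary Δ) k) := ⟨fun σ => by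
      have := σ.2.2
      omega⟩
    exact PdLE.of_subsingleton k
  | succ j ih =>
    intro k hk
    have hx := hex (k + 1)
    let f := (LinearMap.ker (E.toFanSheaf.coboundary o (boundary Δ) k)).subtype
    let g := (E.toFanSheaf.coboundary o (boundary Δ) k).codRestrict
      (LinearMap.ker (E.toFanSheaf.coboundary o (boundary Δ) (k + 1)))
      fun x => (hx _).2 ⟨x, rfl⟩
    refine PdLE.left (f := f) (g := g) (fun x => ?_) Subtype.val_injective ?_
      (hE.pdLE_cochain _ k) (ih (k + 1) (by omega))
    · exact ⟨fun h => ⟨⟨x, congrArg Subtype.val h⟩, rfl⟩, fun ⟨y, hy⟩ => Subtype.ext (hy ▸ y.2)⟩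
    · rintro ⟨y, hy⟩
      obtain ⟨x, hx'⟩ := (hx y).1 hy
      exact ⟨x, Subtype.ext hx'⟩

theorem isQuasiConvex_of_exactAt (hE : E.IsMinimalExtension) (hp : IsPure Δ) {o : Orient Δ}
    (hex : ∀ k, E.toFanSheaf.ExactAt o k) : IsQuasiConvex E := by
  have h0 := hE.pdLE_ker_coboundary hex _ 0 (zero_add _)
  have hr : LinearMap.range E.toFanSheaf.augmentation =
      LinearMap.ker (E.toFanSheaf.coboundary o (boundary Δ) 0) := by
    ext z
    exact ((hex 0) z).symm
  let e := (LinearEquiv.ofInjective _ (E.toFanSheaf.augmentation_injective hp)).trans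
    (LinearEquiv.ofEq _ _ hr)
  have := hE.finite_global
  have : Module.Projective (Pol V) E.toFanSheaf.global := pdLE_zero_iff.1 (PdLE.of_equiv e.symm h0)
  exact (E.sectionsGrading Set.univ).free_of_projective

/-- Ascend from the free module of global sections: by exactness the next coboundaries are `C^k`
modulo the present ones, so the bound rises by one. -/
theorem pdLE_coboundaries (hE : E.IsMinimalExtension) (hp : IsPure Δ) (hq : IsQuasiConvex E)
    {o : Orient Δ} (k : ℕ) (hex : ∀ j < k, E.toFanSheaf.ExactAt o j) :
    PdLE (Pol V) (E.toFanSheaf.coboundaries o k) k := by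
  induction k with
  | zero =>
    have : Module.Free (Pol V) E.toFanSheaf.global := hq
    exact PdLE.of_equiv (LinearEquiv.ofInjective _ (E.toFanSheaf.augmentation_injective hp))
      (pdLE_zero_iff.2 inferInstance)
  | succ k ih =>
    let B := E.toFanSheaf.coboundaries o k
    have hQ : PdLE (Pol V) (E.toFanSheaf.Cochain (boundary Δ) k ⧸ B) (k + 1) :=
      PdLE.right (f := B.subtype) (g := B.mkQ) (LinearMap.exact_subtype_mkQ B)
        Subtype.val_injective B.mkQ_surjective (ih fun j hj => hex j (by omega))
        ((hE.pdLE_cochain _ k).mono (Nat.le_succ k))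
    have hB : B = LinearMap.ker (E.toFanSheaf.coboundary o (boundary Δ) k) := by
      ext z
      exact ((FanSheaf.exactAt_iff _ o k).1 (hex k (Nat.lt_succ_self k)) z).symm
    exact PdLE.of_equiv ((Submodule.quotEquivOfEq _ _ hB).trans
      (E.toFanSheaf.coboundary o (boundary Δ) k).quotKerEquivRange) hQ

theorem pdLE_quotient_coboundaries (hE : E.IsMinimalExtension) (hp : IsPure Δ)
    (hq : IsQuasiConvex E) {o : Orient Δ} (k : ℕ) (hex : ∀ j < k, E.toFanSheaf.ExactAt o j) :
    PdLE (Pol V) (E.toFanSheaf.Cochain (boundary Δ) k ⧸ E.toFanSheaf.coboundaries o k) (k + 1) :=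
  PdLE.right (f := (E.toFanSheaf.coboundaries o k).subtype)
    (g := (E.toFanSheaf.coboundaries o k).mkQ) (LinearMap.exact_subtype_mkQ _)
    Subtype.val_injective (Submodule.mkQ_surjective _) (hE.pdLE_coboundaries hp hq k hex)
    ((hE.pdLE_cochain _ k).mono (Nat.le_succ k))

/-- Exactness of star sheaves in the degrees that are controlled by depth. -/
theorem starSheaf_exactAt_of_depth (hE : E.IsMinimalExtension) (hΔ : IsFan Δ) (hp : IsPure Δ)
    (hq : IsQuasiConvex E) {o : Orient Δ} {k : ℕ} (hex : ∀ j < k, E.toFanSheaf.ExactAt o j) (s : Δ)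
    (hs : ∀ s' : Δ, s < s' → (starSheaf s' ℝ).ExactAt o k)
    (hd : cdim s.1 + k + 2 ≤ finrank ℝ V) : (starSheaf s ℝ).ExactAt o k := by
  refine FanSheaf.exactAt_of_forall _ hΔ hp fun z hz => ?_
  have hF := hE.resBoundary_surjective
  obtain ⟨κ, hκ⟩ := hE.exists_locKer_ne_zero hΔ s
  obtain ⟨p, hpi⟩ := E.toFanSheaf.exists_starHom_leftInverse hF s hκ
  -- The regular sequence has length `codim s ≥ k + 2`, beyond the bound `k + 1` on the projective
  -- dimension of the quotient.
  obtain ⟨ls, hlen, hls, hreg⟩ := Pol.exists_isRegular (lspan s.1) (c := finrank ℝ V - cdim s.1)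
    (by rw [cdim] at *; omega)
  have hfin := hE.finite_cochain (boundary Δ) k
  have h0 : (E.toFanSheaf.coboundaries o k).mkQ ((E.toFanSheaf.starHom hF s κ).cochain z) = 0 := by
    refine PdLE.eq_zero_of_isRegular hreg (hE.pdLE_quotient_coboundaries hp hq k hex)
      (by rw [List.length_map, hlen]; omega) fun r hr => ?_
    obtain ⟨ℓ, hℓ, rfl⟩ := List.mem_map.1 hr
    rw [← map_smul]
    exact (Submodule.Quotient.mk_eq_zero _).2 (E.toFanSheaf.smul_starHom_mem hF s κ hs
      (fun x => E.ι_smul_eq_zero (hls ℓ hℓ) x) hz)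
  -- The retraction onto the star sheaf carries the primitive found in `E` back to one for `z`.
  have h1 := p.mem_coboundaries ((Submodule.Quotient.mk_eq_zero _).1 h0)
  convert h1 using 1
  funext σ
  exact (hpi _ _).symm

/-- The induction on `k` makes `E` exact below degree `k`; the downward induction on `s` supplies
the larger cones. Depth settles `codim s ≥ k + 2`, combinatorics the rest. -/
theorem starSheaf_exactAt (hE : E.IsMinimalExtension) (hΔ : IsFan Δ) (hp : IsPure Δ)
    (hq : IsQuasiConvex E) (o : Orient Δ) (k : ℕ) : ∀ s : Δ, (starSheaf s ℝ).ExactAt o k := by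
  induction k using Nat.strong_induction_on with
  | _ k ihk =>
    have hex : ∀ j < k, E.toFanSheaf.ExactAt o j := fun j hj =>
      E.toFanSheaf.exactAt_of_starSheaf hE.resBoundary_surjective (ihk j hj)
    intro s
    induction s using WellFoundedGT.induction with
    | ind s ihs =>
      rcases lt_or_ge (finrank ℝ V) (cdim s.1 + k) with h1 | h1
      · exact starSheaf_exactAt_of_lt hΔ hp o s h1
      rcases h1.eq_or_lt with h2 | h2
      · exact starSheaf_exactAt_last hΔ hp o s h2
      rcases (Nat.succ_le_of_lt h2).eq_or_lt with h3 | h3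
      · cases k with
        | zero => exact starSheaf_exactAt_wall hΔ hp o s h3
        | succ k =>
          exact starSheaf_exactAt_penultimate hΔ hp o s h3 (ihk 0 (Nat.succ_pos k) s)
      · exact hE.starSheaf_exactAt_of_depth hΔ hp hq hex s ihs h3

end GradedSheaf.IsMinimalExtension

end QuasiConvex

end QCFan

end

open QCFan in
theorem theorem3p8 {V : Type u} [AddCommGroup V] [Module ℝ V] [FiniteDimensional ℝ V]
    (Δ : Finset (PointedCone ℝ V)) (hΔ : IsFan Δ) (hpure : IsPure Δ)
    (E : GradedSheaf.{u, w} Δ) (hE : E.IsMinimalExtension)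
    (o : Orient Δ) (o' : ∀ σ : Δ, Orient (transversal Δ σ.1)) :
    List.TFAE [
      ∀ σ : Δ, (constSheaf ℝ (transversal Δ σ.1)).IsAugAcyclic (o' σ),
      E.toFanSheaf.IsAugAcyclic o,
      IsQuasiConvex E] := by
  have h1 : (∀ σ : Δ, (constSheaf ℝ (transversal Δ σ.1)).IsAugAcyclic (o' σ)) ↔
      ∀ σ : Δ, ∀ k, (starSheaf σ ℝ).ExactAt o k := forall_congr' fun σ =>
    (hΔ.transversal_isAugAcyclic_iff hpure o σ (o' σ)).trans
      (FanSheaf.isAugAcyclic_iff_exactAt _ hpure o)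
  rw [h1, FanSheaf.isAugAcyclic_iff_exactAt _ hpure o]
  tfae_have 1 → 2 := fun h k =>
    E.toFanSheaf.exactAt_of_starSheaf hE.resBoundary_surjective fun γ => h γ k
  tfae_have 2 → 3 := fun h => hE.isQuasiConvex_of_exactAt hpure h
  tfae_have 3 → 1 := fun h σ k => hE.starSheaf_exactAt hΔ hpure h o k σ
  tfae_finish
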